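/- Let $d\ge 2$, $\Omega=(-1,1)^d$, $r\Omega=(-r,r)^d$, $0<s<1$, $1<p,q<\infty$. For a weight $a\ge 0$ consider the nonlocal–local energy $$\mathcal J(v)=\mathcal J^s_p(v)+\mathcal J^1_{q,a}(v),\quad \mathcal J^s_p(v)=\int_{\mathbb R^d}\!\int_{\mathbb R^d}\frac1p\frac{|v(x)-v(y)|^p}{|x-y|^{d+sp}}\,dx\,dy,\quad \mathcal J^1_{q,a}(v)=\int_\Omega \frac1q\,a(x)|\nabla v|^q\,dx,$$ where $\nabla v$ is the weak gradient on $\Omega\cap\{a>0\}$ (the second term is $+\infty$ if it does not exist). Let $W_0$ be the set of $v\in L^1_{loc}(\mathbb R^d)$ with $\mathcal J(v)<\infty$ and $v=0$ a.e. outside $\Omega$, and let $H_0$ be the closure of $C_c^\infty(\Omega)$ in $W_0$ with respect to the Luxemburg norm $\inf\{\lambda>0:\mathcal J(v/\lambda)\le 1\}$. A *weight of class $C^\alpha$* is a bounded function $a:\mathbb R^d\to[0,\infty)$ vanishing outside $3\Omega$ with $a\in C^{k,\beta}$, $\alpha=k+\beta$, $k\in\mathbb N_0$, $0<\beta\le1$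 (for $\alpha=0$: $a$ continuous). A *boundary value* is $u_D\in C^\infty(\mathbb R^d)$ vanishing outside $3\Omega$. There is a *Lavrentiev gap* for $a,u_D$ if $\inf\mathcal J(u_D+W_0)<\inf\mathcal J(u_D+H_0)$. (1) (Subcritical case.) If $s-\frac dp<0$, $\alpha>0$ and $q>sp+\alpha$, then there are a weight $a$ of class $C^\alpha$ and a boundary value $u_D$ with a Lavrentiev gap. (2) (Supercritical case.) If $s-\frac dp>0$, $\alpha\in[0,1]$ and $\frac p{p-1}\left(s-\frac dp\right)<\frac q{q-1}\left(1-\frac{d+\alpha}q\right)$, then there are a weight $a$ of class $C^\alpha$ and a boundary value $u_D$ with a Lavrentiev gap. Moreover, explicit Cantor barriers realize the gap. Write $x=(\bar x,x_d)$ and let $\mathfrak C_\lambda\subset[-\frac12,\frac12]$, $0<\lambda<\frac12$, be the Cantor set obtained by repeatedly removing the middle part of relative length $1-2\lambda$, and $\mu_\lambda$ its Cantor measure. For functions $\delta,h\ge0$ and $0<\kappa<\kappa'$, a $(\delta,h,\kappa,\kappa')$-cut-off is a function $\rho$, smooth off $\{\delta=h=0\}$, with $1_{\{\delta\le\kappa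 h\}}\le\rho\le1_{\{\delta\le\kappa' h\}}$ and $|\nabla\rho|\le C/h$ where $h\neq 0$. Let $\eta,\chi$ denote smooth functions with $1_{(-4/6,4/6)^d}\le\eta\le1_{(-5/6,5/6)^d}$ and $1_{2\Omega}\le\chi\le1_{3\Omega}$. (3) Let $s-\frac dp<0$, $\alpha>0$, and let $\lambda\in(0,\frac12)$ be such that $\mathfrak D=(d-1)\frac{\log 2}{\log(1/\lambda)}$ satisfies $s-\frac{d-\mathfrak D}p<0$ and $1-\frac{d-\mathfrak D}q-\frac\alpha q>0$. With $\delta(x)=\mathrm{dist}(\bar x,\mathfrak C_\lambda^{d-1})$ there are a $(\delta,|x_d|,2,4)$-cut-off $\rho$, a $(\delta,|x_d|,\frac12,2)$-cut-off $\rho_a$ and $\eta,\chi$ such that for $$u_C=\chi\,\tfrac12\,\mathrm{sgn}(x_d)\,\rho,\qquad a=\chi\,|x_d|^\alpha\rho_a,\qquad u_D=(1-\eta)u_C$$ the following hold: (i) $\mathcal J^s_p(u_C)<\infty$; (ii) $\mathcal J^1_{q,a}(u_C)=0$; (iii) there is $c_0>0$ with $\mathcal J^1_{q,a}(v)\ge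 c_0$ for all continuous $v$ on $\mathbb R^d$ with $v=u_D$ outside $\Omega$; (iv) $a$ is a weight of class $C^\alpha$, $u_D$ is a boundary value, and for all sufficiently large $\nu$, for the energy with weight $\nu a$, $u_C\in u_D+W_0$ and $\mathcal J(u_C)<\inf\mathcal J(u_D+H_0)$. (4) Let $s-\frac dp>0$, $\alpha\in(0,1]$, and let $\lambda\in(0,\frac12)$ be such that $\mathfrak D=\frac{\log 2}{\log(1/\lambda)}$ satisfies $\frac p{p-1}\left(s-\frac dp\right)<\mathfrak D<\frac q{q-1}\left(1-\frac{d+\alpha}q\right)$. With $\delta(x)=\mathrm{dist}(x_d,\mathfrak C_\lambda)$ there are a function $u_0$, smooth off $0$, with $|u_0|\le\frac12$, $u_0=\frac12\mathrm{sgn}(x_d)$ on $\{|\bar x|\le2|x_d|\}$ and $|\nabla u_0|\le C/|x|$ for $x\ne 0$, a $(\delta,|\bar x|,\frac12,2)$-cut-off $\rho_a$ and $\eta,\chi$ such that for $$u_C=\chi\cdot\big((\delta_0^{d-1}\times\mu_\lambda)*u_0\big),\qquad a=\chi\,|\bar x|^\alpha(1-\rho_a),\qquad u_D=(1-\eta)u_C$$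 (with $\delta_0^{d-1}$ the Dirac measure at $0\in\mathbb R^{d-1}$) properties (i)–(iv) of (3) hold, where (iii) is for all continuous $v$ on $\mathbb R^d$ that are $C^1$ in $\Omega$ and equal $u_D$ outside $\Omega$. -/

import Mathlib

open MeasureTheory Filter Topology
open scoped ENNReal ContDiff

namespace MixedModel

noncomputable section

/-- The open cube `(-r, r)^d`; the domain is `Ω = box d 1`, and `3Ω = box d 3`. -/
def box (d : ℕ) (r : ℝ) : Set (EuclideanSpace ℝ (Fin d)) :=
  {x | ∀ i, |x i| < r}

/-! ### The energy of the nonlocal-local model -/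

/-- The nonlocal phase `∫∫ (1/p) |v(x)-v(y)|^p / |x-y|^(d+sp) dx dy` over `ℝ^d × ℝ^d`. -/
def nonlocalEnergy {d : ℕ} (s p : ℝ) (v : EuclideanSpace ℝ (Fin d) → ℝ) : ℝ≥0∞ :=
  ∫⁻ x, ∫⁻ y, ENNReal.ofReal (1 / p * (|v x - v y| ^ p / ‖x - y‖ ^ ((d : ℝ) + s * p)))

/-- Test functions `C_c^∞(U)`. -/
def IsTestFunction {d : ℕ} (U : Set (EuclideanSpace ℝ (Fin d)))
    (φ : EuclideanSpace ℝ (Fin d) → ℝ) : Prop :=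
  ContDiff ℝ ∞ φ ∧ HasCompactSupport φ ∧ tsupport φ ⊆ U

/-- `g` is the weak gradient of `v` on the open set `U`; both are locally integrable on `U`. -/
def HasWeakGradientOn {d : ℕ} (U : Set (EuclideanSpace ℝ (Fin d)))
    (v : EuclideanSpace ℝ (Fin d) → ℝ)
    (g : EuclideanSpace ℝ (Fin d) → EuclideanSpace ℝ (Fin d)) : Prop :=
  LocallyIntegrableOn v U ∧ LocallyIntegrableOn g U ∧
    ∀ φ, IsTestFunction U φ → ∀ w : EuclideanSpace ℝ (Fin d),
      ∫ x in U, v x * fderiv ℝ φ x w = -∫ x in U, φ x * inner ℝ (g x) w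

/-- The local phase `∫_Ω (1/q) a(x) |∇v|^q dx`. The gradient is the weak gradient on the part
`{a > 0}` of `Ω` where the phase is active (for a continuous weight this is an open set, and the
gradient there is unique almost everywhere); the value is `∞` if there is no weak gradient. -/
def localEnergy {d : ℕ} (q : ℝ) (a v : EuclideanSpace ℝ (Fin d) → ℝ) : ℝ≥0∞ :=
  ⨅ (g : EuclideanSpace ℝ (Fin d) → EuclideanSpace ℝ (Fin d))
    (_ : HasWeakGradientOn (box d 1 ∩ {x | 0 < a x}) v g),
    ∫⁻ x in box d 1, ENNReal.ofReal (1 / q * (a x * ‖g x‖ ^ q))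

/-- The energy of the nonlocal-local model. -/
def energy {d : ℕ} (s p q : ℝ) (a v : EuclideanSpace ℝ (Fin d) → ℝ) : ℝ≥0∞ :=
  nonlocalEnergy s p v + localEnergy q a v

/-- The Luxemburg norm `inf {r > 0 : J(v/r) ≤ 1}` of the energy. -/
def luxemburgNorm {d : ℕ} (s p q : ℝ) (a v : EuclideanSpace ℝ (Fin d) → ℝ) : ℝ≥0∞ :=
  ⨅ (r : ℝ) (_ : 0 < r) (_ : energy s p q a (fun x => v x / r) ≤ 1), ENNReal.ofReal r

/-- The space `W_0` of locally integrable functions of finite energy that vanish outside `Ω`. -/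
def spaceWZero {d : ℕ} (s p q : ℝ) (a : EuclideanSpace ℝ (Fin d) → ℝ) :
    Set (EuclideanSpace ℝ (Fin d) → ℝ) :=
  {v | LocallyIntegrable v ∧ energy s p q a v < ⊤ ∧ ∀ᵐ x, x ∉ box d 1 → v x = 0}

/-- The space `H_0`: the closure of `C_c^∞(Ω)` in `W_0` for the Luxemburg norm. -/
def spaceHZero {d : ℕ} (s p q : ℝ) (a : EuclideanSpace ℝ (Fin d) → ℝ) :
    Set (EuclideanSpace ℝ (Fin d) → ℝ) :=
  {v | v ∈ spaceWZero s p q a ∧ ∀ ε : ℝ≥0∞, 0 < ε →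
    ∃ φ, IsTestFunction (box d 1) φ ∧ luxemburgNorm s p q a (fun x => v x - φ x) < ε}

/-- `u + W_0`. -/
def spaceW {d : ℕ} (s p q : ℝ) (a u : EuclideanSpace ℝ (Fin d) → ℝ) :
    Set (EuclideanSpace ℝ (Fin d) → ℝ) :=
  {v | (fun x => v x - u x) ∈ spaceWZero s p q a}

/-- `u + H_0`. -/
def spaceH {d : ℕ} (s p q : ℝ) (a u : EuclideanSpace ℝ (Fin d) → ℝ) :
    Set (EuclideanSpace ℝ (Fin d) → ℝ) :=
  {v | (fun x => v x - u x) ∈ spaceHZero s p q a}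

/-- The Lavrentiev gap `inf J(u + W_0) < inf J(u + H_0)`. -/
def LavrentievGap {d : ℕ} (s p q : ℝ) (a u : EuclideanSpace ℝ (Fin d) → ℝ) : Prop :=
  ⨅ v ∈ spaceW s p q a u, energy s p q a v < ⨅ v ∈ spaceH s p q a u, energy s p q a v

/-- The class `C^α(ℝ^d)`, that is `C^{k,β}` with `α = k + β`, `k` a natural number and
`0 < β ≤ 1`; for `α = 0` it consists of continuous functions of bounded oscillation. -/
def IsHolder {d : ℕ} (α : ℝ) (a : EuclideanSpace ℝ (Fin d) → ℝ) : Prop :=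
  ContDiff ℝ (⌈α⌉₊ - 1 : ℕ) a ∧
    ∃ C : ℝ, ∀ x y, ‖iteratedFDeriv ℝ (⌈α⌉₊ - 1) a x - iteratedFDeriv ℝ (⌈α⌉₊ - 1) a y‖ ≤
      C * ‖x - y‖ ^ (α - (⌈α⌉₊ - 1 : ℕ))

/-- Non-negative bounded weights of class `C^α` that vanish outside `3Ω`. -/
def IsWeight {d : ℕ} (α : ℝ) (a : EuclideanSpace ℝ (Fin d) → ℝ) : Prop :=
  (∀ x, 0 ≤ a x) ∧ (∃ M, ∀ x, a x ≤ M) ∧ IsHolder α a ∧ ∀ x, x ∉ box d 3 → a x = 0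

/-- Smooth boundary values that vanish outside `3Ω`. -/
def IsBoundaryValue {d : ℕ} (u : EuclideanSpace ℝ (Fin d) → ℝ) : Prop :=
  ContDiff ℝ ∞ u ∧ ∀ x, x ∉ box d 3 → u x = 0

/-! ### Cantor barriers in `ℝ^d`, `d = n + 1`, with points `x = (x̄, x_d)` -/

/-- `x̄`. -/
def horiz {n : ℕ} (x : EuclideanSpace ℝ (Fin (n + 1))) : EuclideanSpace ℝ (Fin n) :=
  WithLp.toLp 2 (fun i => x i.castSucc)

/-- `x_d`. -/
def vert {n : ℕ} (x : EuclideanSpace ℝ (Fin (n + 1))) : ℝ := x (Fin.last n)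

/-- The stages of the Cantor set: from `[-1/2, 1/2]` on, the middle part of relative length
`1 - 2l` is removed from every interval. -/
def cantorStage (l : ℝ) : ℕ → Set ℝ
  | 0 => Set.Icc (-(1 / 2)) (1 / 2)
  | k + 1 => (fun t => l * t - (1 - l) / 2) '' cantorStage l k ∪
      (fun t => l * t + (1 - l) / 2) '' cantorStage l k

/-- The generalized Cantor set with contraction ratio `l`. -/
def cantor (l : ℝ) : Set ℝ := ⋂ k, cantorStage l k

/-- The `m`-fold Cartesian product of the Cantor set. -/
def cantorProd (m : ℕ) (l : ℝ) : Set (EuclideanSpace ℝ (Fin m)) :=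
  {y | ∀ i, y i ∈ cantor l}

/-- The dimension of `cantorProd m l`. -/
def cantorDim (m : ℕ) (l : ℝ) : ℝ := m * Real.log 2 / Real.log (1 / l)

/-- `μ` is the Cantor measure: the weak limit of the normalized Lebesgue measures on the stages. -/
def IsCantorMeasure (l : ℝ) (μ : Measure ℝ) : Prop :=
  IsProbabilityMeasure μ ∧ ∀ f : BoundedContinuousFunction ℝ ℝ,
    Tendsto (fun k : ℕ => ((2 * l) ^ k)⁻¹ * ∫ t in cantorStage l k, f t) atTop
      (𝓝 (∫ t, f t ∂μ))

/-- `ρ` is a cut-off function with `1_{δ ≤ κ h} ≤ ρ ≤ 1_{δ ≤ κ' h}`, smooth away from the barrier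
`{δ = h = 0}`, with `|∇ρ| ≲ 1/h`. -/
def IsConeCutoff {d : ℕ} (δ h : EuclideanSpace ℝ (Fin d) → ℝ) (κ κ' : ℝ)
    (ρ : EuclideanSpace ℝ (Fin d) → ℝ) : Prop :=
  ContDiffOn ℝ ∞ ρ {x | ¬ (δ x = 0 ∧ h x = 0)} ∧
  (∀ x, 0 ≤ ρ x ∧ ρ x ≤ 1) ∧
  (∀ x, δ x ≤ κ * h x → ρ x = 1) ∧
  (∀ x, κ' * h x < δ x → ρ x = 0) ∧
  ∃ C : ℝ, ∀ x, h x ≠ 0 → ‖fderiv ℝ ρ x‖ ≤ C / h x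

/-- `η` is smooth with `1_{(-r,r)^d} ≤ η ≤ 1_{(-R,R)^d}`. -/
def IsBoxCutoff {d : ℕ} (r R : ℝ) (η : EuclideanSpace ℝ (Fin d) → ℝ) : Prop :=
  ContDiff ℝ ∞ η ∧ (∀ x, 0 ≤ η x ∧ η x ≤ 1) ∧ (∀ x ∈ box d r, η x = 1) ∧
    ∀ x, x ∉ box d R → η x = 0

/-- A one-saddle-point function: smooth away from the origin, equal to `sgn(x_d)/2` on the double
cone `|x̄| ≤ 2|x_d|`, with `|∇u| ≲ 1/|x|`. -/
def IsSaddle {n : ℕ} (u : EuclideanSpace ℝ (Fin (n + 1)) → ℝ) : Prop :=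
  ContDiffOn ℝ ∞ u {x | x ≠ 0} ∧ (∀ x, |u x| ≤ 1 / 2) ∧
  (∀ x, ‖horiz x‖ ≤ 2 * |vert x| → u x = 1 / 2 * Real.sign (vert x)) ∧
  ∃ C : ℝ, ∀ x, x ≠ 0 → ‖fderiv ℝ u x‖ ≤ C / ‖x‖

/-- The competitor `uC` has finite nonlocal energy and does not see the local phase, the local
phase has a positive lower bound on the functions of class `V` that agree with `uD` outside `Ω`,
and for every large multiple of the weight `a` the competitor lies in `uD + W_0` and its energy
is below the infimum over `uD + H_0`. -/
def RealizesGap {d : ℕ} (s p q α : ℝ) (V : Set (EuclideanSpace ℝ (Fin d) → ℝ))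
    (a uC uD : EuclideanSpace ℝ (Fin d) → ℝ) : Prop :=
  nonlocalEnergy s p uC < ⊤ ∧
  localEnergy q a uC = 0 ∧
  (∃ c : ℝ≥0∞, 0 < c ∧ ∀ v ∈ V, (∀ x, x ∉ box d 1 → v x = uD x) → c ≤ localEnergy q a v) ∧
  IsWeight α a ∧ IsBoundaryValue uD ∧
  ∃ ν₀ : ℝ, 0 < ν₀ ∧ ∀ ν : ℝ, ν₀ ≤ ν →
    uC ∈ spaceW s p q (fun x => ν * a x) uD ∧
    energy s p q (fun x => ν * a x) uC <
      ⨅ v ∈ spaceH s p q (fun x => ν * a x) uD, energy s p q (fun x => ν * a x) v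

end

end MixedModel

open MixedModel

/-!
The gap comes from a set of fractional dimension, the barrier, which the nonlocal phase and the
local phase see differently. The competitor `u_C` jumps across the barrier, or oscillates there. The
weight vanishes outside a union of double cones, or a conical shell, around the barrier, in which
`u_C` is locally constant, so that `u_C` has no local energy at all. A function without
singularities has to spend a fixed amount of local energy in that region, since the weight
degenerates at the barrier only like a power `α` of the height. Multiplying the weight by a large
number then makes every smooth competitor more expensive than the nonlocal energy of `u_C`
(`realizesGap_of_lower_bound`); the lower bound passes to the closure of the test functions by the
quasi-triangle inequality (`le_energy_of_mem_spaceH`).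

*Finite nonlocal energy.* Let `D` be the distance to the barrier. If a bounded function oscillates at
most like `min (|x - y| ^ θ) (|x - y| D(x) ^ (θ - 1))`, then by scaling the inner integral of the
nonlocal energy is a multiple of `D(x) ^ (-(s - θ) p)`, which is integrable if `(s - θ) p` is less
than the codimension of the barrier (`nonlocalEnergy_lt_top`). In the subcritical case the barrier is
`C ^ (d - 1) × {0}` and `θ = 0`. In the supercritical case it is `{0} × C`, and `u_C` is the
convolution of a function of degree `0` with the Cantor measure. Riesz potentials of order less than
the dimension of that measure are bounded, so `θ` can be chosen arbitrarily close to the minimum of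
this dimension and `s` (`exists_axBarrier_sub_le`).

*Lower bound.* In the subcritical case a continuous function `v` with the boundary values of `u_C` has
different means over the two ends of each double cone with vertex in the barrier. The continuity of
`v` at the vertex allows to bound the difference by the integral of the radial component of the
gradient over the cone, with the weight `|x_d| ^ (1 - d)` (`coneMean_sub_le`); the test functions are
homogeneous of degree `-d` up to a window in `x_d`. Averaging over the vertices with respect to the
Cantor measure improves the weight by the dimension of the barrier. In the supercritical case `v` is
integrated along Lipschitz graphs over the axis that touch it in the Cantor set
(`volume_le_lintegral_axCone`). In both cases Hölder's inequality gives a lower bound for the local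
energy, under the stated condition on the exponents (`exists_lower_bound_of_integral`).

*Regularity of the weights.* Cut-offs to cones are obtained from indicator functions by mollification
at a scale proportional to the height `h` (`coneCutoff`). In the subcritical case all derivatives of
the weight of order `j` are of size `h ^ (α - j)`, which makes it a function of class `C ^ α`
(`contDiff_holder_of_symbolBound`).

*Existence of a gap.* Every dimension between `0` and `1` is that of a Cantor set, and the conditions
on the exponents say that a suitable dimension exists, with two exceptions. In the subcritical case
with `q ≤ 1 + α` no barrier of codimension greater than `1` is available, but then `s p < 1` and `u_C`
may jump along the boundary of the domain (`exists_lavrentievGap_boundary`). In the supercritical case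
with `α = 0` a weight of a small positive order serves the purpose.
-/

open scoped Pointwise

namespace MixedModel

noncomputable section

/-- Euclidean space of dimension `m`. -/
abbrev Eu (m : ℕ) := EuclideanSpace ℝ (Fin m)

/-! ### Coordinates -/

/-- `horiz` as a continuous linear map. -/
def horizL (n : ℕ) : Eu (n + 1) →L[ℝ] Eu n :=
  LinearMap.toContinuousLinearMap
    { toFun := horiz
      map_add' := fun x y => by ext i; simp [horiz]
      map_smul' := fun c x => by ext i; simp [horiz] }

/-- `vert` as a continuous linear map. -/
def vertL (n : ℕ) : Eu (n + 1) →L[ℝ] ℝ :=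
  LinearMap.toContinuousLinearMap
    { toFun := vert
      map_add' := fun x y => by simp [vert]
      map_smul' := fun c x => by simp [vert] }

@[simp] lemma horizL_apply {n : ℕ} (x : Eu (n + 1)) : horizL n x = horiz x := rfl

@[simp] lemma horiz_apply {n : ℕ} (x : Eu (n + 1)) (i : Fin n) : horiz x i = x i.castSucc := rfl

@[simp] lemma vertL_apply {n : ℕ} (x : Eu (n + 1)) : vertL n x = vert x := rfl

lemma horiz_sub {n : ℕ} (x y : Eu (n + 1)) : horiz (x - y) = horiz x - horiz y :=
  (horizL n).map_sub x y

lemma vert_sub {n : ℕ} (x y : Eu (n + 1)) : vert (x - y) = vert x - vert y :=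
  (vertL n).map_sub x y

lemma horiz_smul {n : ℕ} (c : ℝ) (x : Eu (n + 1)) : horiz (c • x) = c • horiz x :=
  (horizL n).map_smul c x

lemma vert_smul {n : ℕ} (c : ℝ) (x : Eu (n + 1)) : vert (c • x) = c * vert x :=
  (vertL n).map_smul c x

lemma continuous_horiz {n : ℕ} : Continuous (horiz : Eu (n + 1) → Eu n) := (horizL n).continuous

lemma continuous_vert {n : ℕ} : Continuous (vert : Eu (n + 1) → ℝ) := (vertL n).continuous

lemma norm_sq_eq_horiz_vert {n : ℕ} (x : Eu (n + 1)) :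
    ‖x‖ ^ 2 = ‖horiz x‖ ^ 2 + vert x ^ 2 := by
  rw [EuclideanSpace.norm_sq_eq, EuclideanSpace.norm_sq_eq, Fin.sum_univ_castSucc]
  simp [vert]

lemma norm_horiz_le {n : ℕ} (x : Eu (n + 1)) : ‖horiz x‖ ≤ ‖x‖ := by
  refine abs_le_of_sq_le_sq' ?_ (norm_nonneg _) |>.2
  nlinarith [norm_sq_eq_horiz_vert x, sq_nonneg (vert x)]

lemma abs_vert_le {n : ℕ} (x : Eu (n + 1)) : |vert x| ≤ ‖x‖ := by
  refine abs_le_of_sq_le_sq ?_ (norm_nonneg _)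
  nlinarith [norm_sq_eq_horiz_vert x, sq_nonneg ‖horiz x‖]

lemma norm_le_horiz_add_vert {n : ℕ} (x : Eu (n + 1)) : ‖x‖ ≤ ‖horiz x‖ + |vert x| := by
  refine abs_le_of_sq_le_sq' ?_ (by positivity) |>.2
  nlinarith [norm_sq_eq_horiz_vert x, sq_abs (vert x), norm_nonneg (horiz x), abs_nonneg (vert x),
    mul_nonneg (norm_nonneg (horiz x)) (abs_nonneg (vert x))]

lemma abs_coord_le {m : ℕ} (x : Eu m) (i : Fin m) : |x i| ≤ ‖x‖ := by
  simpa using EuclideanSpace.norm_eq x ▸ PiLp.norm_apply_le x i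

/-- The point with given vertical and horizontal parts. -/
def join {n : ℕ} (t : ℝ) (z : Eu n) : Eu (n + 1) :=
  WithLp.toLp 2 (Fin.snoc (α := fun _ => ℝ) z t)

@[simp] lemma vert_join {n : ℕ} (t : ℝ) (z : Eu n) : vert (join t z) = t := by
  simp [vert, join]

@[simp] lemma horiz_join {n : ℕ} (t : ℝ) (z : Eu n) : horiz (join t z) = z := by
  ext i; simp [join]

lemma eq_of_horiz_vert {n : ℕ} {x y : Eu (n + 1)} (h : horiz x = horiz y) (v : vert x = vert y) :
    x = y := by
  ext i
  refine Fin.lastCases v (fun j => ?_) i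
  have := congrArg (fun z : Eu n => z j) h
  simpa using this

@[simp] lemma join_vert_horiz {n : ℕ} (x : Eu (n + 1)) : join (vert x) (horiz x) = x :=
  eq_of_horiz_vert (by simp) (by simp)

lemma measurePreserving_vert_horiz (n : ℕ) :
    MeasurePreserving (fun x : Eu (n + 1) => (vert x, horiz x)) volume
      ((volume : Measure ℝ).prod (volume : Measure (Eu n))) := by
  have h1 := EuclideanSpace.volume_preserving_symm_measurableEquiv_toLp (Fin (n + 1))
  have h2 := volume_preserving_piFinSuccAbove (fun _ : Fin (n + 1) => ℝ) (Fin.last n)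
  have h3 : MeasurePreserving (Prod.map (id : ℝ → ℝ) (WithLp.toLp 2 : (Fin n → ℝ) → Eu n))
      ((volume : Measure ℝ).prod volume) ((volume : Measure ℝ).prod volume) :=
    (MeasurePreserving.id _).prod (PiLp.volume_preserving_toLp (Fin n))
  have h := h3.comp (h2.comp h1)
  have e : (Prod.map (id : ℝ → ℝ) (WithLp.toLp 2 : (Fin n → ℝ) → Eu n)) ∘
      (MeasurableEquiv.piFinSuccAbove (fun _ => ℝ) (Fin.last n)) ∘
        (MeasurableEquiv.toLp 2 (Fin (n + 1) → ℝ)).symm = fun x => (vert x, horiz x) := by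
    funext x
    refine Prod.ext rfl ?_
    ext i
    simp [horiz, MeasurableEquiv.piFinSuccAbove, Fin.insertNthEquiv, Fin.init]
  rw [← e]
  exact h

lemma continuous_join {n : ℕ} : Continuous (fun p : ℝ × Eu n => join p.1 p.2) := by
  refine (PiLp.continuous_toLp 2 _).comp (continuous_pi fun i => ?_)
  refine Fin.lastCases ?_ (fun j => ?_) i
  · simpa using continuous_fst
  · simp only [Fin.snoc_castSucc]
    fun_prop

/-- `vert` and `horiz` as a measurable equivalence. -/
def splitEquiv (n : ℕ) : Eu (n + 1) ≃ᵐ ℝ × Eu n where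
  toFun x := (vert x, horiz x)
  invFun p := join p.1 p.2
  left_inv x := by simp
  right_inv p := by simp
  measurable_toFun := (continuous_vert.prodMk continuous_horiz).measurable
  measurable_invFun := continuous_join.measurable

lemma measurePreserving_splitEquiv (n : ℕ) : MeasurePreserving (splitEquiv n) volume
    ((volume : Measure ℝ).prod (volume : Measure (Eu n))) :=
  measurePreserving_vert_horiz n

lemma lintegral_split {n : ℕ} {f : Eu (n + 1) → ℝ≥0∞} (hf : Measurable f) :
    ∫⁻ x, f x = ∫⁻ t : ℝ, ∫⁻ z : Eu n, f (join t z) := by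
  have h := (measurePreserving_vert_horiz n).lintegral_comp
    (f := fun p : ℝ × Eu n => f (join p.1 p.2)) (hf.comp continuous_join.measurable)
  simp only [join_vert_horiz] at h
  rw [h]
  exact lintegral_prod _ (hf.comp continuous_join.measurable).aemeasurable

lemma volume_setOf_forall_mem {m : ℕ} (S : Fin m → Set ℝ) :
    volume {x : Eu m | ∀ i, x i ∈ S i} = ∏ i, volume (S i) := by
  have h := (EuclideanSpace.volume_preserving_symm_measurableEquiv_toLp (Fin m)).measure_preimage_equiv
    (Set.univ.pi S)
  rw [volume_pi, Measure.pi_pi] at h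
  rw [← h]
  congr 1
  ext x
  simp

/-! ### Integrating negative powers -/

/-- The constant of `lintegral_rpow_neg_le`. -/
def layerConst (κ γ : ℝ) : ℝ≥0∞ := ∑' k : ℕ, ENNReal.ofReal (2 ^ (γ * (k + 1))) *
  ENNReal.ofReal ((2 ^ (-(k : ℝ))) ^ κ)

lemma layerConst_lt_top {κ γ : ℝ} (h : γ < κ) : layerConst κ γ < ⊤ := by
  have : ∀ k : ℕ, ENNReal.ofReal (2 ^ (γ * (k + 1))) * ENNReal.ofReal ((2 ^ (-(k : ℝ))) ^ κ) =
      ENNReal.ofReal (2 ^ γ * (2 ^ (γ - κ)) ^ k) := by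
    intro k
    rw [← ENNReal.ofReal_mul (by positivity)]
    congr 1
    rw [← Real.rpow_mul (by norm_num), ← Real.rpow_natCast, ← Real.rpow_mul (by norm_num),
      ← Real.rpow_add (by norm_num), ← Real.rpow_add (by norm_num)]
    congr 1; ring
  unfold layerConst
  simp_rw [this]
  have hs : Summable fun k : ℕ => (2 : ℝ) ^ γ * (2 ^ (γ - κ)) ^ k := by
    refine (summable_geometric_of_lt_one (by positivity) ?_).mul_left _
    exact Real.rpow_lt_one_of_one_lt_of_neg (by norm_num) (by linarith)
  rw [← ENNReal.ofReal_tsum_of_nonneg (fun k => by positivity) hs]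
  exact ENNReal.ofReal_lt_top

/-- If the sublevel sets `{D < t}` have measure at most `A t ^ κ`, then `D ^ (-γ)` is integrable for
`γ < κ`, by summing over the dyadic layers of `D`. -/
lemma lintegral_rpow_neg_le {X : Type*} [MeasurableSpace X] {ν : Measure X} {D : X → ℝ}
    (hD : Measurable D) (hD0 : ∀ᵐ x ∂ν, 0 < D x ∧ D x ≤ 1) {κ γ : ℝ} {A : ℝ≥0∞} (hγ : 0 ≤ γ)
    (hA : ∀ t : ℝ, 0 < t → t ≤ 1 → ν {x | D x < 2 * t} ≤ A * ENNReal.ofReal (t ^ κ)) :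
    ∫⁻ x, ENNReal.ofReal (D x ^ (-γ)) ∂ν ≤ A * layerConst κ γ := by
  have hmeas : ∀ k : ℕ, MeasurableSet {x | D x < 2 * 2 ^ (-(k : ℝ))} := fun k =>
    measurableSet_lt hD measurable_const
  calc ∫⁻ x, ENNReal.ofReal (D x ^ (-γ)) ∂ν
      ≤ ∫⁻ x, ∑' k : ℕ, {x | D x < 2 * 2 ^ (-(k : ℝ))}.indicator
          (fun _ => ENNReal.ofReal (2 ^ (γ * (k + 1)))) x ∂ν := by
        refine lintegral_mono_ae ?_
        filter_upwards [hD0] with x hx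
        -- the dyadic layer `2 ^ (-(k + 1)) < D x ≤ 2 ^ (-k)` that contains `x`
        obtain ⟨k, hk1, hk2⟩ := exists_nat_pow_near_of_lt_one (y := (1 / 2 : ℝ)) hx.1 hx.2
          (by norm_num) (by norm_num)
        have e : ∀ m : ℕ, (1 / 2 : ℝ) ^ m = 2 ^ (-(m : ℝ)) := by
          intro m
          rw [Real.rpow_neg (by norm_num), Real.rpow_natCast]; simp
        have e1 : (2 : ℝ) ^ (-(k : ℝ)) = (1 / 2 : ℝ) ^ k := (e k).symm
        refine le_trans ?_ (ENNReal.le_tsum k)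
        rw [Set.indicator_of_mem]
        · refine ENNReal.ofReal_le_ofReal ?_
          have : (2 : ℝ) ^ (γ * (k + 1)) = ((1 / 2 : ℝ) ^ (k + 1)) ^ (-γ) := by
            rw [e (k + 1), ← Real.rpow_mul (by norm_num)]; congr 1; push_cast; ring
          rw [this]
          exact Real.rpow_le_rpow_of_nonpos (by positivity) hk1.le (by linarith)
        · show D x < _
          rw [e1]
          have : 0 < (1 / 2 : ℝ) ^ k := by positivity
          linarith
    _ = ∑' k : ℕ, ENNReal.ofReal (2 ^ (γ * (k + 1))) * ν {x | D x < 2 * 2 ^ (-(k : ℝ))} := by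
        rw [lintegral_tsum (fun k => (measurable_const.indicator (hmeas k)).aemeasurable)]
        congr 1; funext k
        rw [lintegral_indicator (hmeas k), setLIntegral_const]
    _ ≤ ∑' k : ℕ, A * (ENNReal.ofReal (2 ^ (γ * (k + 1))) *
          ENNReal.ofReal ((2 ^ (-(k : ℝ))) ^ κ)) := by
        refine ENNReal.tsum_le_tsum fun k => ?_
        have h := hA (2 ^ (-(k : ℝ))) (by positivity)
          (Real.rpow_le_one_of_one_le_of_nonpos (by norm_num) (by simp))
        calc _ ≤ ENNReal.ofReal (2 ^ (γ * (k + 1))) *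
              (A * ENNReal.ofReal ((2 ^ (-(k : ℝ))) ^ κ)) := by gcongr
          _ = _ := by ring
    _ = A * layerConst κ γ := by rw [ENNReal.tsum_mul_left]; rfl

/-! ### The Cantor set and the Cantor measure -/

/-- The dimension of the Cantor set on the line. -/
def cantorExp (l : ℝ) : ℝ := Real.log 2 / Real.log (1 / l)

lemma cantorDim_eq (m : ℕ) (l : ℝ) : cantorDim m l = m * cantorExp l := by
  simp [cantorDim, cantorExp, mul_div_assoc]

lemma cantorExp_pos {l : ℝ} (h0 : 0 < l) (h1 : l < 1 / 2) : 0 < cantorExp l := by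
  refine div_pos (Real.log_pos (by norm_num)) (Real.log_pos ?_)
  rw [lt_div_iff₀ h0]; linarith

lemma cantorExp_lt_one {l : ℝ} (h0 : 0 < l) (h1 : l < 1 / 2) : cantorExp l < 1 := by
  have h2 : (2 : ℝ) < 1 / l := by rw [lt_div_iff₀ h0]; linarith
  refine (div_lt_one (Real.log_pos (by linarith))).2 ?_
  exact Real.log_lt_log (by norm_num) h2

lemma rpow_cantorExp {l : ℝ} (h0 : 0 < l) (h1 : l < 1 / 2) : l ^ cantorExp l = 1 / 2 := by
  have hl : Real.log l ≠ 0 := (Real.log_neg h0 (by linarith)).ne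
  rw [Real.rpow_def_of_pos h0, cantorExp, one_div, Real.log_inv]
  rw [show Real.log l * (Real.log 2 / -Real.log l) = -Real.log 2 by field_simp]
  rw [Real.exp_neg, Real.exp_log (by norm_num)]; norm_num

/-- Every dimension in `(0, 1)` is attained by a Cantor set. -/
lemma exists_cantorExp_eq {D : ℝ} (h0 : 0 < D) (h1 : D < 1) :
    ∃ l : ℝ, 0 < l ∧ l < 1 / 2 ∧ cantorExp l = D := by
  refine ⟨2 ^ (-(1 / D)), by positivity, ?_, ?_⟩
  · have : (2 : ℝ) ^ (-(1 / D)) < 2 ^ (-1 : ℝ) := by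
      apply Real.rpow_lt_rpow_of_exponent_lt (by norm_num)
      have := one_lt_one_div h0 h1
      linarith
    rwa [Real.rpow_neg_one, ← one_div] at this
  · have : Real.log 2 ≠ 0 := (Real.log_pos (by norm_num)).ne'
    rw [cantorExp, one_div, ← Real.rpow_neg (by norm_num), neg_neg, Real.log_rpow (by norm_num)]
    field_simp

/-- A quantity that scales like `t ^ κ` under `t ↦ t / l` is bounded by a multiple of `t ^ κ`. -/
lemma le_rpow_of_scaling {f : ℝ → ℝ≥0∞} {l κ t₀ T M : ℝ} (hl0 : 0 < l) (hl1 : l < 1)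
    (ht₀ : 0 < t₀) (hT : t₀ / l ≤ T) (hκ : 0 ≤ κ) (hM : 0 ≤ M)
    (hs : ∀ t, 0 < t → t ≤ t₀ → f t ≤ ENNReal.ofReal (l ^ κ) * f (t / l))
    (hb : ∀ t, t₀ < t → t ≤ T → f t ≤ ENNReal.ofReal M) {t : ℝ} (ht : 0 < t) (htT : t ≤ T) :
    f t ≤ ENNReal.ofReal (M * t₀ ^ (-κ) * t ^ κ) := by
  have key : ∀ k : ℕ, ∀ t, t₀ * l ^ k < t → t ≤ T →
      f t ≤ ENNReal.ofReal (M * t₀ ^ (-κ) * t ^ κ) := by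
    have base : ∀ t, t₀ < t → t ≤ T → f t ≤ ENNReal.ofReal (M * t₀ ^ (-κ) * t ^ κ) := by
      intro t h1 h2
      refine (hb t h1 h2).trans (ENNReal.ofReal_le_ofReal ?_)
      have : 1 ≤ t₀ ^ (-κ) * t ^ κ := by
        rw [Real.rpow_neg ht₀.le, inv_mul_eq_div, one_le_div (by positivity)]
        exact Real.rpow_le_rpow ht₀.le h1.le hκ
      nlinarith
    intro k
    induction k with
    | zero => intro t h1 h2; exact base t (by simpa using h1) h2
    | succ k ih =>
      intro t h1 h2
      by_cases h : t₀ < t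
      · exact base t h h2
      · push Not at h
        have htpos : 0 < t := lt_trans (by positivity) h1
        have h3 : t₀ * l ^ k < t / l := by
          rw [lt_div_iff₀ hl0]; rw [pow_succ] at h1; linarith
        have h4 : t / l ≤ T := le_trans (by gcongr) hT
        refine (hs t htpos h).trans ?_
        refine (mul_le_mul_right (ih _ h3 h4) _).trans ?_
        rw [← ENNReal.ofReal_mul (by positivity)]
        refine ENNReal.ofReal_le_ofReal (le_of_eq ?_)
        rw [Real.div_rpow htpos.le hl0.le]
        have : l ^ κ ≠ 0 := by positivity
        field_simp
  -- after finitely many steps `t / l ^ k` exceeds `t₀`, where the plain bound holds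
  obtain ⟨k, hk⟩ := exists_pow_lt_of_lt_one (show 0 < t / t₀ by positivity) hl1
  refine key k t ?_ htT
  rw [lt_div_iff₀ ht₀] at hk; linarith

/-- The similarity of ratio `l` that maps `[-1/2, 1/2]` onto its left subinterval of length `l`. -/
def simL (l t : ℝ) : ℝ := l * t - (1 - l) / 2

/-- The similarity of ratio `l` that maps `[-1/2, 1/2]` onto its right subinterval of length `l`. -/
def simR (l t : ℝ) : ℝ := l * t + (1 - l) / 2

lemma cantorStage_succ (l : ℝ) (k : ℕ) :
    cantorStage l (k + 1) = simL l '' cantorStage l k ∪ simR l '' cantorStage l k := rfl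

lemma cantorStage_subset {l : ℝ} (h0 : 0 < l) (h1 : l < 1 / 2) (k : ℕ) :
    cantorStage l k ⊆ Set.Icc (-(1 / 2)) (1 / 2) := by
  induction k with
  | zero => exact subset_rfl
  | succ k ih =>
    rw [cantorStage_succ]
    rintro x (⟨t, ht, rfl⟩ | ⟨t, ht, rfl⟩) <;> obtain ⟨h2, h3⟩ := ih ht <;>
      constructor <;> simp only [simL, simR] <;> nlinarith

lemma isCompact_cantorStage (l : ℝ) (k : ℕ) : IsCompact (cantorStage l k) := by
  induction k with
  | zero => exact isCompact_Icc
  | succ k ih =>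
    rw [cantorStage_succ]
    exact (ih.image (by unfold simL; fun_prop)).union (ih.image (by unfold simR; fun_prop))

lemma isClosed_cantor (l : ℝ) : IsClosed (cantor l) :=
  isClosed_iInter fun k => (isCompact_cantorStage l k).isClosed

lemma cantor_subset (l : ℝ) : cantor l ⊆ Set.Icc (-(1 / 2)) (1 / 2) := Set.iInter_subset _ 0

lemma cantor_subset_union {l : ℝ} (h0 : 0 < l) (h1 : l < 1 / 2) :
    cantor l ⊆ simL l '' cantor l ∪ simR l '' cantor l := by
  intro x hx
  have hx' : ∀ k, x ∈ simL l '' cantorStage l k ∪ simR l '' cantorStage l k := fun k =>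
    Set.mem_iInter.1 hx (k + 1)
  rcases lt_or_ge x 0 with h | h
  · refine Or.inl ⟨(x + (1 - l) / 2) / l, Set.mem_iInter.2 fun k => ?_, ?_⟩
    · rcases hx' k with ⟨t, ht, rfl⟩ | ⟨t, ht, rfl⟩
      · convert ht using 1; simp [simL]; field_simp
      · obtain ⟨h2, h3⟩ := cantorStage_subset h0 h1 k ht
        simp only [simR] at h; nlinarith
    · simp [simL]; field_simp; ring
  · refine Or.inr ⟨(x - (1 - l) / 2) / l, Set.mem_iInter.2 fun k => ?_, ?_⟩
    · rcases hx' k with ⟨t, ht, rfl⟩ | ⟨t, ht, rfl⟩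
      · obtain ⟨h2, h3⟩ := cantorStage_subset h0 h1 k ht
        simp only [simL] at h; nlinarith
      · convert ht using 1; simp [simR]; field_simp
    · simp [simR]; field_simp; ring

/-! #### The measure as a push-forward of Lebesgue measure -/

/-- Replacing the first `k` binary digits of `u ∈ [0, 1)` by Cantor digits: an increasing bijection
of `[0, 1)` onto the stage `k` of the Cantor set up to endpoints, affine of slope `(2l) ^ k` on
dyadic intervals. -/
def cantorApprox (l : ℝ) : ℕ → ℝ → ℝ
  | 0, u => u - 1 / 2
  | k + 1, u => if u < 1 / 2 then simL l (cantorApprox l k (2 * u))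
      else simR l (cantorApprox l k (2 * u - 1))

lemma cantorApprox_succ (l : ℝ) (k : ℕ) (u : ℝ) :
    cantorApprox l (k + 1) u = if u < 1 / 2 then simL l (cantorApprox l k (2 * u))
      else simR l (cantorApprox l k (2 * u - 1)) := rfl

/-- The generalized inverse of the Cantor function; the limit exists for `0 < l < 1/2`, by
`tendsto_cantorApprox`. -/
def cantorMap (l u : ℝ) : ℝ := limUnder atTop fun k => cantorApprox l k u

lemma dist_cantorApprox_succ {l : ℝ} (h0 : 0 < l) (h1 : l < 1 / 2) (k : ℕ) (u : ℝ) :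
    |cantorApprox l k u - cantorApprox l (k + 1) u| ≤ (1 + |u|) * (2 * l) ^ k := by
  induction k generalizing u with
  | zero =>
    simp only [cantorApprox, pow_zero, mul_one]
    rw [abs_le]
    split_ifs with h
    · simp only [simL]
      constructor <;> cases abs_cases u <;> nlinarith
    · simp only [simR]
      constructor <;> cases abs_cases u <;> nlinarith
  | succ k ih =>
    have hl : (0 : ℝ) ≤ (2 * l) ^ k := by positivity
    rw [cantorApprox_succ l k, cantorApprox_succ l (k + 1)]
    split_ifs with h
    · have := ih (2 * u)
      simp only [simL]
      rw [show ∀ a b : ℝ, l * a - (1 - l) / 2 - (l * b - (1 - l) / 2) = l * (a - b) by intros; ring,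
        abs_mul, abs_of_pos h0]
      calc _ ≤ l * ((1 + |2 * u|) * (2 * l) ^ k) := by gcongr
        _ ≤ l * ((2 * (1 + |u|)) * (2 * l) ^ k) := by
            gcongr; rw [abs_mul, abs_two]; linarith
        _ = _ := by ring
    · have := ih (2 * u - 1)
      simp only [simR]
      rw [show ∀ a b : ℝ, l * a + (1 - l) / 2 - (l * b + (1 - l) / 2) = l * (a - b) by intros; ring,
        abs_mul, abs_of_pos h0]
      calc _ ≤ l * ((1 + |2 * u - 1|) * (2 * l) ^ k) := by gcongr
        _ ≤ l * ((2 * (1 + |u|)) * (2 * l) ^ k) := by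
            gcongr
            push Not at h
            rw [abs_of_nonneg (by linarith), abs_of_nonneg (by linarith)]; linarith
        _ = _ := by ring

lemma tendsto_cantorApprox {l : ℝ} (h0 : 0 < l) (h1 : l < 1 / 2) (u : ℝ) :
    Tendsto (fun k => cantorApprox l k u) atTop (𝓝 (cantorMap l u)) := by
  have : CauchySeq fun k => cantorApprox l k u :=
    cauchySeq_of_le_geometric (2 * l) (1 + |u|) (by linarith) fun k => by
      rw [Real.dist_eq]; exact dist_cantorApprox_succ h0 h1 k u
  exact this.tendsto_limUnder

lemma measurable_cantorApprox (l : ℝ) (k : ℕ) : Measurable (cantorApprox l k) := by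
  induction k with
  | zero => exact measurable_id.sub_const _
  | succ k ih =>
    have : cantorApprox l (k + 1) = fun u => if u < 1 / 2 then simL l (cantorApprox l k (2 * u))
      else simR l (cantorApprox l k (2 * u - 1)) := by funext u; rw [cantorApprox]
    rw [this]
    refine Measurable.ite measurableSet_Iio ?_ ?_
    · unfold simL; fun_prop
    · unfold simR; fun_prop

lemma measurable_cantorMap {l : ℝ} (h0 : 0 < l) (h1 : l < 1 / 2) : Measurable (cantorMap l) :=
  measurable_of_tendsto_metrizable (measurable_cantorApprox l)
    (tendsto_pi_nhds.2 (tendsto_cantorApprox h0 h1))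

lemma cantorMap_of_lt {l : ℝ} (h0 : 0 < l) (h1 : l < 1 / 2) {u : ℝ} (h : u < 1 / 2) :
    cantorMap l u = simL l (cantorMap l (2 * u)) := by
  refine tendsto_nhds_unique ((tendsto_add_atTop_iff_nat 1).2 (tendsto_cantorApprox h0 h1 u)) ?_
  simp only [cantorApprox, if_pos h]
  exact ((tendsto_cantorApprox h0 h1 (2 * u)).const_mul l).sub_const _

lemma cantorMap_of_ge {l : ℝ} (h0 : 0 < l) (h1 : l < 1 / 2) {u : ℝ} (h : ¬ u < 1 / 2) :
    cantorMap l u = simR l (cantorMap l (2 * u - 1)) := by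
  refine tendsto_nhds_unique ((tendsto_add_atTop_iff_nat 1).2 (tendsto_cantorApprox h0 h1 u)) ?_
  simp only [cantorApprox, if_neg h]
  exact ((tendsto_cantorApprox h0 h1 (2 * u - 1)).const_mul l).add_const _

lemma cantorApprox_mem {l : ℝ} (h0 : 0 < l) (h1 : l < 1 / 2) (k : ℕ) {u : ℝ}
    (hu : u ∈ Set.Ico (0 : ℝ) 1) : cantorApprox l k u ∈ Set.Icc (-(1 / 2) : ℝ) (1 / 2) := by
  induction k generalizing u with
  | zero => obtain ⟨h2, h3⟩ := hu; constructor <;> simp only [cantorApprox] <;> linarith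
  | succ k ih =>
    obtain ⟨h2, h3⟩ := hu
    rw [cantorApprox]
    split_ifs with h
    · obtain ⟨h4, h5⟩ := ih (u := 2 * u) ⟨by linarith, by linarith⟩
      constructor <;> simp only [simL] <;> nlinarith
    · push Not at h
      obtain ⟨h4, h5⟩ := ih (u := 2 * u - 1) ⟨by linarith, by linarith⟩
      constructor <;> simp only [simR] <;> nlinarith

lemma cantorMap_mem {l : ℝ} (h0 : 0 < l) (h1 : l < 1 / 2) {u : ℝ} (hu : u ∈ Set.Ico (0 : ℝ) 1) :
    cantorMap l u ∈ cantor l := by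
  refine Set.mem_iInter.2 fun k => ?_
  induction k generalizing u with
  | zero =>
    exact isClosed_Icc.mem_of_tendsto (tendsto_cantorApprox h0 h1 u)
      (Eventually.of_forall fun k => cantorApprox_mem h0 h1 k hu)
  | succ k ih =>
    obtain ⟨h2, h3⟩ := hu
    by_cases h : u < 1 / 2
    · rw [cantorMap_of_lt h0 h1 h]
      exact Or.inl ⟨_, ih ⟨by linarith, by linarith⟩, rfl⟩
    · rw [cantorMap_of_ge h0 h1 h]
      push Not at h
      exact Or.inr ⟨_, ih ⟨by linarith, by linarith⟩, rfl⟩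

lemma cantor_nonempty {l : ℝ} (h0 : 0 < l) (h1 : l < 1 / 2) : (cantor l).Nonempty :=
  ⟨_, cantorMap_mem h0 h1 (u := 0) (by norm_num)⟩

/-- The Cantor measure, as the image of the uniform distribution on `[0, 1)`; that it is the weak
limit of the normalized Lebesgue measures on the stages is `isCantorMeasure_cantorMeasure`. -/
def cantorMeasure (l : ℝ) : Measure ℝ :=
  (volume.restrict (Set.Ico (0 : ℝ) 1)).map (cantorMap l)

lemma isProbabilityMeasure_cantorMeasure {l : ℝ} (h0 : 0 < l) (h1 : l < 1 / 2) :
    IsProbabilityMeasure (cantorMeasure l) := by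
  have : IsProbabilityMeasure (volume.restrict (Set.Ico (0 : ℝ) 1)) := ⟨by simp⟩
  exact Measure.isProbabilityMeasure_map (measurable_cantorMap h0 h1).aemeasurable

lemma ae_mem_cantor {l : ℝ} (h0 : 0 < l) (h1 : l < 1 / 2) :
    ∀ᵐ t ∂cantorMeasure l, t ∈ cantor l := by
  rw [cantorMeasure, ae_map_iff (p := fun t => t ∈ cantor l)
    (measurable_cantorMap h0 h1).aemeasurable (isClosed_cantor l).measurableSet]
  filter_upwards [ae_restrict_mem measurableSet_Ico] with u hu using cantorMap_mem h0 h1 hu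

/-- One half of the self-similarity of the Cantor measure; the inequality is all that is needed for
its regularity. -/
lemma cantorMeasure_le {l : ℝ} (h0 : 0 < l) (h1 : l < 1 / 2) {S : Set ℝ} (hS : MeasurableSet S) :
    cantorMeasure l S ≤ ENNReal.ofReal (1 / 2) * cantorMeasure l (simL l ⁻¹' S) +
      ENNReal.ofReal (1 / 2) * cantorMeasure l (simR l ⁻¹' S) := by
  have hm := measurable_cantorMap h0 h1
  have mL : Measurable (simL l) := by unfold simL; fun_prop
  have mR : Measurable (simR l) := by unfold simR; fun_prop
  simp only [cantorMeasure]
  rw [Measure.map_apply hm hS, Measure.map_apply hm (mL hS), Measure.map_apply hm (mR hS),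
    Measure.restrict_apply (hm hS), Measure.restrict_apply (hm (mL hS)),
    Measure.restrict_apply (hm (mR hS))]
  set A := cantorMap l ⁻¹' (simL l ⁻¹' S) ∩ Set.Ico (0 : ℝ) 1
  set B := cantorMap l ⁻¹' (simR l ⁻¹' S) ∩ Set.Ico (0 : ℝ) 1
  have hsub : cantorMap l ⁻¹' S ∩ Set.Ico (0 : ℝ) 1 ⊆
      (fun u => 2 * u) ⁻¹' A ∪ (fun u => 2 * u) ⁻¹' ((fun u => u + (-1)) ⁻¹' B) := by
    rintro u ⟨hu, h2, h3⟩
    by_cases h : u < 1 / 2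
    · refine Or.inl ⟨?_, by constructor <;> dsimp only <;> linarith⟩
      simp only [Set.mem_preimage] at hu ⊢
      rwa [← cantorMap_of_lt h0 h1 h]
    · refine Or.inr ⟨?_, by push Not at h; constructor <;> linarith⟩
      simp only [Set.mem_preimage] at hu ⊢
      rw [← sub_eq_add_neg, ← cantorMap_of_ge h0 h1 h]; exact hu
  refine (measure_mono hsub).trans ((measure_union_le _ _).trans (le_of_eq ?_))
  rw [Real.volume_preimage_mul_left (by norm_num), Real.volume_preimage_mul_left (by norm_num),
    measure_preimage_add_right]
  norm_num

/-- The mass of the Cantor measure in an interval of length `r` is at most a multiple of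
`r ^ cantorExp l`. -/
lemma exists_cantorMeasure_ball_le {l : ℝ} (h0 : 0 < l) (h1 : l < 1 / 2) :
    ∃ A : ℝ, 0 ≤ A ∧ ∀ y r : ℝ, 0 < r →
      cantorMeasure l {t | |t - y| < r} ≤ ENNReal.ofReal (A * r ^ cantorExp l) := by
  have := isProbabilityMeasure_cantorMeasure h0 h1
  have hout : ∀ S : Set ℝ, Disjoint S (Set.Icc (-(1 / 2)) (1 / 2)) → cantorMeasure l S = 0 := by
    intro S hS
    refine measure_mono_null ?_ (ae_iff.1 (ae_mem_cantor h0 h1))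
    intro t ht h
    exact Set.disjoint_left.1 hS ht (cantor_subset l h)
  set f : ℝ → ℝ≥0∞ := fun r => ⨆ y, cantorMeasure l (Set.Icc y (y + r)) with hf
  -- the gap in the middle has length `1 - 2l`, so an interval shorter than that meets only one half
  set t₀ := (1 - 2 * l) / 2
  have ht₀ : 0 < t₀ := by simp only [t₀]; linarith
  refine ⟨1 * t₀ ^ (-cantorExp l) * 2 ^ cantorExp l, by positivity, fun y r hr => ?_⟩
  have hsub : {t | |t - y| < r} ⊆ Set.Icc (y - r) (y - r + 2 * r) := by
    intro t ht
    rw [Set.mem_ofPred_eq, abs_lt] at ht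
    constructor <;> linarith
  calc cantorMeasure l {t | |t - y| < r} ≤ f (2 * r) :=
        (measure_mono hsub).trans (le_iSup (fun y => cantorMeasure l (Set.Icc y (y + 2 * r))) (y - r))
    _ ≤ ENNReal.ofReal (1 * t₀ ^ (-cantorExp l) * (2 * r) ^ cantorExp l) := by
        refine le_rpow_of_scaling (T := max (t₀ / l) (2 * r)) h0 (by linarith) ht₀ (le_max_left _ _)
          (cantorExp_pos h0 h1).le zero_le_one ?_ ?_ (by linarith) (le_max_right _ _)
        · intro t ht htt
          rw [rpow_cantorExp h0 h1]
          refine iSup_le fun y => (cantorMeasure_le h0 h1 measurableSet_Icc).trans ?_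
          have eL : simL l ⁻¹' Set.Icc y (y + t) =
              Set.Icc ((y + (1 - l) / 2) / l) ((y + (1 - l) / 2) / l + t / l) := by
            ext w
            simp only [Set.mem_preimage, Set.mem_Icc, simL, ← add_div, div_le_iff₀ h0,
              le_div_iff₀ h0]
            constructor <;> rintro ⟨h, h'⟩ <;> constructor <;> linarith
          have eR : simR l ⁻¹' Set.Icc y (y + t) =
              Set.Icc ((y - (1 - l) / 2) / l) ((y - (1 - l) / 2) / l + t / l) := by
            ext w
            simp only [Set.mem_preimage, Set.mem_Icc, simR, ← add_div, div_le_iff₀ h0,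
              le_div_iff₀ h0]
            constructor <;> rintro ⟨h, h'⟩ <;> constructor <;> linarith
          have hlt : t < 1 - 2 * l := by simp only [t₀] at htt; linarith
          by_cases hy : y + t < 1 / 2 - l
          · have : cantorMeasure l (simR l ⁻¹' Set.Icc y (y + t)) = 0 := by
              refine hout _ (Set.disjoint_left.2 ?_)
              rintro w ⟨h, h'⟩ ⟨h'', _⟩
              simp only [simR] at h h'; nlinarith
            rw [this, mul_zero, add_zero, eL]
            gcongr
            exact le_iSup (fun y => cantorMeasure l (Set.Icc y (y + t / l))) _
          · have : cantorMeasure l (simL l ⁻¹' Set.Icc y (y + t)) = 0 := by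
              refine hout _ (Set.disjoint_left.2 ?_)
              rintro w ⟨h, h'⟩ ⟨_, h''⟩
              simp only [simL] at h h'; nlinarith
            rw [this, mul_zero, zero_add, eR]
            gcongr
            exact le_iSup (fun y => cantorMeasure l (Set.Icc y (y + t / l))) _
        · intro t _ _
          simp only [ENNReal.ofReal_one]
          exact iSup_le fun y => prob_le_one
    _ = _ := by rw [Real.mul_rpow (by norm_num) hr.le]; ring_nf

/-- The `t`-neighbourhood of the Cantor set has measure at most a multiple of
`t ^ (1 - cantorExp l)`. -/
lemma exists_volume_thickening_cantor_le {l : ℝ} (h0 : 0 < l) (h1 : l < 1 / 2) :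
    ∃ A : ℝ, 0 ≤ A ∧ ∀ t : ℝ, 0 < t → t ≤ 2 →
      volume {x : ℝ | Metric.infDist x (cantor l) < t} ≤
        ENNReal.ofReal (A * t ^ (1 - cantorExp l)) := by
  have hne := cantor_nonempty h0 h1
  have hE := cantorExp_lt_one h0 h1
  -- the neighbourhood of radius `t` is covered by two copies, scaled by `l`, of the one of radius
  -- `t / l`, and `2 l = l ^ (1 - cantorExp l)`
  refine ⟨5 * l ^ (-(1 - cantorExp l)), by positivity, fun t ht htT => ?_⟩
  refine le_rpow_of_scaling (f := fun t => volume {x : ℝ | Metric.infDist x (cantor l) < t})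
    (T := 2) h0 (by linarith) h0 (by rw [div_self h0.ne']; norm_num) (by linarith) (by norm_num)
    ?_ ?_ ht htT
  · intro t ht _
    have hsub : {x : ℝ | Metric.infDist x (cantor l) < t} ⊆
        simL l '' {x : ℝ | Metric.infDist x (cantor l) < t / l} ∪
          simR l '' {x : ℝ | Metric.infDist x (cantor l) < t / l} := by
      intro x hx
      obtain ⟨y, hy, hxy⟩ := (Metric.infDist_lt_iff hne).1 hx
      rw [Real.dist_eq] at hxy
      rcases cantor_subset_union h0 h1 hy with ⟨w, hw, rfl⟩ | ⟨w, hw, rfl⟩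
      · refine Or.inl ⟨(x + (1 - l) / 2) / l, (Metric.infDist_lt_iff hne).2 ⟨w, hw, ?_⟩, ?_⟩
        · rw [Real.dist_eq, show (x + (1 - l) / 2) / l - w = (x - simL l w) / l by
            simp only [simL]; field_simp; ring, abs_div, abs_of_pos h0]
          gcongr
        · simp only [simL]; field_simp; ring
      · refine Or.inr ⟨(x - (1 - l) / 2) / l, (Metric.infDist_lt_iff hne).2 ⟨w, hw, ?_⟩, ?_⟩
        · rw [Real.dist_eq, show (x - (1 - l) / 2) / l - w = (x - simR l w) / l by
            simp only [simR]; field_simp; ring, abs_div, abs_of_pos h0]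
          gcongr
        · simp only [simR]; field_simp; ring
    have hvol : ∀ (c : ℝ) (S : Set ℝ), volume ((fun t => l * t + c) '' S) =
        ENNReal.ofReal l * volume S := by
      intro c S
      have : (fun t => l * t + c) '' S = (fun t => t + c) '' ((fun t => l • t) '' S) := by
        rw [Set.image_image]; rfl
      rw [this, Set.image_add_right, measure_preimage_add_right]
      change volume (l • S) = _
      rw [Measure.addHaar_smul]
      simp [abs_of_pos h0]
    have hL : simL l = fun t => l * t + (-((1 - l) / 2)) := by
      funext t; simp [simL, sub_eq_add_neg]
    have hR : simR l = fun t => l * t + ((1 - l) / 2) := rfl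
    refine (measure_mono hsub).trans ((measure_union_le _ _).trans (le_of_eq ?_))
    rw [hL, hR, hvol, hvol, ← add_mul, ← ENNReal.ofReal_add h0.le h0.le]
    congr 2
    rw [Real.rpow_sub h0, Real.rpow_one, rpow_cantorExp h0 h1]; ring
  · intro t _ ht2
    have hsub : {x : ℝ | Metric.infDist x (cantor l) < t} ⊆ Set.Icc (-(5 / 2)) (5 / 2) := by
      intro x hx
      obtain ⟨y, hy, hxy⟩ := (Metric.infDist_lt_iff hne).1 hx
      rw [Real.dist_eq, abs_lt] at hxy
      obtain ⟨h2, h3⟩ := cantor_subset l hy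
      constructor <;> linarith
    refine (measure_mono hsub).trans (le_of_eq ?_)
    rw [Real.volume_Icc]; norm_num

lemma volume_cantor {l : ℝ} (h0 : 0 < l) (h1 : l < 1 / 2) : volume (cantor l) = 0 := by
  obtain ⟨A, hA, h⟩ := exists_volume_thickening_cantor_le h0 h1
  have hE := cantorExp_lt_one h0 h1
  have hle : ∀ t : ℝ, 0 < t → t ≤ 2 →
      volume (cantor l) ≤ ENNReal.ofReal (A * t ^ (1 - cantorExp l)) := by
    intro t ht ht2
    refine (measure_mono ?_).trans (h t ht ht2)
    intro x hx
    rw [Set.mem_ofPred_eq, Metric.infDist_zero_of_mem hx]; exact ht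
  have hlim : Tendsto (fun t : ℝ => ENNReal.ofReal (A * t ^ (1 - cantorExp l))) (𝓝[>] 0) (𝓝 0) := by
    have : Tendsto (fun t : ℝ => A * t ^ (1 - cantorExp l)) (𝓝 0) (𝓝 (A * 0)) := by
      refine Tendsto.const_mul _ ?_
      have := (Real.continuousAt_rpow_const 0 (1 - cantorExp l) (Or.inr (by linarith))).tendsto
      rwa [Real.zero_rpow (by linarith)] at this
    rw [mul_zero] at this
    simpa using (ENNReal.tendsto_ofReal this).mono_left nhdsWithin_le_nhds
  refine le_antisymm (ge_of_tendsto hlim ?_) (zero_le)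
  filter_upwards [Ioo_mem_nhdsGT (show (0 : ℝ) < 2 by norm_num)] with t ht
    using hle t ht.1 ht.2.le

/-! #### The Cantor measure as a weak limit -/

/-- The normalized Lebesgue measure on a stage of the Cantor set is the image of the uniform
distribution under `cantorApprox`. -/
lemma integral_cantorApprox {l : ℝ} (h0 : 0 < l) (h1 : l < 1 / 2) (k : ℕ) {f : ℝ → ℝ}
    (hf : Continuous f) :
    ((2 * l) ^ k)⁻¹ * ∫ t in cantorStage l k, f t =
      ∫ u in Set.Ico (0 : ℝ) 1, f (cantorApprox l k u) := by
  induction k generalizing f with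
  | zero =>
    simp only [cantorApprox, pow_zero, inv_one, one_mul, cantorStage]
    rw [integral_Icc_eq_integral_Ioc, integral_Ico_eq_integral_Ioc,
      ← intervalIntegral.integral_of_le (by norm_num),
      ← intervalIntegral.integral_of_le (by norm_num),
      intervalIntegral.integral_comp_sub_right (fun t => f t)]
    norm_num
  | succ k ih =>
    have cL : Continuous (simL l) := by unfold simL; fun_prop
    have cR : Continuous (simR l) := by unfold simR; fun_prop
    have himg : ∀ c : ℝ, ∫ t in (fun t => l * t + c) '' cantorStage l k, f t =
        l * ∫ t in cantorStage l k, f (l * t + c) := by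
      intro c
      rw [integral_image_eq_integral_abs_deriv_smul (isCompact_cantorStage l k).measurableSet
        (f' := fun _ => l) (fun x _ => by
          simpa using (((hasDerivAt_id x).const_mul l).add_const c).hasDerivWithinAt)
        (fun x _ y _ h => by simpa [h0.ne'] using h)]
      simp [abs_of_pos h0, integral_const_mul]
    have hL : simL l = fun t => l * t + (-((1 - l) / 2)) := by
      funext t; simp [simL, sub_eq_add_neg]
    have hR : simR l = fun t => l * t + ((1 - l) / 2) := rfl
    have hdisj : Disjoint (simL l '' cantorStage l k) (simR l '' cantorStage l k) := by
      refine Set.disjoint_left.2 ?_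
      rintro x ⟨t, ht, rfl⟩ ⟨w, hw, hwt⟩
      obtain ⟨h2, h3⟩ := cantorStage_subset h0 h1 k ht
      obtain ⟨h4, h5⟩ := cantorStage_subset h0 h1 k hw
      simp only [simL, simR] at hwt; nlinarith
    have hint : ∀ S : Set ℝ, IsCompact S → IntegrableOn f S := fun S hS =>
      hf.continuousOn.integrableOn_compact hS
    have hcL := (isCompact_cantorStage l k).image cL
    have hcR := (isCompact_cantorStage l k).image cR
    rw [cantorStage_succ, setIntegral_union hdisj hcR.measurableSet (hint _ hcL) (hint _ hcR)]
    have e1 : ∫ t in simL l '' cantorStage l k, f t = l * ∫ t in cantorStage l k, f (simL l t) := by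
      rw [hL]; exact himg _
    have e2 : ∫ t in simR l '' cantorStage l k, f t = l * ∫ t in cantorStage l k, f (simR l t) := by
      rw [hR]; exact himg _
    rw [e1, e2]
    have i1 := ih (hf.comp cL)
    have i2 := ih (hf.comp cR)
    simp only [Function.comp_apply] at i1 i2
    have hbd : ∀ g : ℝ → ℝ, Continuous g →
        IntegrableOn (fun u => g (cantorApprox l k u)) (Set.Ico (0 : ℝ) 1) := by
      intro g hg
      obtain ⟨C, hC⟩ := isCompact_Icc.exists_bound_of_continuousOn (s := Set.Icc (-(1 / 2) : ℝ) (1 / 2))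
        hg.continuousOn
      refine Measure.integrableOn_of_bounded (M := C) (by simp)
        (hg.measurable.comp (measurable_cantorApprox l k)).aestronglyMeasurable ?_
      filter_upwards [ae_restrict_mem measurableSet_Ico] with u hu
        using hC _ (cantorApprox_mem h0 h1 k hu)
    have hsplit : Set.Ico (0 : ℝ) 1 = Set.Ico 0 (1 / 2) ∪ Set.Ico (1 / 2) 1 := by
      rw [Set.Ico_union_Ico_eq_Ico] <;> norm_num
    have hI : IntegrableOn (fun u => f (cantorApprox l (k + 1) u)) (Set.Ico (0 : ℝ) 1) := by
      obtain ⟨C, hC⟩ := isCompact_Icc.exists_bound_of_continuousOn (s := Set.Icc (-(1 / 2) : ℝ) (1 / 2))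
        hf.continuousOn
      refine Measure.integrableOn_of_bounded (M := C) (by simp)
        (hf.measurable.comp (measurable_cantorApprox l (k + 1))).aestronglyMeasurable ?_
      filter_upwards [ae_restrict_mem measurableSet_Ico] with u hu
        using hC _ (cantorApprox_mem h0 h1 (k + 1) hu)
    have j1 : ∫ u in Set.Ico (0 : ℝ) (1 / 2), f (cantorApprox l (k + 1) u) =
        1 / 2 * ∫ u in Set.Ico (0 : ℝ) 1, f (simL l (cantorApprox l k u)) := by
      rw [setIntegral_congr_fun measurableSet_Ico (g := fun u => f (simL l (cantorApprox l k (2 * u))))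
        (fun u hu => by simp only [cantorApprox, if_pos hu.2]),
        integral_Ico_eq_integral_Ioc, integral_Ico_eq_integral_Ioc,
        ← intervalIntegral.integral_of_le (by norm_num),
        ← intervalIntegral.integral_of_le (by norm_num),
        intervalIntegral.integral_comp_mul_left (fun u => f (simL l (cantorApprox l k u)))
          two_ne_zero]
      norm_num
    have j2 : ∫ u in Set.Ico (1 / 2 : ℝ) 1, f (cantorApprox l (k + 1) u) =
        1 / 2 * ∫ u in Set.Ico (0 : ℝ) 1, f (simR l (cantorApprox l k u)) := by
      rw [setIntegral_congr_fun measurableSet_Ico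
        (g := fun u => f (simR l (cantorApprox l k (2 * u - 1))))
        (fun u hu => by simp only [cantorApprox, if_neg (not_lt.2 hu.1)]),
        integral_Ico_eq_integral_Ioc, integral_Ico_eq_integral_Ioc,
        ← intervalIntegral.integral_of_le (by norm_num),
        ← intervalIntegral.integral_of_le (by norm_num),
        intervalIntegral.integral_comp_mul_sub (fun u => f (simR l (cantorApprox l k u)))
          two_ne_zero]
      norm_num
    rw [hsplit] at hI ⊢
    rw [setIntegral_union (Set.Ico_disjoint_Ico_same) measurableSet_Ico
      hI.left_of_union hI.right_of_union, j1, j2, ← i1, ← i2, pow_succ]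
    have : (2 * l) ^ k ≠ 0 := by positivity
    field_simp

lemma isCantorMeasure_cantorMeasure {l : ℝ} (h0 : 0 < l) (h1 : l < 1 / 2) :
    IsCantorMeasure l (cantorMeasure l) := by
  refine ⟨isProbabilityMeasure_cantorMeasure h0 h1, fun f => ?_⟩
  rw [cantorMeasure, integral_map (measurable_cantorMap h0 h1).aemeasurable
    f.continuous.aestronglyMeasurable]
  simp_rw [integral_cantorApprox h0 h1 _ f.continuous]
  refine tendsto_integral_of_dominated_convergence (fun _ => ‖f‖) ?_ ?_ ?_ ?_
  · exact fun k => (f.continuous.measurable.comp (measurable_cantorApprox l k)).aestronglyMeasurable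
  · exact integrable_const _
  · exact fun k => Eventually.of_forall fun u => f.norm_coe_le_norm _
  · exact Eventually.of_forall fun u =>
      (f.continuous.tendsto _).comp (tendsto_cantorApprox h0 h1 u)

/-! ### Finiteness of the nonlocal energy -/

/-- The kernel `min(|z|^θ, |z|)^p / |z|^(m+sp)`: the energy density at a point of unit distance to
the barrier. -/
def scaleKernel (m : ℕ) (s p θ : ℝ) (z : Eu m) : ℝ :=
  (min (‖z‖ ^ θ) ‖z‖) ^ p / ‖z‖ ^ ((m : ℝ) + s * p)

lemma measurable_scaleKernel (m : ℕ) (s p θ : ℝ) : Measurable (scaleKernel m s p θ) := by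
  unfold scaleKernel; fun_prop

lemma volume_norm_lt {m : ℕ} (t : ℝ) (ht : 0 < t) :
    volume {z : Eu m | ‖z‖ < 2 * t} ≤
      (ENNReal.ofReal (2 ^ m) * volume (Metric.ball (0 : Eu m) 1)) * ENNReal.ofReal (t ^ (m : ℝ)) := by
  have : {z : Eu m | ‖z‖ < 2 * t} = Metric.ball 0 (2 * t) := by ext z; simp
  rw [this, Measure.addHaar_ball_of_pos _ _ (by positivity), finrank_euclideanSpace_fin, mul_pow,
    ENNReal.ofReal_mul (by positivity), Real.rpow_natCast]
  exact le_of_eq (by ring)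

/-- The exponent `1 > s` near the origin and the exponent `θ < s` at infinity make the kernel
integrable. -/
lemma lintegral_scaleKernel_lt_top {m : ℕ} (hm : 0 < m) {s p θ : ℝ} (hs : s < 1)
    (hp : 0 < p) (hθs : θ < s) :
    ∫⁻ z, ENNReal.ofReal (scaleKernel m s p θ z) < ⊤ := by
  have hm' : (0 : ℝ) < m := by exact_mod_cast hm
  rw [← lintegral_add_compl _ (measurableSet_ball (x := (0 : Eu m)) (ε := 1))]
  refine ENNReal.add_lt_top.2 ⟨?_, ?_⟩
  -- near the origin the kernel is at most `|z| ^ (p - m - sp)`, where `s < 1`; the maximum with `0`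
  -- meets the sign condition of `lintegral_rpow_neg_le`
  · set γ := max (m + s * p - p) 0
    have hγ : γ < m := max_lt (by nlinarith) hm'
    have key := lintegral_rpow_neg_le (ν := volume.restrict (Metric.ball (0 : Eu m) 1))
      (D := fun z => ‖z‖) measurable_norm (κ := m) (γ := γ)
      (A := ENNReal.ofReal (2 ^ m) * volume (Metric.ball (0 : Eu m) 1)) ?_ (le_max_right _ _) ?_
    · refine lt_of_le_of_lt (lintegral_mono_ae ?_) (lt_of_le_of_lt key ?_)
      · filter_upwards [ae_restrict_mem measurableSet_ball] with z hz
        refine ENNReal.ofReal_le_ofReal ?_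
        rw [mem_ball_zero_iff] at hz
        rcases eq_or_ne z 0 with rfl | h0
        · simp only [scaleKernel, norm_zero]
          rw [min_eq_right (by positivity), Real.zero_rpow hp.ne', zero_div]
          positivity
        · have hz0 : 0 < ‖z‖ := norm_pos_iff.2 h0
          calc scaleKernel m s p θ z ≤ ‖z‖ ^ p / ‖z‖ ^ ((m : ℝ) + s * p) := by
                unfold scaleKernel; gcongr; exact min_le_right _ _
            _ = ‖z‖ ^ (-(m + s * p - p)) := by
                rw [← Real.rpow_sub hz0]; congr 1; ring
            _ ≤ ‖z‖ ^ (-γ) :=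
                Real.rpow_le_rpow_of_exponent_ge hz0 hz.le (neg_le_neg (le_max_left _ _))
      · exact ENNReal.mul_lt_top (ENNReal.mul_lt_top ENNReal.ofReal_lt_top measure_ball_lt_top)
          (layerConst_lt_top hγ)
    · have h0 : ∀ᵐ z : Eu m, z ≠ 0 := by
        have : Nonempty (Fin m) := ⟨⟨0, hm⟩⟩
        exact Measure.ae_ne _ _
      filter_upwards [ae_restrict_mem measurableSet_ball, ae_restrict_of_ae h0] with z hz hz0
      rw [mem_ball_zero_iff] at hz
      exact ⟨norm_pos_iff.2 hz0, hz.le⟩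
    · exact fun t ht _ => (Measure.restrict_apply_le _ _).trans (volume_norm_lt t ht)
  -- at infinity the kernel is `|z| ^ (-r)` with `r > m`
  · set r := m + s * p - θ * p
    have hr : (m : ℝ) < r := by simp only [r]; nlinarith
    have hfin := finite_integral_one_add_norm (E := Eu m) (μ := volume) (r := r)
      (by rw [finrank_euclideanSpace_fin]; exact hr)
    refine lt_of_le_of_lt (b := ∫⁻ z : Eu m, ENNReal.ofReal (2 ^ r) *
      ENNReal.ofReal ((1 + ‖z‖) ^ (-r))) ?_ ?_
    · refine (lintegral_mono_ae ?_).trans (setLIntegral_le_lintegral (Metric.ball (0 : Eu m) 1)ᶜ _)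
      filter_upwards [ae_restrict_mem measurableSet_ball.compl] with z hz
      have hz1 : 1 ≤ ‖z‖ := by simpa using hz
      have hz0 : 0 < ‖z‖ := by linarith
      rw [← ENNReal.ofReal_mul (by positivity)]
      refine ENNReal.ofReal_le_ofReal ?_
      calc scaleKernel m s p θ z ≤ (‖z‖ ^ θ) ^ p / ‖z‖ ^ ((m : ℝ) + s * p) := by
            unfold scaleKernel; gcongr; exact min_le_left _ _
        _ = ‖z‖ ^ (-r) := by
            rw [← Real.rpow_mul hz0.le, ← Real.rpow_sub hz0]; congr 1; simp only [r]; ring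
        _ ≤ ((1 + ‖z‖) / 2) ^ (-r) :=
            Real.rpow_le_rpow_of_nonpos (by positivity) (by linarith) (by linarith)
        _ = 2 ^ r * (1 + ‖z‖) ^ (-r) := by
            rw [Real.div_rpow (by positivity) (by norm_num), Real.rpow_neg (by norm_num : (0:ℝ) ≤ 2)]
            field_simp
    · rw [lintegral_const_mul _ (by fun_prop)]
      exact ENNReal.mul_lt_top ENNReal.ofReal_lt_top hfin

/-- Scaling of the kernel: the parameter `D` is the distance to the barrier. -/
lemma lintegral_scaled_kernel {m : ℕ} {s p θ D : ℝ} (hD : 0 < D) (x : Eu m) :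
    ∫⁻ y, ENNReal.ofReal ((min (‖x - y‖ ^ θ) (‖x - y‖ * D ^ (θ - 1))) ^ p /
      ‖x - y‖ ^ ((m : ℝ) + s * p)) =
    ENNReal.ofReal (D ^ (-((s - θ) * p))) * ∫⁻ z, ENNReal.ofReal (scaleKernel m s p θ z) := by
  set g : Eu m → ℝ≥0∞ := fun h => ENNReal.ofReal ((min (‖h‖ ^ θ) (‖h‖ * D ^ (θ - 1))) ^ p /
      ‖h‖ ^ ((m : ℝ) + s * p)) with hg
  have hgm : Measurable g := by simp only [hg]; fun_prop
  rw [lintegral_sub_left_eq_self g x]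
  have h1 : ∫⁻ z, g (D • z) = ENNReal.ofReal (D ^ m)⁻¹ * ∫⁻ h, g h := by
    rw [← lintegral_map hgm (measurable_const_smul D), Measure.map_addHaar_smul _ hD.ne',
      lintegral_smul_measure, finrank_euclideanSpace_fin, abs_of_pos (by positivity), smul_eq_mul]
  have h2 : ∀ z, g (D • z) = ENNReal.ofReal (D ^ (θ * p - m - s * p)) *
      ENNReal.ofReal (scaleKernel m s p θ z) := by
    intro z
    rw [← ENNReal.ofReal_mul (by positivity)]
    simp only [hg, scaleKernel, norm_smul, Real.norm_eq_abs, abs_of_pos hD]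
    congr 1
    have e1 : D * ‖z‖ * D ^ (θ - 1) = D ^ θ * ‖z‖ := by
      rw [Real.rpow_sub_one hD.ne']
      field_simp
    rw [e1, Real.mul_rpow hD.le (norm_nonneg z), ← mul_min_of_nonneg _ _ (by positivity),
      Real.mul_rpow (by positivity) (le_min (by positivity) (norm_nonneg z)),
      Real.mul_rpow hD.le (norm_nonneg z), ← Real.rpow_mul hD.le]
    rw [mul_div_mul_comm, ← Real.rpow_sub hD]
    congr 2; ring
  have h3 : ∫⁻ h, g h = ENNReal.ofReal (D ^ m) * ∫⁻ z, g (D • z) := by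
    rw [h1, ← mul_assoc, ← ENNReal.ofReal_mul (by positivity), mul_inv_cancel₀ (by positivity)]
    simp
  rw [h3]
  simp_rw [h2]
  rw [lintegral_const_mul _ (measurable_scaleKernel m s p θ).ennreal_ofReal, ← mul_assoc,
    ← ENNReal.ofReal_mul (by positivity)]
  congr 2
  rw [← Real.rpow_natCast, ← Real.rpow_add hD]; congr 1; ring

/-- A function that vanishes outside a bounded set and that oscillates at most like
`min(|x-y|^θ, |x-y| D(x)^(θ-1))`, where the sublevel sets of `D` are of codimension
`κ > (s-θ)p`, has finite nonlocal energy. -/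
lemma nonlocalEnergy_lt_top {m : ℕ} (hm : 0 < m) {s p θ κ C : ℝ} (hs1 : s < 1) (hp : 1 < p)
    (hθs : θ < s) (hκ : (s - θ) * p < κ) {v D : Eu m → ℝ} {B : Set (Eu m)}
    {A : ℝ≥0∞} (hA : A < ⊤) (hv : Measurable v) (hB : MeasurableSet B) (hvB : ∀ x ∉ B, v x = 0)
    (hDm : Measurable D) (hD : ∀ᵐ x ∂volume.restrict B, 0 < D x ∧ D x ≤ 1)
    (hvol : ∀ t : ℝ, 0 < t → t ≤ 1 →
      volume.restrict B {x | D x < 2 * t} ≤ A * ENNReal.ofReal (t ^ κ))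
    (hosc : ∀ x ∈ B, 0 < D x → ∀ y, |v x - v y| ≤ C * ‖x - y‖ ^ θ ∧
      |v x - v y| ≤ C * (‖x - y‖ * D x ^ (θ - 1))) :
    nonlocalEnergy s p v < ⊤ := by
  have hp0 : 0 < p := by linarith
  set F : Eu m → Eu m → ℝ≥0∞ := fun x y =>
    ENNReal.ofReal (1 / p * (|v x - v y| ^ p / ‖x - y‖ ^ ((m : ℝ) + s * p))) with hF
  have hFm : Measurable (Function.uncurry F) := by
    simp only [hF, Function.uncurry_def]
    fun_prop
  have hsymm : ∀ x y, F x y = F y x := by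
    intro x y; simp only [hF]; rw [abs_sub_comm, norm_sub_rev]
  -- pairs with both points outside `B` do not contribute, and by symmetry it suffices to count the
  -- pairs whose first point lies in `B`
  have hle : ∀ x y, F x y ≤ B.indicator (fun x => F x y) x + B.indicator (fun y => F x y) y := by
    intro x y
    by_cases hx : x ∈ B
    · rw [Set.indicator_of_mem hx]; exact le_self_add
    · by_cases hy : y ∈ B
      · rw [Set.indicator_of_mem hy]; exact le_add_self
      · simp [hF, hvB x hx, hvB y hy, Real.zero_rpow hp0.ne']
  have hm1 : Measurable fun q : Eu m × Eu m => B.indicator (fun x => F x q.2) q.1 := by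
    have : (fun q : Eu m × Eu m => B.indicator (fun x => F x q.2) q.1) =
        (Prod.fst ⁻¹' B).indicator (Function.uncurry F) := by
      funext q; simp [Set.indicator, Function.uncurry, Set.mem_preimage]; rfl
    rw [this]; exact hFm.indicator (measurable_fst hB)
  have hm2 : Measurable fun q : Eu m × Eu m => B.indicator (fun y => F q.1 y) q.2 := by
    have : (fun q : Eu m × Eu m => B.indicator (fun y => F q.1 y) q.2) =
        (Prod.snd ⁻¹' B).indicator (Function.uncurry F) := by
      funext q; simp [Set.indicator, Function.uncurry, Set.mem_preimage]; rfl
    rw [this]; exact hFm.indicator (measurable_snd hB)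
  have hhalf : ∫⁻ x, ∫⁻ y, B.indicator (fun x => F x y) x < ⊤ := by
    have e : ∀ x, ∫⁻ y, B.indicator (fun x => F x y) x = B.indicator (fun x => ∫⁻ y, F x y) x := by
      intro x
      by_cases hx : x ∈ B <;> simp [hx]
    simp_rw [e]
    rw [lintegral_indicator hB]
    set K := ∫⁻ z, ENNReal.ofReal (scaleKernel m s p θ z)
    have hK : K < ⊤ := lintegral_scaleKernel_lt_top hm hs1 hp0 hθs
    refine lt_of_le_of_lt (b := ∫⁻ x in B, (ENNReal.ofReal (1 / p * |C| ^ p) * K) *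
      ENNReal.ofReal (D x ^ (-((s - θ) * p)))) (lintegral_mono_ae ?_) ?_
    · filter_upwards [hD, ae_restrict_mem hB] with x hx hxB
      calc ∫⁻ y, F x y ≤ ∫⁻ y, ENNReal.ofReal (1 / p * |C| ^ p) *
            ENNReal.ofReal ((min (‖x - y‖ ^ θ) (‖x - y‖ * D x ^ (θ - 1))) ^ p /
              ‖x - y‖ ^ ((m : ℝ) + s * p)) := by
            refine lintegral_mono fun y => ?_
            have hDx : 0 < D x := hx.1
            rw [← ENNReal.ofReal_mul (by positivity)]
            refine ENNReal.ofReal_le_ofReal ?_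
            have hmin : 0 ≤ min (‖x - y‖ ^ θ) (‖x - y‖ * D x ^ (θ - 1)) :=
              le_min (by positivity) (by positivity)
            have h1 : |v x - v y| ≤ |C| * min (‖x - y‖ ^ θ) (‖x - y‖ * D x ^ (θ - 1)) := by
              obtain ⟨h1, h2⟩ := hosc x hxB hDx y
              rw [mul_min_of_nonneg _ _ (abs_nonneg C)]
              refine le_min (h1.trans ?_) (h2.trans ?_) <;> gcongr <;> exact le_abs_self C
            rw [mul_assoc, ← mul_div_assoc (|C| ^ p), ← Real.mul_rpow (abs_nonneg C) hmin]
            gcongr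
        _ = _ := by
            rw [lintegral_const_mul _ (by fun_prop), lintegral_scaled_kernel hx.1]
            ring
    · rw [lintegral_const_mul _ (by fun_prop)]
      refine ENNReal.mul_lt_top (ENNReal.mul_lt_top ENNReal.ofReal_lt_top hK) ?_
      refine lt_of_le_of_lt (lintegral_rpow_neg_le hDm hD (κ := κ) (by nlinarith) hvol) ?_
      exact ENNReal.mul_lt_top hA (layerConst_lt_top hκ)
  calc nonlocalEnergy s p v = ∫⁻ x, ∫⁻ y, F x y := rfl
    _ ≤ ∫⁻ x, ∫⁻ y, (B.indicator (fun x => F x y) x + B.indicator (fun y => F x y) y) :=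
        lintegral_mono fun x => lintegral_mono fun y => hle x y
    _ = (∫⁻ x, ∫⁻ y, B.indicator (fun x => F x y) x) +
          ∫⁻ x, ∫⁻ y, B.indicator (fun y => F x y) y := by
        rw [← lintegral_add_left (hm1.lintegral_prod_right')]
        refine lintegral_congr fun x => ?_
        exact lintegral_add_left (hm1.comp measurable_prodMk_left) _
    _ = (∫⁻ x, ∫⁻ y, B.indicator (fun x => F x y) x) +
          ∫⁻ x, ∫⁻ y, B.indicator (fun x => F x y) x := by
        congr 1
        rw [lintegral_lintegral_swap hm2.aemeasurable]
        refine lintegral_congr fun y => lintegral_congr fun x => ?_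
        simp only [Set.indicator, hsymm x y]
    _ < ⊤ := ENNReal.add_lt_top.2 ⟨hhalf, hhalf⟩

/-! ### Weak gradients and the local energy -/

lemma IsTestFunction.integrable_smul {m : ℕ} {F : Type*} [NormedAddCommGroup F] [NormedSpace ℝ F]
    {U : Set (Eu m)} {ψ : Eu m → ℝ} (hψ : Continuous ψ) (hc : HasCompactSupport ψ)
    (hU : tsupport ψ ⊆ U) {f : Eu m → F} (hf : LocallyIntegrableOn f U) :
    Integrable fun x => ψ x • f x := by
  have h := (hf.integrableOn_compact_subset hU hc).continuousOn_smul hψ.continuousOn hc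
  refine (integrableOn_iff_integrable_of_support_subset ?_).1 h
  intro x hx
  refine subset_tsupport _ fun h0 => hx ?_
  simp [h0]

lemma IsTestFunction.continuous_fderiv_apply {m : ℕ} {U : Set (Eu m)} {φ : Eu m → ℝ}
    (hφ : IsTestFunction U φ) (w : Eu m) : Continuous fun x => fderiv ℝ φ x w :=
  (hφ.1.continuous_fderiv (by norm_num)).clm_apply continuous_const

lemma IsTestFunction.tsupport_fderiv_apply {m : ℕ} {U : Set (Eu m)} {φ : Eu m → ℝ}
    (hφ : IsTestFunction U φ) (w : Eu m) : tsupport (fun x => fderiv ℝ φ x w) ⊆ U :=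
  (tsupport_fderiv_apply_subset ℝ w).trans hφ.2.2

lemma IsTestFunction.setIntegral_mul {m : ℕ} {U : Set (Eu m)} {φ : Eu m → ℝ}
    (hφ : tsupport φ ⊆ U) (f : Eu m → ℝ) : ∫ x in U, φ x * f x = ∫ x, φ x * f x := by
  refine setIntegral_eq_integral_of_forall_compl_eq_zero fun x hx => ?_
  rw [image_eq_zero_of_notMem_tsupport fun h => hx (hφ h), zero_mul]

lemma hasWeakGradientOn_of_contDiffOn {m : ℕ} {U : Set (Eu m)} (hU : IsOpen U) {v : Eu m → ℝ}
    (hv : ContDiffOn ℝ 1 v U) : HasWeakGradientOn U v (gradient v) := by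
  have hg : ContinuousOn (gradient v) U :=
    (InnerProductSpace.toDual ℝ (Eu m)).symm.continuous.comp_continuousOn
      (hv.continuousOn_fderiv_of_isOpen hU le_rfl)
  have hvi := hv.continuousOn.locallyIntegrableOn (μ := volume) hU.measurableSet
  have hgi := hg.locallyIntegrableOn (μ := volume) hU.measurableSet
  refine ⟨hvi, hgi, fun φ hφ w => ?_⟩
  have h1 : Integrable fun x => fderiv ℝ φ x w * v x :=
    IsTestFunction.integrable_smul (hφ.continuous_fderiv_apply w) (hφ.2.1.fderiv_apply ℝ w)
      (hφ.tsupport_fderiv_apply w) hvi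
  have h2 : Integrable fun x => φ x * v x :=
    IsTestFunction.integrable_smul hφ.1.continuous hφ.2.1 hφ.2.2 hvi
  have h3 : Integrable fun x => φ x * fderiv ℝ v x w := by
    have := (IsTestFunction.integrable_smul hφ.1.continuous hφ.2.1 hφ.2.2 hgi).inner_const (𝕜 := ℝ) w
    refine this.congr (Eventually.of_forall fun x => ?_)
    simp [inner_smul_left]
  have key := integral_mul_fderiv_eq_neg_fderiv_mul_of_integrable (μ := volume) (f := φ) (g := v)
    (v := w) h1 h3 h2 (fun x _ => (hφ.1.differentiable (by norm_num)) x)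
    (fun x hx => (hv.differentiableOn (by norm_num)).differentiableAt (hU.mem_nhds (hφ.2.2 hx)))
  have e1 : ∫ x in U, v x * fderiv ℝ φ x w = ∫ x, fderiv ℝ φ x w * v x := by
    rw [← IsTestFunction.setIntegral_mul (hφ.tsupport_fderiv_apply w)]
    exact integral_congr_ae (Eventually.of_forall fun x => mul_comm _ _)
  have e2 : ∫ x in U, φ x * inner ℝ (gradient v x) w = ∫ x, φ x * fderiv ℝ v x w := by
    rw [IsTestFunction.setIntegral_mul hφ.2.2]
    simp
  rw [e1, e2, key, neg_neg]

/-- Weak gradients are unique almost everywhere. -/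
lemma HasWeakGradientOn.ae_eq {m : ℕ} {U : Set (Eu m)} (hU : IsOpen U) {v : Eu m → ℝ}
    {g₁ g₂ : Eu m → Eu m} (h₁ : HasWeakGradientOn U v g₁) (h₂ : HasWeakGradientOn U v g₂) :
    ∀ᵐ x, x ∈ U → g₁ x = g₂ x := by
  have h := hU.ae_eq_zero_of_integral_contDiff_smul_eq_zero (h₁.2.1.sub h₂.2.1) (fun φ hφ hc hs => by
    have i1 := IsTestFunction.integrable_smul hφ.continuous hc hs h₁.2.1
    have i2 := IsTestFunction.integrable_smul hφ.continuous hc hs h₂.2.1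
    simp only [Pi.sub_apply, smul_sub]
    rw [integral_sub i1 i2, sub_eq_zero]
    refine ext_inner_left ℝ fun w => ?_
    rw [← integral_inner i1, ← integral_inner i2]
    have e1 := h₁.2.2 φ ⟨hφ, hc, hs⟩ w
    rw [h₂.2.2 φ ⟨hφ, hc, hs⟩ w, neg_inj, IsTestFunction.setIntegral_mul hs,
      IsTestFunction.setIntegral_mul hs] at e1
    simpa [inner_smul_right, real_inner_comm w] using e1.symm)
  filter_upwards [h] with x hx hxU using sub_eq_zero.1 (hx hxU)

lemma HasWeakGradientOn.add {m : ℕ} {U : Set (Eu m)} {v₁ v₂ : Eu m → ℝ}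
    {g₁ g₂ : Eu m → Eu m} (h₁ : HasWeakGradientOn U v₁ g₁) (h₂ : HasWeakGradientOn U v₂ g₂) :
    HasWeakGradientOn U (fun x => v₁ x + v₂ x) (fun x => g₁ x + g₂ x) := by
  refine ⟨h₁.1.add h₂.1, h₁.2.1.add h₂.2.1, fun φ hφ w => ?_⟩
  have i : ∀ {v : Eu m → ℝ}, LocallyIntegrableOn v U → Integrable fun x => v x * fderiv ℝ φ x w :=
    fun hv => (IsTestFunction.integrable_smul (hφ.continuous_fderiv_apply w)
      (hφ.2.1.fderiv_apply ℝ w) (hφ.tsupport_fderiv_apply w) hv).congr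
        (Eventually.of_forall fun x => mul_comm _ _)
  have j : ∀ {g : Eu m → Eu m}, LocallyIntegrableOn g U →
      Integrable fun x => φ x * inner ℝ (g x) w := fun hg => by
    have := (IsTestFunction.integrable_smul hφ.1.continuous hφ.2.1 hφ.2.2 hg).inner_const (𝕜 := ℝ) w
    refine this.congr (Eventually.of_forall fun x => ?_)
    simp [inner_smul_left]
  simp only [add_mul, inner_add_left, mul_add]
  rw [integral_add (i h₁.1).integrableOn (i h₂.1).integrableOn,
    integral_add (j h₁.2.1).integrableOn (j h₂.2.1).integrableOn, h₁.2.2 φ hφ w, h₂.2.2 φ hφ w,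
    neg_add]

lemma HasWeakGradientOn.const_mul {m : ℕ} {U : Set (Eu m)} {v : Eu m → ℝ}
    {g : Eu m → Eu m} (h : HasWeakGradientOn U v g) (r : ℝ) :
    HasWeakGradientOn U (fun x => r * v x) (fun x => r • g x) := by
  refine ⟨h.1.smul r, h.2.1.smul r, fun φ hφ w => ?_⟩
  simp only [inner_smul_left, mul_assoc, mul_left_comm (φ _)]
  simp only [conj_trivial]
  rw [integral_const_mul, integral_const_mul, h.2.2 φ hφ w, mul_neg]

lemma localEnergy_le {m : ℕ} {q : ℝ} {a v : Eu m → ℝ} {g : Eu m → Eu m}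
    (h : HasWeakGradientOn (box m 1 ∩ {x | 0 < a x}) v g) :
    localEnergy q a v ≤ ∫⁻ x in box m 1, ENNReal.ofReal (1 / q * (a x * ‖g x‖ ^ q)) :=
  iInf₂_le g h

lemma isOpen_box (m : ℕ) (r : ℝ) : IsOpen (box m r) := by
  have : box m r = ⋂ i, {x : Eu m | |x i| < r} := by ext x; simp [box]
  rw [this]
  exact isOpen_iInter_of_finite fun i => isOpen_lt (by fun_prop) continuous_const

lemma isOpen_active {m : ℕ} {a : Eu m → ℝ} (ha : Continuous a) :
    IsOpen (box m 1 ∩ {x | 0 < a x}) :=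
  (isOpen_box m 1).inter (isOpen_lt continuous_const ha)

lemma volume_box_lt_top (m : ℕ) (r : ℝ) : volume (box m r) < ⊤ := by
  have : box m r = {x : Eu m | ∀ i, x i ∈ Set.Ioo (-r) r} := by
    ext x; simp [box, abs_lt]
  rw [this, volume_setOf_forall_mem]
  exact ENNReal.prod_lt_top fun i _ => by simp

/-- The energy is an integral over the part of the box where the weight is active. -/
lemma setLIntegral_box_eq {m : ℕ} {q : ℝ} {a : Eu m → ℝ} (ha : Continuous a)
    (ha0 : ∀ x, 0 ≤ a x) (g : Eu m → Eu m) :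
    ∫⁻ x in box m 1, ENNReal.ofReal (1 / q * (a x * ‖g x‖ ^ q)) =
      ∫⁻ x in box m 1 ∩ {x | 0 < a x}, ENNReal.ofReal (1 / q * (a x * ‖g x‖ ^ q)) := by
  have hm : MeasurableSet {x | 0 < a x} := measurableSet_lt measurable_const ha.measurable
  rw [← lintegral_inter_add_sdiff _ (box m 1) hm,
    setLIntegral_congr_fun (g := fun _ => 0) ((isOpen_box m 1).measurableSet.diff hm)]
  · simp
  rintro x ⟨_, hx'⟩
  have : a x = 0 := le_antisymm (not_lt.1 hx') (ha0 x)
  simp [this]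

lemma localEnergy_const_mul {m : ℕ} {q ν : ℝ} (hν : 0 < ν) {a : Eu m → ℝ}
    (v : Eu m → ℝ) :
    localEnergy q (fun x => ν * a x) v = ENNReal.ofReal ν * localEnergy q a v := by
  have hset : {x | 0 < ν * a x} = {x | 0 < a x} := by
    ext x; exact mul_pos_iff_of_pos_left hν
  have hνe : ENNReal.ofReal ν ≠ 0 := by simpa using hν
  unfold localEnergy
  rw [hset]
  simp_rw [ENNReal.mul_iInf_of_ne hνe ENNReal.ofReal_ne_top]
  refine iInf_congr fun g => iInf_congr fun _ => ?_
  rw [← lintegral_const_mul' _ _ ENNReal.ofReal_ne_top]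
  refine lintegral_congr fun x => ?_
  rw [← ENNReal.ofReal_mul hν.le]
  congr 1; ring

lemma localEnergy_mul_le {m : ℕ} {q r : ℝ} (hr : 0 < r) {a : Eu m → ℝ}
    (v : Eu m → ℝ) :
    localEnergy q a (fun x => r * v x) ≤ ENNReal.ofReal (r ^ q) * localEnergy q a v := by
  have hre : ENNReal.ofReal (r ^ q) ≠ 0 := by
    have : 0 < r ^ q := by positivity
    simpa using this
  conv_rhs => unfold localEnergy
  simp_rw [ENNReal.mul_iInf_of_ne hre ENNReal.ofReal_ne_top]
  refine le_iInf fun g => le_iInf fun hg => (localEnergy_le (hg.const_mul r)).trans (le_of_eq ?_)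
  rw [← lintegral_const_mul' _ _ ENNReal.ofReal_ne_top]
  refine lintegral_congr fun x => ?_
  rw [← ENNReal.ofReal_mul (by positivity), norm_smul, Real.norm_eq_abs, abs_of_pos hr,
    Real.mul_rpow hr.le (norm_nonneg _)]
  congr 1; ring

/-- The quasi-triangle inequality for the local energy. -/
lemma localEnergy_add_le {m : ℕ} {q : ℝ} (hq : 1 < q) {a : Eu m → ℝ} (ha : Continuous a)
    (ha0 : ∀ x, 0 ≤ a x) (v₁ v₂ : Eu m → ℝ) :
    localEnergy q a (fun x => v₁ x + v₂ x) ≤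
      ENNReal.ofReal (2 ^ q) * (localEnergy q a v₁ + localEnergy q a v₂) := by
  have h2e : ENNReal.ofReal ((2 : ℝ) ^ q) ≠ 0 := by
    have : (0 : ℝ) < 2 ^ q := by positivity
    simpa using this
  conv_rhs => unfold localEnergy
  simp_rw [ENNReal.iInf_add, ENNReal.add_iInf, ENNReal.mul_iInf_of_ne h2e ENNReal.ofReal_ne_top]
  refine le_iInf fun g₁ => le_iInf fun h₁ => le_iInf fun g₂ => le_iInf fun h₂ => ?_
  refine (localEnergy_le (h₁.add h₂)).trans ?_
  simp_rw [setLIntegral_box_eq ha ha0]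
  set U := box m 1 ∩ {x | 0 < a x}
  have hm : AEMeasurable (fun x => ENNReal.ofReal (1 / q * (a x * ‖g₁ x‖ ^ q))) (volume.restrict U) :=
    ((ha.measurable.aemeasurable.mul
      (h₁.2.1.aestronglyMeasurable.norm.aemeasurable.pow_const q)).const_mul _).ennreal_ofReal
  rw [← lintegral_add_left' hm, ← lintegral_const_mul' _ _ ENNReal.ofReal_ne_top]
  refine lintegral_mono fun x => ?_
  rw [← ENNReal.ofReal_add (by have := ha0 x; positivity) (by have := ha0 x; positivity),
    ← ENNReal.ofReal_mul (by positivity)]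
  refine ENNReal.ofReal_le_ofReal ?_
  have h3 : ‖g₁ x + g₂ x‖ ^ q ≤ 2 ^ q * (‖g₁ x‖ ^ q + ‖g₂ x‖ ^ q) := by
    have hmax : ‖g₁ x + g₂ x‖ ≤ 2 * max ‖g₁ x‖ ‖g₂ x‖ := by
      have := norm_add_le (g₁ x) (g₂ x)
      linarith [le_max_left ‖g₁ x‖ ‖g₂ x‖, le_max_right ‖g₁ x‖ ‖g₂ x‖]
    calc ‖g₁ x + g₂ x‖ ^ q ≤ (2 * max ‖g₁ x‖ ‖g₂ x‖) ^ q :=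
          Real.rpow_le_rpow (norm_nonneg _) hmax (by linarith)
      _ = 2 ^ q * (max ‖g₁ x‖ ‖g₂ x‖) ^ q :=
          Real.mul_rpow (by norm_num) (le_max_of_le_left (norm_nonneg _))
      _ ≤ _ := by
          gcongr
          have p1 : 0 ≤ ‖g₁ x‖ ^ q := by positivity
          have p2 : 0 ≤ ‖g₂ x‖ ^ q := by positivity
          rcases max_cases ‖g₁ x‖ ‖g₂ x‖ with ⟨h, _⟩ | ⟨h, _⟩ <;> rw [h] <;> linarith
  calc 1 / q * (a x * ‖g₁ x + g₂ x‖ ^ q) ≤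
        1 / q * (a x * (2 ^ q * (‖g₁ x‖ ^ q + ‖g₂ x‖ ^ q))) := by
        have := ha0 x
        gcongr
    _ = _ := by ring

lemma localEnergy_lt_top {m : ℕ} {q M C : ℝ} (hq : 1 < q) {a v : Eu m → ℝ} (ha : Continuous a)
    (ha0 : ∀ x, 0 ≤ a x) (haM : ∀ x, a x ≤ M)
    (hv : ContDiffOn ℝ 1 v (box m 1 ∩ {x | 0 < a x}))
    (hC : ∀ x ∈ box m 1 ∩ {x | 0 < a x}, ‖fderiv ℝ v x‖ ≤ C) : localEnergy q a v < ⊤ := by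
  refine (localEnergy_le (hasWeakGradientOn_of_contDiffOn (isOpen_active ha) hv)).trans_lt ?_
  rw [setLIntegral_box_eq ha ha0]
  refine lt_of_le_of_lt (setLIntegral_mono (g := fun _ => ENNReal.ofReal (1 / q * (M * C ^ q)))
    measurable_const fun x hx => ENNReal.ofReal_le_ofReal ?_) ?_
  · have h0 := ha0 x
    have h1 := haM x
    have h2 : ‖gradient v x‖ ≤ C := by
      rw [gradient, LinearIsometryEquiv.norm_map]; exact hC x hx
    have : 0 ≤ M := h0.trans h1
    gcongr
  · rw [setLIntegral_const]
    exact ENNReal.mul_lt_top ENNReal.ofReal_lt_top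
      ((measure_mono Set.inter_subset_left).trans_lt (volume_box_lt_top m 1))

/-- A function that is locally constant where the weight is active has no local energy, wherever it
jumps otherwise. -/
lemma localEnergy_eq_zero {m : ℕ} {q : ℝ} (hq : 1 < q) {a v : Eu m → ℝ} (ha : Continuous a)
    (ha0 : ∀ x, 0 ≤ a x)
    (hv : ∀ x ∈ box m 1 ∩ {x | 0 < a x}, ∃ c : ℝ, v =ᶠ[𝓝 x] fun _ => c) :
    localEnergy q a v = 0 := by
  have hcd : ContDiffOn ℝ 1 v (box m 1 ∩ {x | 0 < a x}) := fun x hx => by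
    obtain ⟨c, hc⟩ := hv x hx
    exact (contDiffAt_const.congr_of_eventuallyEq hc).contDiffWithinAt
  refine le_antisymm ?_ zero_le
  refine (localEnergy_le (hasWeakGradientOn_of_contDiffOn (isOpen_active ha) hcd)).trans ?_
  rw [setLIntegral_box_eq ha ha0]
  refine (setLIntegral_mono (g := fun _ => 0) measurable_const fun x hx => ?_).trans (by simp)
  obtain ⟨c, hc⟩ := hv x hx
  have : gradient v x = 0 := by
    rw [gradient, hc.fderiv_eq]; simp
  rw [this, norm_zero, Real.zero_rpow (by linarith)]
  simp

/-! ### From a lower bound on smooth competitors to the gap -/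

/-- A lower bound for the local energy on `u + C_c^∞(Ω)` passes to `u + H_0`, up to the constant of
the quasi-triangle inequality: convergence in the Luxemburg norm forces the local energy of the
difference to `0`. -/
lemma le_energy_of_mem_spaceH {m : ℕ} {s p q : ℝ} (hq : 1 < q) {a u v : Eu m → ℝ}
    (ha : Continuous a) (ha0 : ∀ x, 0 ≤ a x) {c : ℝ≥0∞}
    (hc : ∀ φ, IsTestFunction (box m 1) φ → c ≤ localEnergy q a (fun x => u x + φ x))
    (hv : v ∈ spaceH s p q a u) : c ≤ ENNReal.ofReal (2 ^ q) * energy s p q a v := by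
  have hstep : ∀ r : ℝ, 0 < r → r < 1 →
      c ≤ ENNReal.ofReal (2 ^ q) * (energy s p q a v + ENNReal.ofReal r) := by
    intro r hr hr1
    obtain ⟨φ, hφ, hlux⟩ := hv.2 (ENNReal.ofReal r) (by simpa using hr)
    simp only [luxemburgNorm, iInf_lt_iff] at hlux
    obtain ⟨t, ht, hE, htr⟩ := hlux
    rw [ENNReal.ofReal_lt_ofReal_iff hr] at htr
    set w : Eu m → ℝ := fun x => (v x - u x - φ x) / t
    have hw : localEnergy q a w ≤ 1 := le_trans le_add_self hE
    have e : (fun x => u x + φ x) = fun x => v x + t * (-1 * w x) := by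
      funext x; simp only [w]; field_simp; ring
    have hneg : localEnergy q a (fun x => -1 * w x) ≤ localEnergy q a w := by
      conv_rhs => unfold localEnergy
      refine le_iInf fun g => le_iInf fun hg => ?_
      refine (localEnergy_le (hg.const_mul (-1))).trans (le_of_eq ?_)
      simp
    refine (hc φ hφ).trans ?_
    rw [e]
    refine (localEnergy_add_le hq ha ha0 _ _).trans ?_
    gcongr
    · exact le_add_self
    · refine (localEnergy_mul_le ht _).trans ?_
      calc _ ≤ ENNReal.ofReal (t ^ q) * 1 := by gcongr; exact hneg.trans hw
        _ ≤ ENNReal.ofReal r := by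
          rw [mul_one]
          refine ENNReal.ofReal_le_ofReal ?_
          calc t ^ q ≤ t ^ (1 : ℝ) :=
                Real.rpow_le_rpow_of_exponent_ge ht (by linarith) hq.le
            _ ≤ r := by rw [Real.rpow_one]; exact htr.le
  have hlim : Tendsto (fun r : ℝ => ENNReal.ofReal (2 ^ q) * (energy s p q a v + ENNReal.ofReal r))
      (𝓝[>] 0) (𝓝 (ENNReal.ofReal (2 ^ q) * (energy s p q a v + 0))) := by
    refine ENNReal.Tendsto.const_mul ?_ (Or.inr ENNReal.ofReal_ne_top)
    refine Tendsto.const_add _ ?_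
    simpa using (ENNReal.tendsto_ofReal (tendsto_id (α := ℝ) (x := 𝓝 0))).mono_left
      nhdsWithin_le_nhds
  rw [add_zero] at hlim
  refine ge_of_tendsto hlim ?_
  filter_upwards [Ioo_mem_nhdsGT (zero_lt_one' ℝ)] with r hr using hstep r hr.1 hr.2

/-- The competitor `uC` does not see the local phase, so that multiplying the weight by a large
constant raises only the energy of the functions in `uD + H_0`. -/
lemma realizesGap_of_lower_bound {m : ℕ} {s p q α : ℝ} (hq : 1 < q) {V : Set (Eu m → ℝ)}
    {a uC uD : Eu m → ℝ} (h1 : nonlocalEnergy s p uC < ⊤) (h2 : localEnergy q a uC = 0)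
    (hc : ∃ c : ℝ≥0∞, 0 < c ∧ ∀ v ∈ V, (∀ x, x ∉ box m 1 → v x = uD x) → c ≤ localEnergy q a v)
    (hV : ∀ φ, IsTestFunction (box m 1) φ → (fun x => uD x + φ x) ∈ V)
    (hw : IsWeight α a) (hb : IsBoundaryValue uD)
    (hint : LocallyIntegrable fun x => uC x - uD x)
    (hnl : nonlocalEnergy s p (fun x => uC x - uD x) < ⊤)
    (hl : localEnergy q a (fun x => uC x - uD x) < ⊤)
    (hz : ∀ᵐ x, x ∉ box m 1 → uC x - uD x = 0) :
    RealizesGap s p q α V a uC uD := by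
  refine ⟨h1, h2, hc, hw, hb, ?_⟩
  obtain ⟨c', hc'0, hc'⟩ := hc
  set c := min c' 1
  have hc0 : 0 < c := lt_min hc'0 one_pos
  have hc1 : c ≠ ⊤ := ne_top_of_le_ne_top ENNReal.one_ne_top (min_le_right _ _)
  set J := (nonlocalEnergy s p uC).toReal
  have hJ : nonlocalEnergy s p uC = ENNReal.ofReal J := (ENNReal.ofReal_toReal h1.ne).symm
  have hJ0 : 0 ≤ J := ENNReal.toReal_nonneg
  have hcr : 0 < c.toReal := ENNReal.toReal_pos hc0.ne' hc1
  have hacont : Continuous a := hw.2.2.1.1.continuous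
  -- the factor `2 ^ q` is the loss in `le_energy_of_mem_spaceH`
  refine ⟨2 ^ q * (J + 1) / c.toReal, by positivity, fun ν hν => ?_⟩
  have hν0 : 0 < ν := lt_of_lt_of_le (by positivity) hν
  refine ⟨⟨hint, ?_, hz⟩, ?_⟩
  · rw [energy, localEnergy_const_mul hν0]
    exact ENNReal.add_lt_top.2 ⟨hnl, ENNReal.mul_lt_top ENNReal.ofReal_lt_top hl⟩
  · have hE : energy s p q (fun x => ν * a x) uC = ENNReal.ofReal J := by
      rw [energy, localEnergy_const_mul hν0, h2, mul_zero, add_zero, hJ]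
    rw [hE]
    refine lt_of_lt_of_le (b := ENNReal.ofReal (J + 1))
      ((ENNReal.ofReal_lt_ofReal_iff (by positivity)).2 (by linarith)) ?_
    refine le_iInf₂ fun v hv => ?_
    have hkey := le_energy_of_mem_spaceH (a := fun x => ν * a x) (c := ENNReal.ofReal ν * c) hq
      (continuous_const.mul hacont) (fun x => mul_nonneg hν0.le (hw.1 x)) (fun φ hφ => by
        rw [localEnergy_const_mul hν0]
        gcongr
        refine (min_le_left _ _).trans (hc' _ (hV φ hφ) fun x hx => ?_)
        rw [image_eq_zero_of_notMem_tsupport fun h => hx (hφ.2.2 h), add_zero]) hv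
    have h2q : (0 : ℝ) < 2 ^ q := by positivity
    have h3 : ENNReal.ofReal (2 ^ q) * ENNReal.ofReal (J + 1) ≤ ENNReal.ofReal ν * c := by
      rw [← ENNReal.ofReal_toReal hc1, ← ENNReal.ofReal_mul h2q.le, ← ENNReal.ofReal_mul hν0.le]
      refine ENNReal.ofReal_le_ofReal ?_
      rwa [div_le_iff₀ hcr] at hν
    exact (ENNReal.mul_le_mul_iff_right (by simpa using h2q) ENNReal.ofReal_ne_top).1
      (h3.trans hkey)

lemma IsWeight.const_mul {m : ℕ} {α ν : ℝ} (hν : 0 ≤ ν) {a : Eu m → ℝ} (h : IsWeight α a) :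
    IsWeight α fun x => ν * a x := by
  obtain ⟨h0, ⟨M, hM⟩, ⟨hcd, C, hC⟩, hz⟩ := h
  refine ⟨fun x => mul_nonneg hν (h0 x), ⟨ν * M, fun x => mul_le_mul_of_nonneg_left (hM x) hν⟩,
    ⟨contDiff_const.mul hcd, ν * C, fun x y => ?_⟩, fun x hx => by simp [hz x hx]⟩
  have e : (fun x => ν * a x) = ν • a := rfl
  rw [e, iteratedFDeriv_const_smul_apply hcd.contDiffAt,
    iteratedFDeriv_const_smul_apply hcd.contDiffAt, ← smul_sub, norm_smul, Real.norm_eq_abs,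
    abs_of_nonneg hν, mul_assoc]
  exact mul_le_mul_of_nonneg_left (hC x y) hν

lemma RealizesGap.exists_lavrentievGap {m : ℕ} {s p q α : ℝ} {V : Set (Eu m → ℝ)}
    {a uC uD : Eu m → ℝ} (h : RealizesGap s p q α V a uC uD) :
    ∃ a u : Eu m → ℝ, IsWeight α a ∧ IsBoundaryValue u ∧ LavrentievGap s p q a u := by
  obtain ⟨_, _, _, hw, hb, ν₀, hν₀, hgap⟩ := h
  obtain ⟨hmem, hlt⟩ := hgap ν₀ le_rfl
  exact ⟨_, uD, hw.const_mul hν₀.le, hb, (iInf₂_le uC hmem).trans_lt hlt⟩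

/-! ### Functions with derivatives of homogeneous size -/

lemma isOpen_pos {X : Type*} [TopologicalSpace X] {h : X → ℝ} (hc : Continuous h) :
    IsOpen {x | 0 < h x} :=
  isOpen_lt continuous_const hc

section Symbol

variable {X Y V W : Type*} [NormedAddCommGroup X] [NormedSpace ℝ X]
  [NormedAddCommGroup Y] [NormedSpace ℝ Y] [NormedAddCommGroup V] [NormedSpace ℝ V]
  [NormedAddCommGroup W] [NormedSpace ℝ W]

/-- The `j`-th derivative of `f` is of size `h ^ (σ - j)` on `{h > 0}`. -/
def SymbolBound (h : X → ℝ) (σ : ℝ) (j : ℕ) (f : X → V) : Prop :=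
  ∃ C : ℝ, ∀ x, 0 < h x → ‖iteratedFDeriv ℝ j f x‖ ≤ C * h x ^ (σ - j)

/-- A symbol of order `σ`: smooth on `{h > 0}`, with derivatives of order `j` of size
`h ^ (σ - j)`. -/
def IsSymbol (h : X → ℝ) (σ : ℝ) (f : X → V) : Prop :=
  ContDiffOn ℝ ∞ f {x | 0 < h x} ∧ ∀ j, SymbolBound h σ j f

lemma SymbolBound.congr {h : X → ℝ} (hc : Continuous h) {σ : ℝ} {j : ℕ} {f g : X → V}
    (hf : SymbolBound h σ j f) (hfg : Set.EqOn f g {x | 0 < h x}) : SymbolBound h σ j g := by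
  obtain ⟨C, hC⟩ := hf
  refine ⟨C, fun x hx => ?_⟩
  have : f =ᶠ[𝓝 x] g := hfg.eventuallyEq_of_mem ((isOpen_pos hc).mem_nhds hx)
  rw [← (this.iteratedFDeriv ℝ j).eq_of_nhds]
  exact hC x hx

lemma IsSymbol.congr {h : X → ℝ} (hc : Continuous h) {σ : ℝ} {f g : X → V}
    (hf : IsSymbol h σ f) (hfg : Set.EqOn f g {x | 0 < h x}) : IsSymbol h σ g :=
  ⟨hf.1.congr fun _ hx => (hfg hx).symm, fun j => (hf.2 j).congr hc hfg⟩

/-- The Leibniz rule. The bounds are only required up to the order `j`, so that the lemma can be used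
within an induction on the order. -/
lemma SymbolBound.smul {h : X → ℝ} (hc : Continuous h) {σ τ : ℝ} {j : ℕ} {f : X → ℝ} {g : X → V}
    (hfd : ContDiffOn ℝ ∞ f {x | 0 < h x}) (hgd : ContDiffOn ℝ ∞ g {x | 0 < h x})
    (hf : ∀ i ≤ j, SymbolBound h σ i f) (hg : ∀ i ≤ j, SymbolBound h τ i g) :
    SymbolBound h (σ + τ) j (fun x => f x • g x) := by
  choose! C hC using hf
  choose! D hD using hg
  refine ⟨∑ i ∈ Finset.range (j + 1), j.choose i * |C i| * |D (j - i)|, fun x hx => ?_⟩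
  have hop := isOpen_pos hc
  have key := norm_iteratedFDerivWithin_smul_le hfd hgd hop.uniqueDiffOn (x := x) hx (n := j)
    (mod_cast le_top)
  rw [iteratedFDerivWithin_of_isOpen j hop hx] at key
  refine key.trans ?_
  rw [Finset.sum_mul]
  refine Finset.sum_le_sum fun i hi => ?_
  have hij : i ≤ j := Nat.lt_succ_iff.1 (Finset.mem_range.1 hi)
  rw [iteratedFDerivWithin_of_isOpen i hop hx, iteratedFDerivWithin_of_isOpen (j - i) hop hx]
  have h1 := hC i hij x hx
  have h2 := hD (j - i) (Nat.sub_le _ _) x hx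
  have hp := fun y : ℝ => Real.rpow_nonneg (le_of_lt hx) y
  calc (j.choose i : ℝ) * ‖iteratedFDeriv ℝ i f x‖ * ‖iteratedFDeriv ℝ (j - i) g x‖
      ≤ j.choose i * (|C i| * h x ^ (σ - i)) * (|D (j - i)| * h x ^ (τ - (j - i : ℕ))) := by
        have := hp (σ - i)
        have := hp (τ - (j - i : ℕ))
        gcongr
        · exact h1.trans (by gcongr; exact le_abs_self _)
        · exact h2.trans (by gcongr; exact le_abs_self _)
    _ = _ := by
        have : h x ^ (σ + τ - j) = h x ^ (σ - i) * h x ^ (τ - (j - i : ℕ)) := by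
          rw [← Real.rpow_add hx]; congr 1; push_cast [hij]; ring
        rw [this]; ring

lemma IsSymbol.smul {h : X → ℝ} (hc : Continuous h) {σ τ : ℝ} {f : X → ℝ} {g : X → V}
    (hf : IsSymbol h σ f) (hg : IsSymbol h τ g) : IsSymbol h (σ + τ) (fun x => f x • g x) :=
  ⟨hf.1.smul hg.1, fun _ => SymbolBound.smul hc hf.1 hg.1 (fun i _ => hf.2 i) (fun i _ => hg.2 i)⟩

lemma IsSymbol.comp_clm {h : X → ℝ} (hc : Continuous h) {σ : ℝ} {f : X → V}
    (hf : IsSymbol h σ f) (L : Y →L[ℝ] X) :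
    IsSymbol (fun y => h (L y)) σ (fun y => f (L y)) := by
  refine ⟨hf.1.comp L.contDiff.contDiffOn fun y hy => hy, fun j => ?_⟩
  obtain ⟨C, hC⟩ := hf.2 j
  refine ⟨‖L‖ ^ j * C, fun y hy => ?_⟩
  have hop := isOpen_pos hc
  have hop' : IsOpen (L ⁻¹' {x | 0 < h x}) := hop.preimage L.continuous
  have key := L.iteratedFDerivWithin_comp_right hf.1 hop.uniqueDiffOn hop'.uniqueDiffOn (x := y) hy
    (i := j) (mod_cast le_top)
  rw [iteratedFDerivWithin_of_isOpen j hop' hy, iteratedFDerivWithin_of_isOpen j hop hy] at key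
  have e : (fun y => f (L y)) = f ∘ L := rfl
  rw [e, key]
  refine (ContinuousMultilinearMap.norm_compContinuousLinearMap_le _ _).trans ?_
  rw [Finset.prod_const, Finset.card_univ, Fintype.card_fin]
  calc _ ≤ C * h (L y) ^ (σ - j) * ‖L‖ ^ j := by gcongr; exact hC _ hy
    _ = _ := by ring

lemma IsSymbol.of_const_mul {h : X → ℝ} {c : ℝ} (hc : 0 < c) {σ : ℝ} {f : X → V}
    (hf : IsSymbol (fun x => c * h x) σ f) : IsSymbol h σ f := by
  have hset : {x | 0 < c * h x} = {x | 0 < h x} := by ext x; exact mul_pos_iff_of_pos_left hc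
  refine ⟨hset ▸ hf.1, fun j => ?_⟩
  obtain ⟨C, hC⟩ := hf.2 j
  refine ⟨C * c ^ (σ - j), fun x hx => (hC x (by positivity)).trans (le_of_eq ?_)⟩
  rw [Real.mul_rpow hc.le (le_of_lt hx), mul_assoc]

lemma IsSymbol.abs {h : X → ℝ} {σ : ℝ} {f : X → V} (hc : Continuous h)
    (h1 : IsSymbol h σ f) (h2 : IsSymbol (fun x => -h x) σ f) : IsSymbol (fun x => |h x|) σ f := by
  refine ⟨fun x hx => ?_, fun j => ?_⟩
  · have hx' : 0 < |h x| := hx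
    rcases lt_or_gt_of_ne (abs_pos.1 hx') with h | h
    · exact (h2.1.contDiffAt ((isOpen_pos hc.neg).mem_nhds (by simpa using h))).contDiffWithinAt
    · exact (h1.1.contDiffAt ((isOpen_pos hc).mem_nhds h)).contDiffWithinAt
  · obtain ⟨C, hC⟩ := h1.2 j
    obtain ⟨D, hD⟩ := h2.2 j
    refine ⟨max C D, fun x hx => ?_⟩
    have hx' : 0 < |h x| := hx
    change _ ≤ max C D * |h x| ^ _
    rcases lt_or_gt_of_ne (abs_pos.1 hx') with hlt | hlt
    · rw [abs_of_neg hlt]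
      refine (hD x (by simpa using hlt)).trans ?_
      have : 0 ≤ (-h x) ^ (σ - j) := Real.rpow_nonneg (by linarith) _
      gcongr
      exact le_max_right _ _
    · rw [abs_of_pos hlt]
      refine (hC x hlt).trans ?_
      gcongr
      exact le_max_left _ _

lemma isSymbol_rpow (σ : ℝ) : IsSymbol (fun t : ℝ => t) σ (fun t : ℝ => t ^ σ) := by
  refine ⟨fun t ht => (Real.contDiffAt_rpow_const_of_ne (ne_of_gt ht)).contDiffWithinAt,
    fun j => ⟨|(descPochhammer ℝ j).eval σ|, fun t ht => ?_⟩⟩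
  rw [norm_iteratedFDeriv_eq_norm_iteratedDeriv, iteratedDeriv_eq_iterate,
    Real.iter_deriv_rpow_const, norm_mul, Real.norm_eq_abs, Real.norm_eq_abs,
    abs_of_nonneg (Real.rpow_nonneg (le_of_lt ht) _)]

/-- A smooth compactly supported function is a symbol of order `0`. -/
lemma isSymbol_of_hasCompactSupport {h : X → ℝ} {R : ℝ} {f : X → V}
    (hf : ContDiff ℝ ∞ f) (hs : HasCompactSupport f) (hR : ∀ x ∈ tsupport f, h x ≤ R) :
    IsSymbol h 0 f := by
  refine ⟨hf.contDiffOn, fun j => ?_⟩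
  obtain ⟨C, hC⟩ := (hs.iteratedFDeriv (𝕜 := ℝ) j).exists_bound_of_continuous
    (hf.continuous_iteratedFDeriv (m := j) (mod_cast le_top))
  refine ⟨max C 0 * |R| ^ (j : ℝ), fun x hx => ?_⟩
  by_cases hx' : x ∈ tsupport f
  · have h1 : 1 ≤ |R| ^ (j : ℝ) * h x ^ (0 - j : ℝ) := by
      rw [zero_sub, Real.rpow_neg hx.le, ← div_eq_mul_inv, one_le_div (by positivity)]
      exact Real.rpow_le_rpow hx.le ((hR x hx').trans (le_abs_self R)) (by positivity)
    calc _ ≤ max C 0 * 1 := by rw [mul_one]; exact (hC x).trans (le_max_left _ _)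
      _ ≤ max C 0 * (|R| ^ (j : ℝ) * h x ^ (0 - j : ℝ)) := by gcongr
      _ = _ := by ring
  · have : iteratedFDeriv ℝ j f x = 0 := by
      by_contra hne
      exact hx' (support_iteratedFDeriv_subset j hne)
    rw [this, norm_zero]
    positivity

/-! ### Hölder regularity of symbols -/

/-- A function bounded by `h ^ β` whose gradient is bounded by `h ^ (β - 1)` is `β`-Hölder. -/
lemma exists_holder_of_bounds {h : X → ℝ} (h0 : ∀ x, 0 ≤ h x)
    (hlip : ∀ x y, |h x - h y| ≤ ‖x - y‖) {β : ℝ} (hβ0 : 0 < β) (hβ1 : β ≤ 1) {f : X → V}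
    (hz : ∀ x, h x = 0 → f x = 0) (hd : ∀ x, 0 < h x → DifferentiableAt ℝ f x)
    {C : ℝ} (hf : ∀ x, 0 < h x → ‖f x‖ ≤ C * h x ^ β)
    (hf' : ∀ x, 0 < h x → ‖fderiv ℝ f x‖ ≤ C * h x ^ (β - 1)) :
    ∃ C' : ℝ, ∀ x y, ‖f x - f y‖ ≤ C' * ‖x - y‖ ^ β := by
  refine ⟨|C| * 2 ^ β + |C| * 3 ^ β, fun x y => ?_⟩
  have hfb : ∀ x, ‖f x‖ ≤ |C| * h x ^ β := by
    intro x
    rcases (h0 x).eq_or_lt with h | h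
    · rw [hz x h.symm, norm_zero]
      have := h0 x
      positivity
    · exact (hf x h).trans (by gcongr; exact le_abs_self _)
  rcases eq_or_ne x y with rfl | hxy
  · simp [Real.zero_rpow hβ0.ne']
  have hxy0 : 0 < ‖x - y‖ := norm_pos_iff.2 (sub_ne_zero.2 hxy)
  -- nearby points: integrate the gradient along the segment, on which `h` is comparable to `h x`;
  -- far points: both values are small
  by_cases hclose : ‖x - y‖ < h x / 2
  · set r := h x / 2 with hr
    have hball : ∀ w ∈ Metric.ball x r, r < h w := by
      intro w hw
      rw [mem_ball_iff_norm, norm_sub_rev] at hw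
      have := (abs_le.1 (hlip x w)).2
      linarith
    have hr0 : 0 < r := hxy0.trans hclose
    have key := Convex.norm_image_sub_le_of_norm_fderiv_le (𝕜 := ℝ) (f := f) (C := |C| * r ^ (β - 1))
      (s := Metric.ball x r) (x := y) (y := x)
      (fun w hw => hd w (hr0.trans (hball w hw)))
      (fun w hw => (hf' w (hr0.trans (hball w hw))).trans (by
        have h1 := hball w hw
        have h2 : h w ^ (β - 1) ≤ r ^ (β - 1) :=
          Real.rpow_le_rpow_of_nonpos hr0 h1.le (by linarith)
        have h3 : 0 ≤ h w ^ (β - 1) := Real.rpow_nonneg (h0 w) _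
        calc _ ≤ |C| * h w ^ (β - 1) := by gcongr; exact le_abs_self _
          _ ≤ _ := by gcongr))
      (convex_ball x r) (by rw [mem_ball_iff_norm, norm_sub_rev]; exact hclose)
      (Metric.mem_ball_self hr0)
    refine key.trans ?_
    have h4 : r ^ (β - 1) ≤ ‖x - y‖ ^ (β - 1) :=
      Real.rpow_le_rpow_of_nonpos hxy0 hclose.le (by linarith)
    calc |C| * r ^ (β - 1) * ‖x - y‖ ≤ |C| * ‖x - y‖ ^ (β - 1) * ‖x - y‖ := by gcongr
      _ = |C| * 1 * ‖x - y‖ ^ β := by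
          rw [Real.rpow_sub_one hxy0.ne']; field_simp
      _ ≤ |C| * 2 ^ β * ‖x - y‖ ^ β := by
          gcongr; exact Real.one_le_rpow (by norm_num) hβ0.le
      _ ≤ _ := by
          gcongr
          have : 0 ≤ |C| * (3 : ℝ) ^ β := by positivity
          linarith
  · push Not at hclose
    have hx : h x ≤ 2 * ‖x - y‖ := by linarith
    have hy : h y ≤ 3 * ‖x - y‖ := by
      have := (abs_le.1 (hlip x y)).1
      linarith
    calc ‖f x - f y‖ ≤ ‖f x‖ + ‖f y‖ := norm_sub_le _ _
      _ ≤ |C| * (2 * ‖x - y‖) ^ β + |C| * (3 * ‖x - y‖) ^ β := by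
          refine add_le_add ((hfb x).trans ?_) ((hfb y).trans ?_)
          · have := h0 x; gcongr
          · have := h0 y; gcongr
      _ = _ := by
          rw [Real.mul_rpow (by norm_num) hxy0.le, Real.mul_rpow (by norm_num) hxy0.le]; ring

end Symbol

/-- A symbol of order `k + β` that vanishes on `{h = 0}` is of class `C^{k,β}`: its derivatives of
order at most `k` extend by zero. -/
lemma contDiff_holder_of_symbolBound {X : Type} [NormedAddCommGroup X] [NormedSpace ℝ X]
    {h : X → ℝ} (h0 : ∀ x, 0 ≤ h x) (hlip : ∀ x y, |h x - h y| ≤ ‖x - y‖) {β : ℝ} (hβ0 : 0 < β)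
    (hβ1 : β ≤ 1) (k : ℕ) {V : Type} [NormedAddCommGroup V] [NormedSpace ℝ V] {f : X → V}
    (hz : ∀ x, h x = 0 → f x = 0) (hf : IsSymbol h (k + β) f) :
    ContDiff ℝ k f ∧ ∃ C : ℝ, ∀ x y,
      ‖iteratedFDeriv ℝ k f x - iteratedFDeriv ℝ k f y‖ ≤ C * ‖x - y‖ ^ β := by
  have hcont : Continuous h := by
    have : LipschitzWith 1 h := LipschitzWith.of_dist_le_mul fun x y => by
      simpa [Real.dist_eq, dist_eq_norm] using hlip x y
    exact this.continuous
  have hop := isOpen_pos hcont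
  induction k generalizing V with
  | zero =>
    obtain ⟨C, hC⟩ := hf.2 0
    obtain ⟨D, hD⟩ := hf.2 1
    simp only [norm_iteratedFDeriv_zero, Nat.cast_zero, zero_add, sub_zero, Nat.cast_one,
      norm_iteratedFDeriv_one] at hC hD
    obtain ⟨C', hC'⟩ := exists_holder_of_bounds h0 hlip hβ0 hβ1 (C := max C D) hz
      (fun x hx => (hf.1.differentiableOn (by norm_num)).differentiableAt (hop.mem_nhds hx))
      (fun x hx => (hC x hx).trans (by gcongr; exact le_max_left _ _))
      (fun x hx => (hD x hx).trans (by gcongr; exact le_max_right _ _))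
    refine ⟨?_, C', fun x y => ?_⟩
    · rw [Nat.cast_zero, contDiff_zero]
      refine continuous_iff_continuousAt.2 fun x => tendsto_iff_norm_sub_tendsto_zero.2 ?_
      have hlim : Tendsto (fun y => C' * ‖y - x‖ ^ β) (𝓝 x) (𝓝 0) := by
        have : Continuous fun y => C' * ‖y - x‖ ^ β := by
          refine continuous_const.mul (Continuous.rpow_const (by fun_prop) fun _ => Or.inr hβ0.le)
        simpa [Real.zero_rpow hβ0.ne'] using this.tendsto x
      exact squeeze_zero (fun _ => norm_nonneg _) (fun y => hC' y x) hlim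
    · rw [iteratedFDeriv_zero_eq_comp, Function.comp_apply, Function.comp_apply, ← map_sub,
        LinearIsometryEquiv.norm_map]
      exact hC' x y
  | succ k ih =>
    obtain ⟨C, hC⟩ := hf.2 0
    simp only [norm_iteratedFDeriv_zero, Nat.cast_zero, sub_zero, Nat.cast_succ] at hC
    have hσ : 1 < (k : ℝ) + 1 + β := by have : (0 : ℝ) ≤ k := k.cast_nonneg; linarith
    -- at the zeros of `h` the function is of size `|y - x| ^ (k + 1 + β)`, so the derivative is `0`
    have hzero : ∀ x, h x = 0 → HasFDerivAt f (0 : X →L[ℝ] V) x := by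
      intro x hx
      refine HasFDerivAt.of_isLittleO ?_
      have hO : (fun y => f y - f x - (0 : X →L[ℝ] V) (y - x)) =O[𝓝 x]
          fun y => ‖y - x‖ ^ ((k : ℝ) + 1 + β) := by
        refine Asymptotics.IsBigO.of_bound |C| (Eventually.of_forall fun y => ?_)
        have hyx : h y ≤ ‖y - x‖ := by
          have := (abs_le.1 (hlip y x)).2; linarith
        rw [hz x hx, sub_zero, zero_apply, sub_zero,
          Real.norm_of_nonneg (by positivity)]
        rcases (h0 y).eq_or_lt with hy | hy
        · rw [hz y hy.symm, norm_zero]; positivity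
        · refine (hC y hy).trans ?_
          have := h0 y
          gcongr
          exact le_abs_self _
      refine hO.trans_isLittleO ?_
      have h1 : (fun y => ‖y - x‖ ^ ((k : ℝ) + 1 + β)) =
          fun y => ‖y - x‖ ^ ((k : ℝ) + β) * ‖y - x‖ := by
        funext y
        rcases eq_or_ne ‖y - x‖ 0 with hy | hy
        · rw [hy, Real.zero_rpow (by linarith), mul_zero]
        · rw [add_right_comm, Real.rpow_add_one hy]
      rw [h1]
      have h2 : Tendsto (fun y => ‖y - x‖ ^ ((k : ℝ) + β)) (𝓝 x) (𝓝 0) := by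
        have hpos : 0 < (k : ℝ) + β := by positivity
        have : Continuous fun y => ‖y - x‖ ^ ((k : ℝ) + β) :=
          Continuous.rpow_const (by fun_prop) fun _ => Or.inr hpos.le
        simpa [Real.zero_rpow hpos.ne'] using this.tendsto x
      have h3 : (fun y => ‖y - x‖ ^ ((k : ℝ) + β)) =o[𝓝 x] fun _ => (1 : ℝ) :=
        (Asymptotics.isLittleO_one_iff ℝ).2 h2
      have h4 := h3.mul_isBigO (Asymptotics.isBigO_refl (fun y => ‖y - x‖) (𝓝 x))
      simp only [one_mul] at h4
      exact h4.of_norm_right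
    have hsym : IsSymbol h (k + β) (fderiv ℝ f) := by
      refine ⟨hf.1.fderiv_of_isOpen hop (by norm_num), fun j => ?_⟩
      obtain ⟨D, hD⟩ := hf.2 (j + 1)
      refine ⟨D, fun x hx => ?_⟩
      rw [norm_iteratedFDeriv_fderiv]
      refine (hD x hx).trans (le_of_eq ?_)
      congr 2; push_cast; ring
    obtain ⟨hcd, C', hC'⟩ := ih (fun x hx => (hzero x hx).fderiv) hsym
    refine ⟨?_, C', fun x y => ?_⟩
    · push_cast
      refine contDiff_succ_iff_fderiv.2 ⟨fun x => ?_, by simp, hcd⟩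
      rcases (h0 x).eq_or_lt with hx | hx
      · exact (hzero x hx.symm).differentiableAt
      · exact (hf.1.differentiableOn (by norm_num)).differentiableAt (hop.mem_nhds hx)
    · have := (continuousMultilinearCurryRightEquiv' ℝ k X V).symm.dist_map
        (iteratedFDeriv ℝ k (fderiv ℝ f) x) (iteratedFDeriv ℝ k (fderiv ℝ f) y)
      rw [dist_eq_norm, dist_eq_norm] at this
      rw [iteratedFDeriv_succ_eq_comp_right, iteratedFDeriv_succ_eq_comp_right]
      exact this.le.trans (hC' x y)

/-- The splitting `α = k + β` with `k = ⌈α⌉₊ - 1` and `0 < β ≤ 1`. -/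
lemma ceil_sub_one_spec {α : ℝ} (hα : 0 < α) :
    0 < α - (⌈α⌉₊ - 1 : ℕ) ∧ α - (⌈α⌉₊ - 1 : ℕ) ≤ 1 := by
  have h1 : 1 ≤ ⌈α⌉₊ := Nat.one_le_ceil_iff.2 hα
  have h2 := Nat.le_ceil α
  have h3 := Nat.ceil_lt_add_one hα.le
  push_cast [h1]
  constructor <;> linarith

lemma isHolder_of_isSymbol {m : ℕ} {α : ℝ} (hα : 0 < α) {h : Eu m → ℝ} (h0 : ∀ x, 0 ≤ h x)
    (hlip : ∀ x y, |h x - h y| ≤ ‖x - y‖) {a : Eu m → ℝ} (hz : ∀ x, h x = 0 → a x = 0)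
    (ha : IsSymbol h α a) : IsHolder α a := by
  obtain ⟨h1, h2⟩ := ceil_sub_one_spec hα
  have := contDiff_holder_of_symbolBound h0 hlip h1 h2 (⌈α⌉₊ - 1) hz (by simpa using ha)
  exact this

/-! ### Mollification at a variable scale and cone cut-offs -/

/-- The kernel `Θ` rescaled to length `r`. -/
def scaledKernel {m : ℕ} {V : Type} [NormedAddCommGroup V] [NormedSpace ℝ V] (Θ : Eu m → V)
    (r : ℝ) (y : Eu m) : V :=
  (r ^ m)⁻¹ • Θ (r⁻¹ • y)

/-- The convolution of `F` with the kernel `Θ` at scale `q.1`, at the point `q.2`. -/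
def scaleConv {m : ℕ} {V : Type} [NormedAddCommGroup V] [NormedSpace ℝ V] (F : Eu m → ℝ)
    (Θ : Eu m → V) (q : ℝ × Eu m) : V :=
  ∫ z, F z • scaledKernel Θ q.1 (q.2 - z)

/-- The kernel whose rescalings give the derivative of the rescalings of `Θ`, jointly in the scale
and in the point, up to the factor `r⁻¹` in `fderiv_scaledKernel`. It is again smooth and supported
in the unit ball, so that differentiation can be iterated. -/
def derivKernel {m : ℕ} {V : Type} [NormedAddCommGroup V] [NormedSpace ℝ V] (Θ : Eu m → V)
    (w : Eu m) : ℝ × Eu m →L[ℝ] V :=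
  (fderiv ℝ Θ w).comp (ContinuousLinearMap.snd ℝ ℝ (Eu m)) +
    (ContinuousLinearMap.fst ℝ ℝ (Eu m)).smulRight (-((m : ℝ) • Θ w) - fderiv ℝ Θ w w)

section

variable {m : ℕ} {V : Type} [NormedAddCommGroup V] [NormedSpace ℝ V]

lemma contDiff_derivKernel {Θ : Eu m → V} (hΘ : ContDiff ℝ ∞ Θ) :
    ContDiff ℝ ∞ (derivKernel Θ) := by
  have h1 : ContDiff ℝ ∞ (fderiv ℝ Θ) := hΘ.fderiv_right (by norm_num)
  unfold derivKernel
  refine (h1.clm_comp contDiff_const).add ?_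
  exact contDiff_const.smulRight ((contDiff_const.smul hΘ).neg.sub (h1.clm_apply contDiff_id))

lemma derivKernel_eq_zero {Θ : Eu m → V} (hs : ∀ w, 1 < ‖w‖ → Θ w = 0) (w : Eu m)
    (hw : 1 < ‖w‖) : derivKernel Θ w = 0 := by
  have h0 : Θ =ᶠ[𝓝 w] fun _ => 0 := by
    filter_upwards [(isOpen_lt continuous_const continuous_norm).mem_nhds hw] with y hy using hs y hy
  have h1 : fderiv ℝ Θ w = 0 := by rw [h0.fderiv_eq]; simp
  simp [derivKernel, h1, hs w hw]

lemma contDiffOn_scaledKernel {Θ : Eu m → V} (hΘ : ContDiff ℝ ∞ Θ) {s : Set ℝ}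
    (hs : ∀ r ∈ s, r ≠ 0) :
    ContDiffOn ℝ ∞ (fun q : ℝ × Eu m => scaledKernel Θ q.1 q.2) (s ×ˢ Set.univ) := by
  unfold scaledKernel
  have hinv : ContDiffOn ℝ ∞ (fun q : ℝ × Eu m => q.1⁻¹) (s ×ˢ Set.univ) :=
    contDiff_fst.contDiffOn.inv fun q hq => hs _ hq.1
  refine ContDiffOn.smul ?_ ?_
  · refine (contDiff_fst.pow m).contDiffOn.inv fun q hq => pow_ne_zero _ (hs _ hq.1)
  · exact hΘ.comp_contDiffOn (hinv.smul contDiff_snd.contDiffOn)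

lemma fderiv_scaledKernel {Θ : Eu m → V} (hΘ : ContDiff ℝ ∞ Θ) {r : ℝ} (hr : 0 < r) (y : Eu m) :
    fderiv ℝ (fun q : ℝ × Eu m => scaledKernel Θ q.1 q.2) (r, y) =
      r⁻¹ • scaledKernel (derivKernel Θ) r y := by
  have hr0 := hr.ne'
  have hT : HasFDerivAt Θ (fderiv ℝ Θ (r⁻¹ • y)) (r⁻¹ • y) :=
    ((hΘ.differentiable (by norm_num)) _).hasFDerivAt
  have hfst : HasFDerivAt (fun q : ℝ × Eu m => q.1) (ContinuousLinearMap.fst ℝ ℝ (Eu m)) (r, y) :=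
    hasFDerivAt_fst
  have hsnd : HasFDerivAt (fun q : ℝ × Eu m => q.2) (ContinuousLinearMap.snd ℝ ℝ (Eu m)) (r, y) :=
    hasFDerivAt_snd
  have hinv : HasFDerivAt (fun q : ℝ × Eu m => q.1⁻¹)
      ((-(r ^ 2)⁻¹) • ContinuousLinearMap.fst ℝ ℝ (Eu m)) (r, y) :=
    (hasDerivAt_inv hr0).comp_hasFDerivAt (r, y) hfst
  have hpow : HasFDerivAt (fun q : ℝ × Eu m => (q.1 ^ m)⁻¹)
      ((-(m * r⁻¹ * (r ^ m)⁻¹)) • ContinuousLinearMap.fst ℝ ℝ (Eu m)) (r, y) := by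
    have h1 : HasDerivAt (fun t : ℝ => (t ^ m)⁻¹) (-(m * r⁻¹ * (r ^ m)⁻¹)) r := by
      refine ((hasDerivAt_pow m r).inv (pow_ne_zero _ hr0)).congr_deriv ?_
      rcases m with _ | k
      · simp
      · simp only [Nat.add_sub_cancel]
        field_simp
        rw [pow_succ]
    exact HasDerivAt.comp_hasFDerivAt (h₂ := fun t : ℝ => (t ^ m)⁻¹) (r, y) h1 hfst
  have hin := hinv.smul hsnd
  have hcomp : HasFDerivAt (fun q : ℝ × Eu m => Θ (q.1⁻¹ • q.2)) _ (r, y) := hT.comp (r, y) hin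
  have h := hpow.smul hcomp
  have e : (fun q : ℝ × Eu m => scaledKernel Θ q.1 q.2) =
    fun q : ℝ × Eu m => (q.1 ^ m)⁻¹ • Θ (q.1⁻¹ • q.2) := rfl
  rw [e]
  refine (show fderiv ℝ _ _ = _ from h.fderiv).trans ?_
  refine ContinuousLinearMap.ext fun p => ?_
  obtain ⟨t, w⟩ := p
  simp only [scaledKernel, derivKernel, add_apply, smul_apply, ContinuousLinearMap.comp_apply,
    ContinuousLinearMap.smulRight_apply, ContinuousLinearMap.coe_fst', ContinuousLinearMap.coe_snd',
    map_add, map_smul, smul_add, smul_sub, smul_neg, smul_smul]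
  module

lemma scaledKernel_eq_zero {Θ : Eu m → V} (hs : ∀ w, 1 < ‖w‖ → Θ w = 0) {r : ℝ} (hr : 0 < r)
    {y : Eu m} (hy : r < ‖y‖) : scaledKernel Θ r y = 0 := by
  rw [scaledKernel, hs, smul_zero]
  rw [norm_smul, norm_inv, Real.norm_of_nonneg hr.le, inv_mul_eq_div, one_lt_div hr]
  exact hy

lemma contDiffOn_scaleConv {F : Eu m → ℝ} (hF : LocallyIntegrable F) {Θ : Eu m → V}
    (hΘ : ContDiff ℝ ∞ Θ) (hs : ∀ w, 1 < ‖w‖ → Θ w = 0) :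
    ContDiffOn ℝ ∞ (scaleConv F Θ) {q | 0 < q.1} := by
  rintro ⟨r, x⟩ hr
  have hr : 0 < r := hr
  have h := contDiffOn_convolution_right_with_param (𝕜 := ℝ) (n := ⊤) (μ := volume)
    (ContinuousLinearMap.lsmul ℝ ℝ) (f := F) (g := scaledKernel Θ) (s := Set.Ioo (r / 2) (2 * r))
    (k := Metric.closedBall 0 (2 * r)) isOpen_Ioo (isCompact_closedBall _ _)
    (fun p y hp hy => scaledKernel_eq_zero hs (by linarith [hp.1]) (by
      have : 2 * r < ‖y‖ := by simpa using hy
      exact hp.2.trans this)) hF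
    (contDiffOn_scaledKernel hΘ fun p hp => by
      have := hp.1
      have : 0 < p := by linarith
      exact this.ne')
  refine (h.contDiffAt ?_).contDiffWithinAt
  exact (isOpen_Ioo.prod isOpen_univ).mem_nhds ⟨⟨by dsimp only; linarith, by dsimp only; linarith⟩,
    trivial⟩

lemma fderiv_scaleConv [CompleteSpace V] {F : Eu m → ℝ} (hF : LocallyIntegrable F) {Θ : Eu m → V}
    (hΘ : ContDiff ℝ ∞ Θ) (hs : ∀ w, 1 < ‖w‖ → Θ w = 0) {q : ℝ × Eu m} (hq : 0 < q.1) :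
    fderiv ℝ (scaleConv F Θ) q = q.1⁻¹ • scaleConv F (derivKernel Θ) q := by
  obtain ⟨r, x⟩ := q
  have hr : 0 < r := hq
  have h := hasFDerivAt_convolution_right_with_param (𝕜 := ℝ) (μ := volume)
    (ContinuousLinearMap.lsmul ℝ ℝ) (f := F) (g := scaledKernel Θ) (s := Set.Ioo (r / 2) (2 * r))
    (k := Metric.closedBall 0 (2 * r)) isOpen_Ioo (isCompact_closedBall _ _)
    (fun p y hp hy => scaledKernel_eq_zero hs (by linarith [hp.1]) (by
      have : 2 * r < ‖y‖ := by simpa using hy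
      exact hp.2.trans this)) hF
    ((contDiffOn_scaledKernel hΘ fun p hp => by
      have := hp.1
      have : 0 < p := by linarith
      exact this.ne').of_le (by norm_num)) (r, x)
    ⟨by dsimp only; linarith, by dsimp only; linarith⟩
  refine (show fderiv ℝ (scaleConv F Θ) (r, x) = _ from h.fderiv).trans ?_
  rw [scaleConv, ← integral_smul]
  refine integral_congr_ae (Eventually.of_forall fun z => ?_)
  have e := fderiv_scaledKernel hΘ hr (x - z)
  change ContinuousLinearMap.precompR (ℝ × Eu m) (ContinuousLinearMap.lsmul ℝ ℝ) (F z)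
    (fderiv ℝ (fun q : ℝ × Eu m => scaledKernel Θ q.1 q.2) (r, x - z)) = _
  rw [e]
  refine ContinuousLinearMap.ext fun p => ?_
  simp

lemma integrable_scaledKernel {Θ : Eu m → V} (hΘ : Continuous Θ)
    (hs : ∀ w, 1 < ‖w‖ → Θ w = 0) {r : ℝ} (hr : 0 < r) (x : Eu m) :
    Integrable fun z => scaledKernel Θ r (x - z) := by
  have hc : Continuous (scaledKernel Θ r) := by unfold scaledKernel; fun_prop
  have hcs : HasCompactSupport (scaledKernel Θ r) :=
    HasCompactSupport.intro (isCompact_closedBall (0 : Eu m) r) fun y hy =>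
      scaledKernel_eq_zero hs hr (by simpa using hy)
  exact (hc.integrable_of_hasCompactSupport hcs).comp_sub_left x

lemma integral_scaledKernel {W : Type} [NormedAddCommGroup W] [NormedSpace ℝ W] (Θ : Eu m → W)
    {r : ℝ} (hr : 0 < r) (x : Eu m) : ∫ z, scaledKernel Θ r (x - z) = ∫ w, Θ w := by
  rw [integral_sub_left_eq_self (scaledKernel Θ r) volume x]
  unfold scaledKernel
  rw [integral_smul, Measure.integral_comp_inv_smul, finrank_euclideanSpace_fin,
    abs_of_pos (by positivity), smul_smul, inv_mul_cancel₀ (by positivity), one_smul]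

lemma norm_scaleConv_le {F : Eu m → ℝ} (hF1 : ∀ z, |F z| ≤ 1)
    {Θ : Eu m → V} (hΘ : Continuous Θ) (hs : ∀ w, 1 < ‖w‖ → Θ w = 0) {q : ℝ × Eu m}
    (hq : 0 < q.1) : ‖scaleConv F Θ q‖ ≤ ∫ w, ‖Θ w‖ := by
  have e : ∀ z, ‖scaledKernel Θ q.1 (q.2 - z)‖ = scaledKernel (fun w => ‖Θ w‖) q.1 (q.2 - z) := by
    intro z
    simp only [scaledKernel, norm_smul, smul_eq_mul]
    rw [Real.norm_of_nonneg (by positivity)]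
  rw [← integral_scaledKernel (fun w => ‖Θ w‖) hq q.2]
  refine norm_integral_le_of_norm_le ?_ (Eventually.of_forall fun z => ?_)
  · simpa only [e] using (integrable_scaledKernel hΘ hs hq q.2).norm
  · rw [norm_smul, e, Real.norm_eq_abs]
    refine mul_le_of_le_one_left ?_ (hF1 z)
    rw [← e]; positivity

/-- Mollification of a bounded function at scale `r` loses a factor `r⁻¹` with every derivative,
jointly in the scale and in the point. -/
lemma isSymbol_scaleConv {F : Eu m → ℝ} (hF : LocallyIntegrable F) (hF1 : ∀ z, |F z| ≤ 1)
    [CompleteSpace V] {Θ : Eu m → V} (hΘ : ContDiff ℝ ∞ Θ) (hs : ∀ w, 1 < ‖w‖ → Θ w = 0) :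
    IsSymbol (fun q : ℝ × Eu m => q.1) 0 (scaleConv F Θ) := by
  refine ⟨contDiffOn_scaleConv hF hΘ hs, fun j => ?_⟩
  suffices H : ∀ i ≤ j, SymbolBound (fun q : ℝ × Eu m => q.1) 0 i (scaleConv F Θ) from H j le_rfl
  induction j generalizing V with
  | zero =>
    intro i hi
    obtain rfl : i = 0 := by omega
    refine ⟨∫ w, ‖Θ w‖, fun q hq => ?_⟩
    rw [norm_iteratedFDeriv_zero]
    simpa using norm_scaleConv_le hF1 hΘ.continuous hs hq
  | succ j ih =>
    intro i hi
    rcases Nat.lt_or_ge i (j + 1) with h | h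
    · exact ih hΘ hs i (by omega)
    obtain rfl : i = j + 1 := by omega
    have hinv : IsSymbol (fun q : ℝ × Eu m => q.1) (-1) (fun q : ℝ × Eu m => q.1 ^ (-1 : ℝ)) :=
      (isSymbol_rpow (-1)).comp_clm continuous_id (ContinuousLinearMap.fst ℝ ℝ (Eu m))
    have hk := contDiff_derivKernel hΘ
    have hk0 := derivKernel_eq_zero hs
    have hprod := SymbolBound.smul (j := j) continuous_fst hinv.1 (contDiffOn_scaleConv hF hk hk0)
      (fun i _ => hinv.2 i) (ih hk hk0)
    obtain ⟨C, hC⟩ := hprod.congr continuous_fst (g := fderiv ℝ (scaleConv F Θ)) fun q hq => by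
      rw [fderiv_scaleConv hF hΘ hs hq, Real.rpow_neg_one]
    refine ⟨C, fun q hq => ?_⟩
    rw [← norm_iteratedFDeriv_fderiv]
    refine (hC q hq).trans (le_of_eq ?_)
    congr 2; push_cast; ring

end

/-- A smooth probability density supported in the unit ball. -/
def bumpKernel (m : ℕ) : Eu m → ℝ :=
  (⟨1 / 2, 1, by norm_num, by norm_num⟩ : ContDiffBump (0 : Eu m)).normed volume

lemma contDiff_bumpKernel (m : ℕ) : ContDiff ℝ ∞ (bumpKernel m) := ContDiffBump.contDiff_normed _

lemma bumpKernel_nonneg (m : ℕ) (w : Eu m) : 0 ≤ bumpKernel m w := ContDiffBump.nonneg_normed _ _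

lemma integral_bumpKernel (m : ℕ) : ∫ w, bumpKernel m w = 1 := ContDiffBump.integral_normed _

lemma bumpKernel_eq_zero (m : ℕ) (w : Eu m) (hw : 1 < ‖w‖) : bumpKernel m w = 0 := by
  refine image_eq_zero_of_notMem_tsupport ?_
  rw [bumpKernel, ContDiffBump.tsupport_normed_eq]
  simpa using hw

/-- The ratio of the mollification scale to `h` in `coneCutoff`: by `coneScale_mul` it is small enough
for the mollified indicator function to be constant where `δ ≤ κ h` and where `κ' h < δ`, if `δ` and
`h` are `1`-Lipschitz. -/
def coneScale (κ κ' : ℝ) : ℝ := (κ' - κ) / (2 * (1 + (κ + κ') / 2))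

/-- The indicator function of `{δ ≤ h (κ + κ') / 2}`. -/
def coneIndicator {m : ℕ} (δ h : Eu m → ℝ) (κ κ' : ℝ) : Eu m → ℝ :=
  {z | δ z ≤ (κ + κ') / 2 * h z}.indicator 1

/-- The indicator function of an intermediate cone, mollified at a scale proportional to `h`. On
`{h = 0}`, where there is no scale to mollify at, it is the indicator function of `{δ = 0}`. -/
def coneCutoff {m : ℕ} (δ h : Eu m → ℝ) (κ κ' : ℝ) (x : Eu m) : ℝ :=
  if h x = 0 then if δ x = 0 then 1 else 0
  else scaleConv (coneIndicator δ h κ κ') (bumpKernel m) (coneScale κ κ' * h x, x)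

section

variable {m : ℕ} {δ h : Eu m → ℝ} {κ κ' : ℝ}

lemma coneScale_pos (hκ : 0 < κ) (hκ' : κ < κ') : 0 < coneScale κ κ' :=
  div_pos (by linarith) (by linarith)

lemma coneScale_mul (hκ : 0 < κ) (hκ' : κ < κ') :
    coneScale κ κ' * (1 + (κ + κ') / 2) = (κ' - κ) / 2 := by
  have : 1 + (κ + κ') / 2 ≠ 0 := by linarith
  rw [coneScale, div_mul_eq_mul_div, mul_comm 2, ← div_div, mul_div_cancel_right₀ _ this]

lemma coneIndicator_mem (z : Eu m) : 0 ≤ coneIndicator δ h κ κ' z ∧ coneIndicator δ h κ κ' z ≤ 1 := by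
  unfold coneIndicator
  by_cases hz : z ∈ {z | δ z ≤ (κ + κ') / 2 * h z} <;> simp [hz]

lemma abs_coneIndicator_le (z : Eu m) : |coneIndicator δ h κ κ' z| ≤ 1 := by
  obtain ⟨h1, h2⟩ := coneIndicator_mem (δ := δ) (h := h) (κ := κ) (κ' := κ') z
  rwa [abs_of_nonneg h1]

lemma locallyIntegrable_coneIndicator (hδ : Continuous δ) (hh : Continuous h) :
    LocallyIntegrable (coneIndicator δ h κ κ') := by
  have hm : MeasurableSet {z | δ z ≤ (κ + κ') / 2 * h z} :=
    (isClosed_le hδ (continuous_const.mul hh)).measurableSet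
  refine (locallyIntegrable_const (1 : ℝ)).mono (measurable_const.indicator hm).aestronglyMeasurable ?_
  refine Eventually.of_forall fun z => ?_
  rw [Real.norm_eq_abs, norm_one]
  exact abs_coneIndicator_le z

lemma continuous_of_abs_sub_le (hlip : ∀ x y, |h x - h y| ≤ ‖x - y‖) : Continuous h := by
  have : LipschitzWith 1 h := LipschitzWith.of_dist_le_mul fun x y => by
    simpa [Real.dist_eq, dist_eq_norm] using hlip x y
  exact this.continuous

lemma coneCutoff_mem (h0 : ∀ x, 0 ≤ h x) (hκ : 0 < κ) (hκ' : κ < κ') (x : Eu m) :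
    0 ≤ coneCutoff δ h κ κ' x ∧ coneCutoff δ h κ κ' x ≤ 1 := by
  unfold coneCutoff
  split_ifs with h1 h2
  · simp
  · simp
  · have hr : 0 < coneScale κ κ' * h x :=
      mul_pos (coneScale_pos hκ hκ') (lt_of_le_of_ne (h0 x) (Ne.symm h1))
    constructor
    · refine integral_nonneg fun z => mul_nonneg (coneIndicator_mem z).1 ?_
      exact mul_nonneg (by positivity) (bumpKernel_nonneg m _)
    · refine (le_abs_self _).trans ?_
      have := norm_scaleConv_le (V := ℝ) (F := coneIndicator δ h κ κ') abs_coneIndicator_le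
        (contDiff_bumpKernel m).continuous (bumpKernel_eq_zero m) (q := (coneScale κ κ' * h x, x)) hr
      rw [Real.norm_eq_abs] at this
      refine this.trans (le_of_eq ?_)
      rw [← integral_bumpKernel m]
      refine integral_congr_ae (Eventually.of_forall fun w => ?_)
      exact Real.norm_of_nonneg (bumpKernel_nonneg m w)

lemma coneCutoff_eq_one (h0 : ∀ x, 0 ≤ h x) (hδ0 : ∀ x, 0 ≤ δ x) (hκ : 0 < κ) (hκ' : κ < κ')
    (hδ : ∀ x y, |δ x - δ y| ≤ ‖x - y‖) (hh : ∀ x y, |h x - h y| ≤ ‖x - y‖) {x : Eu m}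
    (hx : δ x ≤ κ * h x) : coneCutoff δ h κ κ' x = 1 := by
  unfold coneCutoff
  split_ifs with h1 h2
  · rfl
  · rw [h1, mul_zero] at hx
    exact absurd (le_antisymm hx (hδ0 x)) h2
  · have hx0 : 0 < h x := lt_of_le_of_ne (h0 x) (Ne.symm h1)
    have hr : 0 < coneScale κ κ' * h x := mul_pos (coneScale_pos hκ hκ') hx0
    rw [scaleConv, ← integral_bumpKernel m, ← integral_scaledKernel (bumpKernel m) hr x]
    refine integral_congr_ae (Eventually.of_forall fun z => ?_)
    dsimp only
    by_cases hz : coneScale κ κ' * h x < ‖x - z‖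
    · rw [scaledKernel_eq_zero (bumpKernel_eq_zero m) hr hz, smul_zero]
    · push Not at hz
      have hmem : z ∈ {z | δ z ≤ (κ + κ') / 2 * h z} := by
        have h3 := (abs_le.1 (hδ x z)).1
        have h4 := (abs_le.1 (hh x z)).2
        have h5 := coneScale_mul hκ hκ'
        have h6 : (κ + κ') / 2 * h z ≥ (κ + κ') / 2 * (h x - coneScale κ κ' * h x) :=
          mul_le_mul_of_nonneg_left (by linarith) (by linarith)
        have h7 : coneScale κ κ' * (1 + (κ + κ') / 2) * h x = (κ' - κ) / 2 * h x := by rw [h5]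
        rw [Set.mem_ofPred_eq]
        nlinarith
      rw [coneIndicator, Set.indicator_of_mem hmem, Pi.one_apply, one_smul]

lemma coneCutoff_eq_zero (h0 : ∀ x, 0 ≤ h x) (hκ : 0 < κ) (hκ' : κ < κ')
    (hδ : ∀ x y, |δ x - δ y| ≤ ‖x - y‖) (hh : ∀ x y, |h x - h y| ≤ ‖x - y‖) {x : Eu m}
    (hx : κ' * h x < δ x) : coneCutoff δ h κ κ' x = 0 := by
  unfold coneCutoff
  split_ifs with h1 h2
  · rw [h1, mul_zero, h2] at hx
    exact absurd hx (lt_irrefl _)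
  · rfl
  · have hx0 : 0 < h x := lt_of_le_of_ne (h0 x) (Ne.symm h1)
    have hr : 0 < coneScale κ κ' * h x := mul_pos (coneScale_pos hκ hκ') hx0
    rw [scaleConv, ← integral_zero (Eu m) ℝ]
    refine integral_congr_ae (Eventually.of_forall fun z => ?_)
    dsimp only
    by_cases hz : coneScale κ κ' * h x < ‖x - z‖
    · rw [scaledKernel_eq_zero (bumpKernel_eq_zero m) hr hz, smul_zero]
    · push Not at hz
      have hmem : z ∉ {z | δ z ≤ (κ + κ') / 2 * h z} := by
        have h3 := (abs_le.1 (hδ x z)).2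
        have h4 := (abs_le.1 (hh x z)).1
        have h5 := coneScale_mul hκ hκ'
        have h6 : (κ + κ') / 2 * h z ≤ (κ + κ') / 2 * (h x + coneScale κ κ' * h x) :=
          mul_le_mul_of_nonneg_left (by linarith) (by linarith)
        have h7 : coneScale κ κ' * (1 + (κ + κ') / 2) * h x = (κ' - κ) / 2 * h x := by rw [h5]
        rw [Set.mem_ofPred_eq, not_le]
        nlinarith
      rw [coneIndicator, Set.indicator_of_notMem hmem, zero_smul]

lemma isSymbol_coneConv (hδ : Continuous δ) (hh : Continuous h) :
    IsSymbol (fun q : ℝ × Eu m => q.1) 0 (scaleConv (coneIndicator δ h κ κ') (bumpKernel m)) :=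
  isSymbol_scaleConv (locallyIntegrable_coneIndicator hδ hh) abs_coneIndicator_le
    (contDiff_bumpKernel m) (bumpKernel_eq_zero m)

lemma isConeCutoff_coneCutoff (h0 : ∀ x, 0 ≤ h x) (hδ0 : ∀ x, 0 ≤ δ x) (hκ : 0 < κ) (hκ' : κ < κ')
    (hδ : ∀ x y, |δ x - δ y| ≤ ‖x - y‖) (hh : ∀ x y, |h x - h y| ≤ ‖x - y‖)
    (hsm : ∀ x, h x ≠ 0 → ContDiffAt ℝ ∞ h x) : IsConeCutoff δ h κ κ' (coneCutoff δ h κ κ') := by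
  have hδc := continuous_of_abs_sub_le hδ
  have hhc := continuous_of_abs_sub_le hh
  have hsymb := isSymbol_coneConv (κ := κ) (κ' := κ') hδc hhc
  have hc := coneScale_pos hκ hκ'
  have hev : ∀ x, h x ≠ 0 → coneCutoff δ h κ κ' =ᶠ[𝓝 x] fun y =>
      scaleConv (coneIndicator δ h κ κ') (bumpKernel m) (coneScale κ κ' * h y, y) := by
    intro x hx
    filter_upwards [hhc.continuousAt.eventually_ne hx] with y hy
    rw [coneCutoff, if_neg hy]
  have hpos : ∀ x, h x ≠ 0 → 0 < coneScale κ κ' * h x := fun x hx =>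
    mul_pos hc (lt_of_le_of_ne (h0 x) (Ne.symm hx))
  refine ⟨fun x hx => ?_, coneCutoff_mem h0 hκ hκ',
    fun x hx => coneCutoff_eq_one h0 hδ0 hκ hκ' hδ hh hx,
    fun x hx => coneCutoff_eq_zero h0 hκ hκ' hδ hh hx, ?_⟩
  -- near a point with `h x = 0 < δ x` the cut-off vanishes
  · by_cases h1 : h x = 0
    · have hδx : 0 < δ x := lt_of_le_of_ne (hδ0 x) fun h2 => hx ⟨h2.symm, h1⟩
      have hzero : coneCutoff δ h κ κ' =ᶠ[𝓝 x] fun _ => 0 := by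
        have : ∀ᶠ y in 𝓝 x, κ' * h y < δ y :=
          (continuous_const.mul hhc).continuousAt.eventually_lt hδc.continuousAt (by simpa [h1])
        filter_upwards [this] with y hy using coneCutoff_eq_zero h0 hκ hκ' hδ hh hy
      exact (contDiffAt_const.congr_of_eventuallyEq hzero).contDiffWithinAt
    · refine (ContDiffAt.congr_of_eventuallyEq ?_ (hev x h1)).contDiffWithinAt
      have h2 : ContDiffAt ℝ ∞ (scaleConv (coneIndicator δ h κ κ') (bumpKernel m))
          (coneScale κ κ' * h x, x) :=
        hsymb.1.contDiffAt ((isOpen_pos continuous_fst).mem_nhds (hpos x h1))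
      exact h2.comp x (f := fun y => (coneScale κ κ' * h y, y))
        ((contDiffAt_const.mul (hsm x h1)).prodMk contDiffAt_id)
  · obtain ⟨C, hC⟩ := hsymb.2 1
    refine ⟨|C| * (coneScale κ κ')⁻¹ * max (coneScale κ κ') 1, fun x hx => ?_⟩
    have hx0 : 0 < h x := lt_of_le_of_ne (h0 x) (Ne.symm hx)
    have h2 : DifferentiableAt ℝ (scaleConv (coneIndicator δ h κ κ') (bumpKernel m))
        (coneScale κ κ' * h x, x) :=
      (hsymb.1.contDiffAt ((isOpen_pos continuous_fst).mem_nhds (hpos x hx))).differentiableAt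
        (by norm_num)
    have h3 : HasFDerivAt (fun y => (coneScale κ κ' * h y, y))
        ((coneScale κ κ' • fderiv ℝ h x).prod (ContinuousLinearMap.id ℝ (Eu m))) x :=
      ((((hsm x hx).differentiableAt (by norm_num)).hasFDerivAt).const_mul _).prodMk (hasFDerivAt_id x)
    have hcomp : HasFDerivAt (fun y => scaleConv (coneIndicator δ h κ κ') (bumpKernel m)
        (coneScale κ κ' * h y, y)) _ x :=
      h2.hasFDerivAt.comp (f := fun y => (coneScale κ κ' * h y, y)) x h3
    rw [(hev x hx).fderiv_eq, hcomp.fderiv]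
    have h4 := hC (coneScale κ κ' * h x, x) (hpos x hx)
    rw [norm_iteratedFDeriv_one] at h4
    have h5 : ‖fderiv ℝ h x‖ ≤ 1 := by
      refine norm_fderiv_le_of_lip' ℝ zero_le_one (Eventually.of_forall fun y => ?_)
      simpa using hh y x
    have h6 : ‖(coneScale κ κ' • fderiv ℝ h x).prod (ContinuousLinearMap.id ℝ (Eu m))‖ ≤
        max (coneScale κ κ') 1 := by
      rw [ContinuousLinearMap.opNorm_prod]
      refine max_le_max ?_ ContinuousLinearMap.norm_id_le
      rw [norm_smul, Real.norm_of_nonneg hc.le]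
      exact mul_le_of_le_one_right hc.le h5
    refine (ContinuousLinearMap.opNorm_comp_le _ _).trans ?_
    have h7 : ‖fderiv ℝ (scaleConv (coneIndicator δ h κ κ') (bumpKernel m))
        (coneScale κ κ' * h x, x)‖ ≤ |C| * (coneScale κ κ')⁻¹ * (h x)⁻¹ := by
      refine h4.trans ?_
      rw [Nat.cast_one, zero_sub, Real.rpow_neg_one, mul_inv, ← mul_assoc]
      gcongr
      exact le_abs_self C
    calc _ ≤ |C| * (coneScale κ κ')⁻¹ * (h x)⁻¹ * max (coneScale κ κ') 1 := by gcongr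
      _ = _ := by rw [div_eq_mul_inv]; ring

end

/-- For `h = |x_d|` the cut-off has derivatives of all orders of the natural size: on each side of
`{x_d = 0}` the scale of the mollification is a linear function of `x`. -/
lemma isSymbol_coneCutoff_vert {n : ℕ} {δ : Eu (n + 1) → ℝ} {κ κ' : ℝ} (hκ : 0 < κ)
    (hκ' : κ < κ') (hδ : Continuous δ) :
    IsSymbol (fun x : Eu (n + 1) => |vert x|) 0 (coneCutoff δ (fun x => |vert x|) κ κ') := by
  have hc := coneScale_pos hκ hκ'
  have hsymb := isSymbol_coneConv (κ := κ) (κ' := κ') hδ (continuous_vert (n := n)).abs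
  refine IsSymbol.abs (h := vert) continuous_vert ?_ ?_
  · have := hsymb.comp_clm continuous_fst
      ((coneScale κ κ' • vertL n).prod (ContinuousLinearMap.id ℝ (Eu (n + 1))))
    refine (this.of_const_mul (h := vert) hc).congr continuous_vert fun x hx => ?_
    have hx : 0 < vert x := hx
    simp [coneCutoff, hx.ne', abs_of_pos hx]
  · have := hsymb.comp_clm continuous_fst
      ((coneScale κ κ' • (-vertL n)).prod (ContinuousLinearMap.id ℝ (Eu (n + 1))))
    refine (this.of_const_mul (h := fun x => -vert x) hc).congr continuous_vert.neg fun x hx => ?_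
    have hx : vert x < 0 := by simpa using hx
    simp [coneCutoff, hx.ne, abs_of_neg hx]

/-! ### Box cut-offs and the general form of a barrier -/

lemma exists_isBoxCutoff (m : ℕ) {r R : ℝ} (hr : 0 < r) (hR : r < R) :
    ∃ η : Eu m → ℝ, IsBoxCutoff r R η := by
  have hpos : 0 < R ^ 2 - r ^ 2 := by nlinarith
  refine ⟨fun x => ∏ i, Real.smoothTransition ((R ^ 2 - x i ^ 2) / (R ^ 2 - r ^ 2)), ?_, ?_, ?_, ?_⟩
  · refine contDiff_prod fun i _ => Real.smoothTransition.contDiff.comp ?_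
    fun_prop
  · exact fun x => ⟨Finset.prod_nonneg fun i _ => Real.smoothTransition.nonneg _,
      Finset.prod_le_one (fun i _ => Real.smoothTransition.nonneg _)
        fun i _ => Real.smoothTransition.le_one _⟩
  · intro x hx
    refine Finset.prod_eq_one fun i _ => Real.smoothTransition.one_of_one_le ?_
    rw [one_le_div hpos]
    have := sq_lt_sq' (abs_lt.1 (hx i)).1 (abs_lt.1 (hx i)).2
    linarith
  · intro x hx
    simp only [box, Set.mem_ofPred_eq, not_forall, not_lt] at hx
    obtain ⟨i, hi⟩ := hx
    refine Finset.prod_eq_zero (Finset.mem_univ i) (Real.smoothTransition.zero_of_nonpos ?_)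
    refine div_nonpos_of_nonpos_of_nonneg ?_ hpos.le
    have hR0 : 0 ≤ R := by linarith
    have : R ^ 2 ≤ |x i| ^ 2 := by gcongr
    rw [sq_abs] at this
    linarith

lemma norm_le_of_coord_le {m : ℕ} {R : ℝ} (x : Eu m) (hx : ∀ i, |x i| ≤ R) : ‖x‖ ≤ m * |R| := by
  have h : ‖x‖ ≤ ∑ i, |x i| := by
    rw [EuclideanSpace.norm_eq]
    refine Real.sqrt_le_iff.2 ⟨Finset.sum_nonneg fun i _ => abs_nonneg _, ?_⟩
    exact Finset.sum_sq_le_sq_sum_of_nonneg fun i _ => abs_nonneg (x i)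
  refine h.trans ((Finset.sum_le_card_nsmul _ _ |R| fun i _ => (hx i).trans (le_abs_self R)).trans ?_)
  simp

lemma IsBoxCutoff.tsupport_subset {m : ℕ} {r R : ℝ} {η : Eu m → ℝ} (h : IsBoxCutoff r R η) :
    tsupport η ⊆ {x | ∀ i, |x i| ≤ R} := by
  have hc : IsClosed {x : Eu m | ∀ i, |x i| ≤ R} := by
    have : {x : Eu m | ∀ i, |x i| ≤ R} = ⋂ i, {x : Eu m | |x i| ≤ R} := by ext x; simp
    rw [this]
    exact isClosed_iInter fun i => isClosed_le (by fun_prop) continuous_const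
  refine closure_minimal (fun x hx => ?_) hc
  by_contra hcon
  exact hx (h.2.2.2 x fun hb => hcon fun i => (hb i).le)

lemma IsBoxCutoff.hasCompactSupport {m : ℕ} {r R : ℝ} {η : Eu m → ℝ} (h : IsBoxCutoff r R η) :
    HasCompactSupport η := by
  refine (isCompact_closedBall (0 : Eu m) (m * |R|)).of_isClosed_subset (isClosed_tsupport _) ?_
  intro x hx
  rw [mem_closedBall_zero_iff]
  exact norm_le_of_coord_le x (h.tsupport_subset hx)

lemma box_subset_box {m : ℕ} {r R : ℝ} (h : r ≤ R) : box m r ⊆ box m R :=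
  fun _ hx i => (hx i).trans_le h

/-- A test function is bounded and Lipschitz. -/
lemma exists_lipschitz_of_contDiff {m : ℕ} {ζ : Eu m → ℝ} (h1 : ContDiff ℝ ∞ ζ)
    (h2 : HasCompactSupport ζ) :
    ∃ L : ℝ, 0 ≤ L ∧ (∀ x, |ζ x| ≤ L) ∧ (∀ x, ‖fderiv ℝ ζ x‖ ≤ L) ∧
      ∀ x y, |ζ x - ζ y| ≤ L * ‖x - y‖ := by
  obtain ⟨Z, hZ⟩ := h2.exists_bound_of_continuous h1.continuous
  obtain ⟨L, hL⟩ := (h2.fderiv ℝ).exists_bound_of_continuous (h1.continuous_fderiv (by norm_num))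
  have hL' : ∀ x, ‖fderiv ℝ ζ x‖ ≤ max Z L := fun x => (hL x).trans (le_max_right _ _)
  refine ⟨max Z L, (norm_nonneg (ζ 0)).trans ((hZ 0).trans (le_max_left _ _)),
    fun x => (hZ x).trans (le_max_left _ _), hL', fun x y => ?_⟩
  exact Convex.norm_image_sub_le_of_norm_fderiv_le (𝕜 := ℝ) (s := Set.univ)
    (fun w _ => (h1.differentiable (by norm_num)) w) (fun w _ => hL' w) convex_univ trivial trivial

/-- The energy of a barrier function times a smooth cut-off is finite. -/
lemma nonlocalEnergy_cutoff_mul_lt_top {m : ℕ} (hm : 0 < m) {s p θ κ C M : ℝ} (hs1 : s < 1)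
    (hp : 1 < p) (hθ : 0 ≤ θ) (hθs : θ < s) (hκ : (s - θ) * p < κ) {w D ζ : Eu m → ℝ} {A : ℝ≥0∞}
    (hA : A < ⊤) (hw : Measurable w) (hwM : ∀ x, |w x| ≤ M) (hDm : Measurable D)
    (hD1 : ∀ x, D x ≤ 1)
    (hvol : ∀ t : ℝ, 0 < t → t ≤ 1 →
      volume.restrict (box m 3) {x | D x < 2 * t} ≤ A * ENNReal.ofReal (t ^ κ))
    (hosc : ∀ x, 0 < D x → ∀ y, |w x - w y| ≤ C * ‖x - y‖ ^ θ ∧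
      |w x - w y| ≤ C * (‖x - y‖ * D x ^ (θ - 1)))
    (hζ : ContDiff ℝ ∞ ζ) (hζc : HasCompactSupport ζ) (hζ0 : ∀ x ∉ box m 3, ζ x = 0) :
    nonlocalEnergy s p (fun x => ζ x * w x) < ⊤ := by
  have hκ0 : 0 < κ := lt_trans (mul_pos (by linarith) (by linarith)) hκ
  obtain ⟨L, hL0, hLb, -, hL⟩ := exists_lipschitz_of_contDiff hζ hζc
  have hM0 : 0 ≤ M := (abs_nonneg _).trans (hwM 0)
  have hDpos : ∀ᵐ x ∂volume.restrict (box m 3), 0 < D x ∧ D x ≤ 1 := by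
    -- the barrier `{D ≤ 0}` is a null set, being of positive codimension
    have hnull : volume.restrict (box m 3) {x | D x ≤ 0} = 0 := by
      have hlim : Tendsto (fun t : ℝ => A * ENNReal.ofReal (t ^ κ)) (𝓝[>] 0) (𝓝 (A * 0)) := by
        refine ENNReal.Tendsto.const_mul ?_ (Or.inr hA.ne)
        have := (Real.continuousAt_rpow_const 0 κ (Or.inr hκ0.le)).tendsto
        rw [Real.zero_rpow hκ0.ne'] at this
        simpa using (ENNReal.tendsto_ofReal this).mono_left nhdsWithin_le_nhds
      rw [mul_zero] at hlim
      refine le_antisymm (ge_of_tendsto hlim ?_) zero_le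
      filter_upwards [Ioo_mem_nhdsGT (zero_lt_one' ℝ)] with t ht
      refine (measure_mono fun x hx => ?_).trans (hvol t ht.1 ht.2.le)
      have hx : D x ≤ 0 := hx
      rw [Set.mem_ofPred_eq]
      linarith [ht.1]
    have : ∀ᵐ x ∂volume.restrict (box m 3), ¬ D x ≤ 0 := by
      rw [ae_iff]; simpa using hnull
    filter_upwards [this] with x hx using ⟨not_le.1 hx, hD1 x⟩
  refine nonlocalEnergy_lt_top hm (C := L * |C| + M * (2 * L)) hs1 hp hθs hκ hA
    (hζ.continuous.measurable.mul hw) (isOpen_box m 3).measurableSet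
    (fun x hx => by rw [hζ0 x hx, zero_mul]) hDm hDpos hvol ?_
  intro x _ hDx y
  obtain ⟨o1, o2⟩ := hosc x hDx y
  have hθ1 : θ ≤ 1 := by linarith
  have hprod : |ζ x * w x - ζ y * w y| ≤ L * |w x - w y| + M * |ζ x - ζ y| := by
    have e : ζ x * w x - ζ y * w y = ζ y * (w x - w y) + w x * (ζ x - ζ y) := by ring
    rw [e]
    refine (abs_add_le _ _).trans ?_
    rw [abs_mul, abs_mul]
    have := hLb y
    have := hwM x
    gcongr
  have hζ1 : |ζ x - ζ y| ≤ 2 * L * ‖x - y‖ ^ θ := by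
    -- the cut-off is Lipschitz and bounded, hence Hölder for every exponent in `[0, 1]`
    by_cases h1 : ‖x - y‖ ≤ 1
    · rcases (norm_nonneg (x - y)).eq_or_lt with h0 | h0
      · have := hL x y
        rw [← h0, mul_zero] at this
        exact this.trans (by positivity)
      · calc |ζ x - ζ y| ≤ L * ‖x - y‖ ^ (1 : ℝ) := by rw [Real.rpow_one]; exact hL x y
          _ ≤ L * ‖x - y‖ ^ θ := by
              gcongr 1; exact Real.rpow_le_rpow_of_exponent_ge h0 h1 hθ1
          _ ≤ 2 * L * ‖x - y‖ ^ θ := by gcongr; linarith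
    · push Not at h1
      calc |ζ x - ζ y| ≤ |ζ x| + |ζ y| := abs_sub _ _
        _ ≤ 2 * L * 1 := by linarith [hLb x, hLb y]
        _ ≤ 2 * L * ‖x - y‖ ^ θ := by gcongr; exact Real.one_le_rpow h1.le hθ
  have hζ2 : |ζ x - ζ y| ≤ 2 * L * (‖x - y‖ * D x ^ (θ - 1)) := by
    have h1 : 1 ≤ D x ^ (θ - 1) :=
      Real.one_le_rpow_of_pos_of_le_one_of_nonpos hDx (hD1 x) (by linarith)
    calc |ζ x - ζ y| ≤ L * (‖x - y‖ * 1) := by rw [mul_one]; exact hL x y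
      _ ≤ 2 * L * (‖x - y‖ * D x ^ (θ - 1)) := by gcongr; linarith
  constructor
  · calc _ ≤ L * (C * ‖x - y‖ ^ θ) + M * (2 * L * ‖x - y‖ ^ θ) := hprod.trans (by gcongr)
      _ ≤ L * (|C| * ‖x - y‖ ^ θ) + M * (2 * L * ‖x - y‖ ^ θ) := by gcongr; exact le_abs_self C
      _ = _ := by ring
  · calc _ ≤ L * (C * (‖x - y‖ * D x ^ (θ - 1))) + M * (2 * L * (‖x - y‖ * D x ^ (θ - 1))) :=
          hprod.trans (by gcongr)
      _ ≤ L * (|C| * (‖x - y‖ * D x ^ (θ - 1))) + M * (2 * L * (‖x - y‖ * D x ^ (θ - 1))) := by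
          gcongr; exact le_abs_self C
      _ = _ := by ring

/-- The common part of the barrier constructions: the barrier function `w` is locally constant where
the weight is positive, of finite energy, and smooth away from the barrier. -/
lemma realizesGap_of_barrier {m : ℕ} (hm : 0 < m) {s p q α θ κ C : ℝ} (hs1 : s < 1) (hp : 1 < p)
    (hq : 1 < q) (hθ : 0 ≤ θ) (hθs : θ < s) (hκ : (s - θ) * p < κ) {V : Set (Eu m → ℝ)}
    {w a η χ D : Eu m → ℝ} {A : ℝ≥0∞}
    (hη : IsBoxCutoff (4 / 6) (5 / 6) η) (hχ : IsBoxCutoff 2 3 χ) (hA : A < ⊤)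
    (hw : Measurable w) (hwM : ∀ x, |w x| ≤ 1 / 2) (hDm : Measurable D) (hD1 : ∀ x, D x ≤ 1)
    (hvol : ∀ t : ℝ, 0 < t → t ≤ 1 →
      volume.restrict (box m 3) {x | D x < 2 * t} ≤ A * ENNReal.ofReal (t ^ κ))
    (hosc : ∀ x, 0 < D x → ∀ y, |w x - w y| ≤ C * ‖x - y‖ ^ θ ∧
      |w x - w y| ≤ C * (‖x - y‖ * D x ^ (θ - 1)))
    (hsm : ∀ x ∉ box m (4 / 6), ContDiffAt ℝ ∞ w x) (ha : IsWeight α a)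
    (hact : ∀ x ∈ box m 1, 0 < a x → ∃ c : ℝ, w =ᶠ[𝓝 x] fun _ => c)
    (hV : ∀ v, ContDiff ℝ ∞ v → v ∈ V)
    (hc : ∃ c : ℝ≥0∞, 0 < c ∧ ∀ v ∈ V, (∀ x, x ∉ box m 1 → v x = w x * χ x) →
      c ≤ localEnergy q a v) :
    RealizesGap s p q α V a (fun x => χ x * w x) (fun x => (1 - η x) * (χ x * w x)) := by
  have hac : Continuous a := ha.2.2.1.1.continuous
  have hη0 : ∀ x ∉ box m 1, η x = 0 := fun x hx =>
    hη.2.2.2 x fun h => hx (box_subset_box (by norm_num) h)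
  have hχ1 : ∀ x ∈ box m 1, χ =ᶠ[𝓝 x] fun _ => 1 := by
    intro x hx
    filter_upwards [(isOpen_box m 2).mem_nhds (box_subset_box (by norm_num) hx)] with y hy
      using hχ.2.2.1 y hy
  -- since `χ = 1` on `Ω`, only the cut-off `η χ w` of the barrier function separates `u_C` and `u_D`
  have hdiff : (fun x => χ x * w x - (1 - η x) * (χ x * w x)) = fun x => (η x * χ x) * w x := by
    funext x; ring
  have huD : IsBoundaryValue (fun x => (1 - η x) * (χ x * w x)) := by
    refine ⟨contDiff_iff_contDiffAt.2 fun x => ?_, fun x hx => ?_⟩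
    · by_cases hx : x ∈ box m (4 / 6)
      · have : (fun x => (1 - η x) * (χ x * w x)) =ᶠ[𝓝 x] fun _ => 0 := by
          filter_upwards [(isOpen_box m (4 / 6)).mem_nhds hx] with y hy
          rw [hη.2.2.1 y hy, sub_self, zero_mul]
        exact contDiffAt_const.congr_of_eventuallyEq this
      · exact (contDiffAt_const.sub hη.1.contDiffAt).mul (hχ.1.contDiffAt.mul (hsm x hx))
    · simp [hχ.2.2.2 x hx]
  have hen : ∀ ζ : Eu m → ℝ, ContDiff ℝ ∞ ζ → HasCompactSupport ζ → (∀ x ∉ box m 3, ζ x = 0) →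
      nonlocalEnergy s p (fun x => ζ x * w x) < ⊤ := fun ζ h1 h2 h3 =>
    nonlocalEnergy_cutoff_mul_lt_top hm hs1 hp hθ hθs hκ hA hw hwM hDm hD1 hvol hosc h1 h2 h3
  obtain ⟨c, hc0, hc⟩ := hc
  refine realizesGap_of_lower_bound hq (hen χ hχ.1 hχ.hasCompactSupport hχ.2.2.2) ?_
    ⟨c, hc0, fun v hv hvu => hc v hv fun x hx => ?_⟩
    (fun φ hφ => hV _ (huD.1.add hφ.1)) ha huD ?_ ?_ ?_ ?_
  · refine localEnergy_eq_zero hq hac ha.1 fun x hx => ?_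
    obtain ⟨c, hc⟩ := hact x hx.1 hx.2
    refine ⟨1 * c, ?_⟩
    filter_upwards [hc, hχ1 x hx.1] with y h1 h2
    rw [h1, h2]
  · rw [hvu x hx, hη0 x hx]; ring
  · rw [hdiff]
    refine (locallyIntegrable_const (1 / 2 : ℝ)).mono
      ((hη.1.continuous.measurable.mul hχ.1.continuous.measurable).mul hw).aestronglyMeasurable
      (Eventually.of_forall fun x => ?_)
    rw [Real.norm_eq_abs, Real.norm_eq_abs, abs_mul, abs_mul, abs_of_nonneg (hη.2.1 x).1,
      abs_of_nonneg (hχ.2.1 x).1, abs_of_pos (by norm_num : (0 : ℝ) < 1 / 2)]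
    calc η x * χ x * |w x| ≤ 1 * 1 * (1 / 2) :=
          mul_le_mul (mul_le_mul (hη.2.1 x).2 (hχ.2.1 x).2 (hχ.2.1 x).1 zero_le_one) (hwM x)
            (abs_nonneg _) (by norm_num)
      _ = 1 / 2 := by norm_num
  · rw [hdiff]
    refine hen _ (hη.1.mul hχ.1) (hη.hasCompactSupport.mul_right) fun x hx => ?_
    simp [hχ.2.2.2 x hx]
  · rw [hdiff]
    obtain ⟨L, hL0, -, hL, -⟩ := exists_lipschitz_of_contDiff hη.1 hη.hasCompactSupport
    obtain ⟨M, hM⟩ := ha.2.1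
    have hloc : ∀ x ∈ box m 1 ∩ {x | 0 < a x}, ∃ c : ℝ, |c| ≤ 1 / 2 ∧
        (fun x => (η x * χ x) * w x) =ᶠ[𝓝 x] fun x => η x * c := by
      intro x hx
      obtain ⟨c, hc⟩ := hact x hx.1 hx.2
      refine ⟨c, by rw [← hc.eq_of_nhds]; exact hwM x, ?_⟩
      filter_upwards [hc, hχ1 x hx.1] with y h1 h2
      rw [h1, h2, mul_one]
    refine localEnergy_lt_top (C := L * (1 / 2)) hq hac ha.1 hM (fun x hx => ?_) fun x hx => ?_
    · obtain ⟨c, -, hc⟩ := hloc x hx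
      exact (((hη.1.of_le (by norm_num)).contDiffAt.mul contDiffAt_const).congr_of_eventuallyEq
        hc).contDiffWithinAt
    · obtain ⟨c, hc1, hc⟩ := hloc x hx
      rw [hc.fderiv_eq, fderiv_mul_const ((hη.1.differentiable (by norm_num)) x), norm_smul, mul_comm]
      exact mul_le_mul (hL x) hc1 (norm_nonneg _) hL0
  · refine Eventually.of_forall fun x hx => ?_
    rw [hη0 x hx]; ring

/-- The oscillation of a bounded function whose gradient is at most the inverse distance to the
barrier. -/
lemma abs_sub_le_of_fderiv_le {m : ℕ} {w M : Eu m → ℝ} {C : ℝ}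
    (hM : ∀ x y, |M x - M y| ≤ ‖x - y‖) (hw : ∀ x, |w x| ≤ 1 / 2)
    (hd : ∀ x, 0 < M x → DifferentiableAt ℝ w x) (hC : ∀ x, 0 < M x → ‖fderiv ℝ w x‖ ≤ C / M x)
    {x : Eu m} (hx : 0 < M x) (y : Eu m) : |w x - w y| ≤ (2 * |C| + 2) * (‖x - y‖ / M x) := by
  -- nearby points are joined by a segment that stays at a comparable distance from the barrier; for
  -- the others the bound of the function suffices
  by_cases hclose : ‖x - y‖ < M x / 2
  · have hball : ∀ z ∈ Metric.ball x (M x / 2), M x / 2 < M z := by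
      intro z hz
      rw [mem_ball_iff_norm, norm_sub_rev] at hz
      have := (abs_le.1 (hM x z)).2
      linarith
    have key := Convex.norm_image_sub_le_of_norm_fderiv_le (𝕜 := ℝ) (f := w)
      (C := |C| / (M x / 2)) (s := Metric.ball x (M x / 2)) (x := y) (y := x)
      (fun z hz => hd z (by linarith [hball z hz]))
      (fun z hz => (hC z (by linarith [hball z hz])).trans (by
        have := hball z hz
        gcongr
        exact le_abs_self C))
      (convex_ball _ _) (by rw [mem_ball_iff_norm, norm_sub_rev]; exact hclose)
      (Metric.mem_ball_self (by linarith))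
    refine key.trans ?_
    have h1 : |C| / (M x / 2) * ‖x - y‖ = 2 * |C| * (‖x - y‖ / M x) := by field_simp
    rw [h1]
    have : 0 ≤ ‖x - y‖ / M x := by positivity
    nlinarith
  · push Not at hclose
    have h1 : 1 ≤ 2 * (‖x - y‖ / M x) := by
      rw [← mul_div_assoc, one_le_div hx]; linarith
    calc |w x - w y| ≤ |w x| + |w y| := abs_sub _ _
      _ ≤ 1 := by linarith [hw x, hw y]
      _ ≤ 2 * (‖x - y‖ / M x) := h1
      _ ≤ _ := by
          gcongr
          have := abs_nonneg C
          linarith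

/-! ### Measures of neighbourhoods of the barriers -/

lemma volume_split {n : ℕ} (S : Set ℝ) (T : Set (Eu n)) :
    volume {x : Eu (n + 1) | vert x ∈ S ∧ horiz x ∈ T} = volume S * volume T := by
  have h := (measurePreserving_splitEquiv n).measure_preimage_equiv (S ×ˢ T)
  rw [Measure.prod_prod] at h
  rw [← h]
  rfl

lemma volume_abs_lt (t : ℝ) : volume {x : ℝ | |x| < t} = ENNReal.ofReal (2 * t) := by
  have : {x : ℝ | |x| < t} = Set.Ioo (-t) t := by ext x; simp [abs_lt]
  rw [this, Real.volume_Ioo]; ring_nf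

lemma infDist_coord_lt {n : ℕ} {l t : ℝ} (h0 : 0 < l) (h1 : l < 1 / 2) {z : Eu n}
    (hz : Metric.infDist z (cantorProd n l) < t) (i : Fin n) :
    Metric.infDist (z i) (cantor l) < t := by
  obtain ⟨c, hc⟩ := cantor_nonempty h0 h1
  have hne : (cantorProd n l).Nonempty := ⟨WithLp.toLp 2 fun _ => c, fun i => hc⟩
  obtain ⟨y, hy, hzy⟩ := (Metric.infDist_lt_iff hne).1 hz
  refine (Metric.infDist_le_dist_of_mem (hy i)).trans_lt (lt_of_le_of_lt ?_ hzy)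
  rw [Real.dist_eq, dist_eq_norm]
  exact abs_coord_le (z - y) i

lemma exists_volume_thickening_cantorProd_le (n : ℕ) {l : ℝ} (h0 : 0 < l) (h1 : l < 1 / 2) :
    ∃ A : ℝ, 0 ≤ A ∧ ∀ t : ℝ, 0 < t → t ≤ 2 →
      volume {z : Eu n | Metric.infDist z (cantorProd n l) < t} ≤
        ENNReal.ofReal (A * t ^ (n - cantorDim n l)) := by
  obtain ⟨A, hA, h⟩ := exists_volume_thickening_cantor_le h0 h1
  refine ⟨A ^ n, by positivity, fun t ht ht2 => ?_⟩
  calc volume {z : Eu n | Metric.infDist z (cantorProd n l) < t}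
      ≤ volume {z : Eu n | ∀ i, z i ∈ {x : ℝ | Metric.infDist x (cantor l) < t}} :=
        measure_mono fun z hz i => infDist_coord_lt h0 h1 hz i
    _ ≤ ∏ _i : Fin n, ENNReal.ofReal (A * t ^ (1 - cantorExp l)) := by
        rw [volume_setOf_forall_mem]
        exact Finset.prod_le_prod' fun i _ => h t ht ht2
    _ = _ := by
        rw [Finset.prod_const, Finset.card_univ, Fintype.card_fin,
          ← ENNReal.ofReal_pow (by positivity), mul_pow, ← Real.rpow_natCast (t ^ _),
          ← Real.rpow_mul ht.le, cantorDim_eq]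
        congr 3; ring

/-- Passing from a bound for the sublevel sets of `M` near `0` to one for `min 1 M`. -/
lemma volume_restrict_min_lt_le {m : ℕ} {M : Eu m → ℝ} {A κ : ℝ} (hκ : 0 ≤ κ) (hA : 0 ≤ A)
    (h : ∀ t : ℝ, 0 < t → t ≤ 2 →
      volume.restrict (box m 3) {x | M x < t} ≤ ENNReal.ofReal (A * t ^ κ)) (t : ℝ) (ht : 0 < t) :
    volume.restrict (box m 3) {x | min 1 (M x) < 2 * t} ≤
      (ENNReal.ofReal (A * 2 ^ κ) + volume (box m 3) * ENNReal.ofReal (2 ^ κ)) *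
        ENNReal.ofReal (t ^ κ) := by
  rw [add_mul]
  by_cases h2 : 2 * t ≤ 1
  · refine le_trans ?_ le_self_add
    have hsub : {x | min 1 (M x) < 2 * t} ⊆ {x | M x < 2 * t} := by
      intro x hx
      have hx : min 1 (M x) < 2 * t := hx
      rcases min_lt_iff.1 hx with h3 | h3
      · linarith
      · exact h3
    refine (measure_mono hsub).trans
      ((h (2 * t) (by linarith) (by linarith)).trans (le_of_eq ?_))
    rw [← ENNReal.ofReal_mul (by positivity), Real.mul_rpow (by norm_num) ht.le, mul_assoc]
  · refine le_trans ?_ le_add_self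
    calc volume.restrict (box m 3) {x | min 1 (M x) < 2 * t} ≤ volume (box m 3) * 1 := by
          rw [mul_one]
          exact (measure_mono (Set.subset_univ _)).trans (by simp)
      _ ≤ volume (box m 3) * (ENNReal.ofReal (2 ^ κ) * ENNReal.ofReal (t ^ κ)) := by
          gcongr
          rw [← ENNReal.ofReal_mul (by positivity), ← Real.mul_rpow (by norm_num) ht.le]
          rw [ENNReal.one_le_ofReal]
          exact Real.one_le_rpow (by linarith) hκ
      _ = _ := by ring

lemma volume_min_lt_le {m : ℕ} {M : Eu m → ℝ} {A κ : ℝ} (hκ : 0 ≤ κ) (hA : 0 ≤ A)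
    (h : ∀ t : ℝ, 0 < t → t ≤ 2 → volume {x | M x < t} ≤ ENNReal.ofReal (A * t ^ κ)) (t : ℝ)
    (ht : 0 < t) :
    volume.restrict (box m 3) {x | min 1 (M x) < 2 * t} ≤
      (ENNReal.ofReal (A * 2 ^ κ) + volume (box m 3) * ENNReal.ofReal (2 ^ κ)) *
        ENNReal.ofReal (t ^ κ) :=
  volume_restrict_min_lt_le hκ hA
    (fun t h1 h2 => (Measure.restrict_apply_le _ _).trans (h t h1 h2)) t ht

/-! ### Lower bounds for the local phase -/

/-- A lower bound for a weighted `L¹` norm of the gradient gives one for the local phase, by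
Hölder's inequality: the integrand `|g| h ^ (-σ)` is the product of `|g| h ^ (α / q)`, whose `q`-th
power is at most `a |g| ^ q`, and `h ^ (-(σ + α / q))`. -/
lemma exists_lower_bound_of_integral {m : ℕ} {q α σ : ℝ} (hq : 1 < q) {a h : Eu m → ℝ}
    {S : Set (Eu m)} (hS : MeasurableSet S) (hSb : S ⊆ box m 1) (hh : Measurable h)
    (hpos : ∀ x ∈ S, 0 < h x ∧ h x ^ α ≤ a x) {c₀ : ℝ≥0∞} (hc₀ : 0 < c₀)
    (hK : ∫⁻ x in S, ENNReal.ofReal (h x ^ (-((σ + α / q) * (q / (q - 1))))) < ⊤) :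
    ∃ c : ℝ≥0∞, 0 < c ∧ ∀ g : Eu m → Eu m, AEStronglyMeasurable g (volume.restrict S) →
      c₀ ≤ ∫⁻ x in S, ‖g x‖ₑ * ENNReal.ofReal (h x ^ (-σ)) →
      c ≤ ∫⁻ x in box m 1, ENNReal.ofReal (1 / q * (a x * ‖g x‖ ^ q)) := by
  have hq0 : 0 < q := by linarith
  have hconj : q.HolderConjugate (q / (q - 1)) := Real.HolderConjugate.conjExponent hq
  set K := ∫⁻ x in S, ENNReal.ofReal (h x ^ (-((σ + α / q) * (q / (q - 1))))) with hKdef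
  -- the summand `1` keeps the divisor positive
  set N := K ^ (1 / (q / (q - 1))) + 1 with hN
  have hNtop : N ≠ ⊤ :=
    ENNReal.add_ne_top.2 ⟨(ENNReal.rpow_lt_top_of_nonneg hconj.symm.one_div_nonneg hK.ne).ne,
      ENNReal.one_ne_top⟩
  refine ⟨c₀ ^ q / (ENNReal.ofReal q * N ^ q), ENNReal.div_pos (ENNReal.rpow_pos_of_nonneg hc₀ hq0.le).ne'
    (ENNReal.mul_ne_top ENNReal.ofReal_ne_top (ENNReal.rpow_ne_top_of_nonneg hq0.le hNtop)),
    fun g hg hle => ?_⟩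
  set E := ∫⁻ x in box m 1, ENNReal.ofReal (1 / q * (a x * ‖g x‖ ^ q)) with hE
  have key : c₀ ≤ (ENNReal.ofReal q * E) ^ (1 / q) * N := by
    calc c₀ ≤ ∫⁻ x in S, ‖g x‖ₑ * ENNReal.ofReal (h x ^ (-σ)) := hle
      _ = ∫⁻ x in S, ((fun x => ‖g x‖ₑ * ENNReal.ofReal (h x ^ (α / q))) *
            fun x => ENNReal.ofReal (h x ^ (-(σ + α / q)))) x := by
          refine setLIntegral_congr_fun hS fun x hx => ?_
          have h0 := (hpos x hx).1
          simp only [Pi.mul_apply]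
          rw [mul_assoc, ← ENNReal.ofReal_mul (by positivity), ← Real.rpow_add h0]
          congr 3; ring
      _ ≤ (∫⁻ x in S, (‖g x‖ₑ * ENNReal.ofReal (h x ^ (α / q))) ^ q) ^ (1 / q) *
          (∫⁻ x in S, ENNReal.ofReal (h x ^ (-(σ + α / q))) ^ (q / (q - 1))) ^
            (1 / (q / (q - 1))) :=
          ENNReal.lintegral_mul_le_Lp_mul_Lq _ hconj
            (hg.enorm.mul (hh.pow_const _).ennreal_ofReal.aemeasurable)
            (hh.pow_const _).ennreal_ofReal.aemeasurable
      _ ≤ (ENNReal.ofReal q * E) ^ (1 / q) * N := by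
          gcongr
          · rw [hE, ← lintegral_const_mul' _ _ ENNReal.ofReal_ne_top]
            refine (setLIntegral_mono' hS fun x hx => ?_).trans (lintegral_mono_set hSb)
            obtain ⟨h0, h1⟩ := hpos x hx
            rw [← ofReal_norm, ← ENNReal.ofReal_mul (norm_nonneg _),
              ENNReal.ofReal_rpow_of_nonneg (by positivity) hq0.le,
              ← ENNReal.ofReal_mul hq0.le]
            refine ENNReal.ofReal_le_ofReal ?_
            rw [Real.mul_rpow (norm_nonneg _) (by positivity), ← Real.rpow_mul h0.le,
              div_mul_cancel₀ _ hq0.ne', ← mul_assoc, mul_one_div_cancel hq0.ne', one_mul, mul_comm]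
            gcongr
          · rw [hN]
            refine le_trans (le_of_eq ?_) le_self_add
            congr 1
            refine setLIntegral_congr_fun hS fun x hx => ?_
            have h0 := (hpos x hx).1
            rw [ENNReal.ofReal_rpow_of_nonneg (by positivity) hconj.symm.nonneg, ← Real.rpow_mul h0.le,
              neg_mul]
  refine ENNReal.div_le_of_le_mul ?_
  calc c₀ ^ q ≤ ((ENNReal.ofReal q * E) ^ (1 / q) * N) ^ q := by gcongr
    _ = ENNReal.ofReal q * E * N ^ q := by
        rw [ENNReal.mul_rpow_of_nonneg _ _ hq0.le, ← ENNReal.rpow_mul, one_div_mul_cancel hq0.ne',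
          ENNReal.rpow_one]
    _ = _ := by ring

/-! ### The barrier in the subcritical case -/

lemma isClosed_cantorProd (n : ℕ) (l : ℝ) : IsClosed (cantorProd n l) := by
  have : cantorProd n l = ⋂ i, (fun y : Eu n => y i) ⁻¹' cantor l := by ext y; simp [cantorProd]
  rw [this]
  exact isClosed_iInter fun i => (isClosed_cantor l).preimage (by fun_prop)

lemma cantorProd_nonempty (n : ℕ) {l : ℝ} (h0 : 0 < l) (h1 : l < 1 / 2) :
    (cantorProd n l).Nonempty := by
  obtain ⟨c, hc⟩ := cantor_nonempty h0 h1
  exact ⟨WithLp.toLp 2 fun _ => c, fun i => hc⟩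

lemma abs_infDist_sub_le {X : Type*} [SeminormedAddCommGroup X] (s : Set X) (x y : X) :
    |Metric.infDist x s - Metric.infDist y s| ≤ ‖x - y‖ := by
  simpa [Real.dist_eq, dist_eq_norm] using (Metric.lipschitz_infDist_pt s).dist_le_mul x y

/-- The distance of `x̄` to the product Cantor set. -/
def latDist (n : ℕ) (l : ℝ) (x : Eu (n + 1)) : ℝ := Metric.infDist (horiz x) (cantorProd n l)

lemma latDist_nonneg (n : ℕ) (l : ℝ) (x : Eu (n + 1)) : 0 ≤ latDist n l x := Metric.infDist_nonneg

lemma abs_latDist_sub_le {n : ℕ} (l : ℝ) (x y : Eu (n + 1)) :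
    |latDist n l x - latDist n l y| ≤ ‖x - y‖ := by
  refine (abs_infDist_sub_le _ _ _).trans ?_
  rw [← horiz_sub]
  exact norm_horiz_le _

lemma abs_abs_vert_sub_le {n : ℕ} (x y : Eu (n + 1)) : |(|vert x| - |vert y|)| ≤ ‖x - y‖ := by
  refine (abs_abs_sub_abs_le _ _).trans ?_
  rw [← vert_sub]
  exact abs_vert_le _

lemma continuous_latDist (n : ℕ) (l : ℝ) : Continuous (latDist n l) :=
  continuous_of_abs_sub_le (abs_latDist_sub_le l)

lemma contDiff_vert {n : ℕ} : ContDiff ℝ ∞ (vert : Eu (n + 1) → ℝ) := (vertL n).contDiff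

lemma contDiff_horiz {n : ℕ} : ContDiff ℝ ∞ (horiz : Eu (n + 1) → Eu n) := (horizL n).contDiff

lemma isConeCutoff_latDist (n : ℕ) (l : ℝ) {κ κ' : ℝ} (hκ : 0 < κ) (hκ' : κ < κ') :
    IsConeCutoff (latDist n l) (fun x => |vert x|) κ κ'
      (coneCutoff (latDist n l) (fun x => |vert x|) κ κ') :=
  isConeCutoff_coneCutoff (fun _ => abs_nonneg _) (latDist_nonneg n l) hκ hκ' (abs_latDist_sub_le l)
    abs_abs_vert_sub_le fun x hx =>
      (contDiffAt_abs (abs_ne_zero.1 hx)).comp x contDiff_vert.contDiffAt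

/-- The barrier function of the subcritical case: it jumps across `C^(d-1) × {0}`. -/
def latBarrier (n : ℕ) (l : ℝ) (x : Eu (n + 1)) : ℝ :=
  1 / 2 * Real.sign (vert x) * coneCutoff (latDist n l) (fun x => |vert x|) 2 4 x

/-- The weight of the subcritical case before localization. -/
def latWeight (n : ℕ) (l α : ℝ) (x : Eu (n + 1)) : ℝ :=
  |vert x| ^ α * coneCutoff (latDist n l) (fun x => |vert x|) (1 / 2) 2 x

/-- The size of the larger one of the two distances that define the barrier. -/
def latMax (n : ℕ) (l : ℝ) (x : Eu (n + 1)) : ℝ := max (latDist n l x) |vert x|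

lemma abs_latMax_sub_le {n : ℕ} (l : ℝ) (x y : Eu (n + 1)) :
    |latMax n l x - latMax n l y| ≤ ‖x - y‖ :=
  (abs_max_sub_max_le_max _ _ _ _).trans (max_le (abs_latDist_sub_le l x y) (abs_abs_vert_sub_le x y))

lemma sign_vert_eventuallyEq {n : ℕ} {x : Eu (n + 1)} (hx : vert x ≠ 0) :
    (fun y : Eu (n + 1) => Real.sign (vert y)) =ᶠ[𝓝 x] fun _ => Real.sign (vert x) := by
  rcases lt_or_gt_of_ne hx with h | h
  · filter_upwards [continuous_vert.continuousAt.eventually_lt continuousAt_const h] with y hy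
    rw [Real.sign_of_neg hy, Real.sign_of_neg h]
  · filter_upwards [continuousAt_const.eventually_lt continuous_vert.continuousAt h] with y hy
    rw [Real.sign_of_pos hy, Real.sign_of_pos h]

lemma abs_sign_le (t : ℝ) : |Real.sign t| ≤ 1 := by
  rcases Real.sign_apply_eq t with h | h | h <;> simp [h]

lemma abs_latBarrier_le (n : ℕ) (l : ℝ) (x : Eu (n + 1)) : |latBarrier n l x| ≤ 1 / 2 := by
  have h := (isConeCutoff_latDist n l (κ := 2) (κ' := 4) (by norm_num) (by norm_num)).2.1 x
  rw [latBarrier, abs_mul, abs_mul, abs_of_nonneg h.1]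
  calc _ ≤ |(1 / 2 : ℝ)| * 1 * 1 := mul_le_mul (mul_le_mul_of_nonneg_left (abs_sign_le _) (abs_nonneg _)) h.2 h.1
          (by positivity)
    _ = 1 / 2 := by norm_num

/-- The barrier function is smooth off the barrier and its gradient is bounded by the inverse of the
distance to the barrier. -/
lemma exists_fderiv_latBarrier_le (n : ℕ) (l : ℝ) : ∃ C : ℝ, ∀ x, 0 < latMax n l x →
    ContDiffAt ℝ ∞ (latBarrier n l) x ∧ ‖fderiv ℝ (latBarrier n l) x‖ ≤ C / latMax n l x := by
  obtain ⟨hsm, h01, -, hzero, C, hC⟩ :=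
    isConeCutoff_latDist n l (κ := 2) (κ' := 4) (by norm_num) (by norm_num)
  set ρ := coneCutoff (latDist n l) (fun x => |vert x|) 2 4 with hρ
  -- outside the wide cone the function vanishes, and inside of it `latMax` is comparable to `|x_d|`
  have hfar : ∀ x, 4 * |vert x| < latDist n l x → ρ =ᶠ[𝓝 x] fun _ => 0 := by
    intro x hx
    filter_upwards [(continuous_const.mul continuous_vert.abs).continuousAt.eventually_lt
      (continuous_latDist n l).continuousAt hx] with y hy using hzero y hy
  have hfar' : ∀ x, 4 * |vert x| < latDist n l x → latBarrier n l =ᶠ[𝓝 x] fun _ => 0 := by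
    intro x hx
    filter_upwards [hfar x hx] with y hy
    rw [latBarrier, ← hρ, hy, mul_zero]
  refine ⟨4 * |C|, fun x hx => ?_⟩
  by_cases hx4 : 4 * |vert x| < latDist n l x
  · refine ⟨contDiffAt_const.congr_of_eventuallyEq (hfar' x hx4), ?_⟩
    rw [(hfar' x hx4).fderiv_eq, fderiv_const_apply, norm_zero]
    positivity
  · push Not at hx4
    have hv : vert x ≠ 0 := by
      intro h0
      rw [h0, abs_zero, mul_zero] at hx4
      rw [latMax, h0, abs_zero, max_eq_right hx4] at hx
      exact lt_irrefl _ hx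
    have hv' : 0 < |vert x| := abs_pos.2 hv
    have hop : IsOpen {x : Eu (n + 1) | ¬ (latDist n l x = 0 ∧ |vert x| = 0)} := by
      have : {x : Eu (n + 1) | ¬ (latDist n l x = 0 ∧ |vert x| = 0)} =
          ({x | latDist n l x = 0} ∩ {x | |vert x| = 0})ᶜ := rfl
      rw [this, isOpen_compl_iff]
      exact (isClosed_eq (continuous_latDist n l) continuous_const).inter
        (isClosed_eq continuous_vert.abs continuous_const)
    have hρx : ContDiffAt ℝ ∞ ρ x := hsm.contDiffAt (hop.mem_nhds fun h => hv'.ne' h.2)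
    have hev : latBarrier n l =ᶠ[𝓝 x] fun y => 1 / 2 * Real.sign (vert x) * ρ y := by
      filter_upwards [sign_vert_eventuallyEq hv] with y hy
      rw [latBarrier, ← hρ, hy]
    refine ⟨(contDiffAt_const.mul hρx).congr_of_eventuallyEq hev, ?_⟩
    rw [hev.fderiv_eq, fderiv_const_mul (hρx.differentiableAt (by norm_num)), norm_smul]
    have h1 : ‖1 / 2 * Real.sign (vert x)‖ ≤ 1 := by
      rw [Real.norm_eq_abs, abs_mul]
      calc _ ≤ |(1 / 2 : ℝ)| * 1 := by gcongr; exact abs_sign_le _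
        _ ≤ 1 := by norm_num
    have h2 : latMax n l x ≤ 4 * |vert x| := max_le hx4 (by linarith)
    calc _ ≤ 1 * (|C| / |vert x|) :=
          mul_le_mul h1 ((hC x hv'.ne').trans (by gcongr; exact le_abs_self C)) (norm_nonneg _)
            zero_le_one
      _ = 4 * |C| / (4 * |vert x|) := by field_simp
      _ ≤ 4 * |C| / latMax n l x := by gcongr

lemma measurable_latBarrier (n : ℕ) (l : ℝ) : Measurable (latBarrier n l) := by
  classical
  obtain ⟨C, hC⟩ := exists_fderiv_latBarrier_le n l
  have hop : IsOpen {x | 0 < latMax n l x} := isOpen_pos (continuous_of_abs_sub_le (abs_latMax_sub_le l))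
  have he : latBarrier n l = {x | 0 < latMax n l x}.piecewise (latBarrier n l) (fun _ => 0) := by
    funext x
    by_cases hx : x ∈ {x | 0 < latMax n l x}
    · rw [Set.piecewise_eq_of_mem _ _ _ hx]
    -- on the barrier itself the function vanishes, because of `sgn 0 = 0`
    · rw [Set.piecewise_eq_of_notMem _ _ _ hx]
      have h1 : latMax n l x ≤ 0 := not_lt.1 hx
      have h2 : vert x = 0 := abs_eq_zero.1 (le_antisymm ((le_max_right _ _).trans h1) (abs_nonneg _))
      rw [latBarrier, h2, Real.sign_zero]; ring
  rw [he]
  exact ContinuousOn.measurable_piecewise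
    (fun x hx => (hC x hx).1.continuousAt.continuousWithinAt) continuousOn_const hop.measurableSet

lemma latMax_pos_of_notMem_box {n : ℕ} {l : ℝ} (h0 : 0 < l) (h1 : l < 1 / 2) {x : Eu (n + 1)}
    (hx : x ∉ box (n + 1) (4 / 6)) : 0 < latMax n l x := by
  by_contra hcon
  push Not at hcon
  refine hx fun i => ?_
  have hv : |vert x| ≤ 0 := (le_max_right _ _).trans hcon
  have hd : latDist n l x = 0 :=
    le_antisymm ((le_max_left _ _).trans hcon) (latDist_nonneg n l x)
  have hmem : horiz x ∈ cantorProd n l :=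
    ((isClosed_cantorProd n l).mem_iff_infDist_zero (cantorProd_nonempty n h0 h1)).2 hd
  refine Fin.lastCases (lt_of_le_of_lt hv (by norm_num)) (fun j => ?_) i
  have := cantor_subset l (hmem j)
  have h2 : |(horiz x) j| ≤ 1 / 2 := abs_le.2 this
  exact lt_of_le_of_lt h2 (by norm_num)

lemma exists_volume_latMax_lt_le (n : ℕ) {l : ℝ} (h0 : 0 < l) (h1 : l < 1 / 2) :
    ∃ A : ℝ, 0 ≤ A ∧ ∀ t : ℝ, 0 < t → t ≤ 2 →
      volume {x | latMax n l x < t} ≤ ENNReal.ofReal (A * t ^ (n + 1 - cantorDim n l)) := by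
  obtain ⟨A, hA, h⟩ := exists_volume_thickening_cantorProd_le n h0 h1
  refine ⟨2 * A, by positivity, fun t ht ht2 => ?_⟩
  have hset : {x | latMax n l x < t} = {x : Eu (n + 1) | vert x ∈ {r : ℝ | |r| < t} ∧
      horiz x ∈ {z | Metric.infDist z (cantorProd n l) < t}} := by
    ext x
    simp only [latMax, latDist, max_lt_iff, Set.mem_ofPred_eq]
    exact and_comm
  rw [hset, volume_split, volume_abs_lt]
  calc _ ≤ ENNReal.ofReal (2 * t) * ENNReal.ofReal (A * t ^ (n - cantorDim n l)) := by
        gcongr; exact h t ht ht2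
    _ = _ := by
        rw [← ENNReal.ofReal_mul (by positivity),
          show (n : ℝ) + 1 - cantorDim n l = 1 + (n - cantorDim n l) by ring, Real.rpow_add ht,
          Real.rpow_one]
        congr 1; ring

lemma cantorDim_le (n : ℕ) {l : ℝ} (h0 : 0 < l) (h1 : l < 1 / 2) : cantorDim n l ≤ n := by
  rw [cantorDim_eq]
  have := cantorExp_lt_one h0 h1
  exact mul_le_of_le_one_right (Nat.cast_nonneg n) this.le

lemma cantorDim_nonneg (n : ℕ) {l : ℝ} (h0 : 0 < l) (h1 : l < 1 / 2) : 0 ≤ cantorDim n l := by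
  rw [cantorDim_eq]
  exact mul_nonneg (Nat.cast_nonneg n) (cantorExp_pos h0 h1).le

lemma isSymbol_abs_vert_rpow (n : ℕ) (α : ℝ) :
    IsSymbol (fun x : Eu (n + 1) => |vert x|) α (fun x => |vert x| ^ α) := by
  refine IsSymbol.abs (h := vert) continuous_vert ?_ ?_
  · refine ((isSymbol_rpow α).comp_clm continuous_id (vertL n)).congr continuous_vert fun x hx => ?_
    have hx : 0 < vert x := hx
    simp [abs_of_pos hx]
  · refine ((isSymbol_rpow α).comp_clm continuous_id (-vertL n)).congr continuous_vert.neg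
      fun x hx => ?_
    have hx : 0 < -vert x := hx
    simp [abs_of_neg (neg_pos.1 hx)]

lemma isWeight_latWeight (n : ℕ) (l : ℝ) {α : ℝ} (hα : 0 < α) {χ : Eu (n + 1) → ℝ}
    (hχ : IsBoxCutoff 2 3 χ) : IsWeight α (fun x => χ x * latWeight n l α x) := by
  have h01 := (isConeCutoff_latDist n l (κ := 1 / 2) (κ' := 2) (by norm_num) (by norm_num)).2.1
  have hv : ∀ x ∈ tsupport χ, |vert x| ≤ 3 := fun x hx => hχ.tsupport_subset hx (Fin.last n)
  refine ⟨fun x => mul_nonneg (hχ.2.1 x).1 (mul_nonneg (by positivity) (h01 x).1),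
    ⟨3 ^ α, fun x => ?_⟩, ?_, fun x hx => by simp [hχ.2.2.2 x hx]⟩
  · by_cases hx : x ∈ tsupport χ
    · have h1 := hχ.2.1 x
      have h2 := h01 x
      have h3 := hv x hx
      calc χ x * latWeight n l α x ≤ 1 * (3 ^ α * 1) := by
            rw [latWeight]
            refine mul_le_mul h1.2 (mul_le_mul ?_ h2.2 h2.1 (by positivity))
              (mul_nonneg (by positivity) h2.1) zero_le_one
            exact Real.rpow_le_rpow (abs_nonneg _) h3 hα.le
        _ = 3 ^ α := by ring
    · dsimp only
      rw [image_eq_zero_of_notMem_tsupport hx, zero_mul]; positivity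
  · refine isHolder_of_isSymbol hα (h := fun x => |vert x|) (fun _ => abs_nonneg _) abs_abs_vert_sub_le
      (fun x hx => ?_) ?_
    · rw [latWeight, hx, Real.zero_rpow hα.ne']; ring
    · have hc : Continuous fun x : Eu (n + 1) => |vert x| := continuous_vert.abs
      have h1 := isSymbol_of_hasCompactSupport (h := fun x : Eu (n + 1) => |vert x|) hχ.1
        hχ.hasCompactSupport hv
      have h2 := isSymbol_coneCutoff_vert (κ := 1 / 2) (κ' := 2) (by norm_num) (by norm_num)
        (continuous_latDist n l)
      have h3 := h1.smul hc ((isSymbol_abs_vert_rpow n α).smul hc h2)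
      rw [zero_add, add_zero] at h3
      exact h3

/-- Where the weight is active, the barrier function is locally constant. -/
lemma latBarrier_eventuallyEq {n : ℕ} {l α : ℝ} (hα : 0 < α) {χ : Eu (n + 1) → ℝ}
    (hχ : IsBoxCutoff 2 3 χ) {x : Eu (n + 1)} (hx : 0 < χ x * latWeight n l α x) :
    ∃ c : ℝ, latBarrier n l =ᶠ[𝓝 x] fun _ => c := by
  have hcont : Continuous fun x => χ x * latWeight n l α x :=
    (isWeight_latWeight n l hα hχ).2.2.1.1.continuous
  have hA := isConeCutoff_latDist n l (κ := 1 / 2) (κ' := 2) (by norm_num) (by norm_num)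
  have hB := isConeCutoff_latDist n l (κ := 2) (κ' := 4) (by norm_num) (by norm_num)
  have hv : vert x ≠ 0 := by
    intro h0
    rw [latWeight, h0, abs_zero, Real.zero_rpow hα.ne', zero_mul, mul_zero] at hx
    exact lt_irrefl _ hx
  refine ⟨1 / 2 * Real.sign (vert x), ?_⟩
  filter_upwards [continuousAt_const.eventually_lt hcont.continuousAt hx,
    sign_vert_eventuallyEq hv] with y hy hs
  have h1 : latDist n l y ≤ 2 * |vert y| := by
    by_contra hcon
    push Not at hcon
    rw [latWeight, hA.2.2.2.1 y hcon] at hy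
    simp at hy
  rw [latBarrier, hs, hB.2.2.1 y h1, mul_one]

/-- In the subcritical case the gap follows from a lower bound on the local phase. -/
lemma realizesGap_latBarrier {n : ℕ} {s p q α l : ℝ} (hs0 : 0 < s) (hs1 : s < 1) (hp : 1 < p)
    (hq : 1 < q) (hα : 0 < α) (h0 : 0 < l) (h1 : l < 1 / 2)
    (hcap : s * p < n + 1 - cantorDim n l) {η χ : Eu (n + 1) → ℝ}
    (hη : IsBoxCutoff (4 / 6) (5 / 6) η) (hχ : IsBoxCutoff 2 3 χ)
    (hc : ∃ c : ℝ≥0∞, 0 < c ∧ ∀ v ∈ {v : Eu (n + 1) → ℝ | Continuous v},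
      (∀ x, x ∉ box (n + 1) 1 → v x = latBarrier n l x * χ x) →
      c ≤ localEnergy q (fun x => χ x * latWeight n l α x) v) :
    RealizesGap s p q α {v | Continuous v} (fun x => χ x * latWeight n l α x)
      (fun x => χ x * latBarrier n l x) (fun x => (1 - η x) * (χ x * latBarrier n l x)) := by
  obtain ⟨C, hC⟩ := exists_fderiv_latBarrier_le n l
  obtain ⟨A, hA, hvol⟩ := exists_volume_latMax_lt_le n h0 h1
  have hMc : Continuous (latMax n l) := continuous_of_abs_sub_le (abs_latMax_sub_le l)
  have hκ0 : 0 ≤ n + 1 - cantorDim n l := by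
    have := cantorDim_le n h0 h1
    linarith
  refine realizesGap_of_barrier (θ := 0) (κ := n + 1 - cantorDim n l) (C := 2 * |C| + 2)
    (D := fun x => min 1 (latMax n l x)) (Nat.succ_pos n) hs1 hp hq
    le_rfl hs0 (by simpa using hcap) hη hχ ?_ (measurable_latBarrier n l) (abs_latBarrier_le n l)
    (continuous_const.min hMc).measurable (fun x => min_le_left _ _)
    (fun t ht _ => volume_min_lt_le hκ0 hA hvol t ht) ?_
    (fun x hx => (hC x (latMax_pos_of_notMem_box h0 h1 hx)).1) (isWeight_latWeight n l hα hχ)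
    (fun x _ hx => latBarrier_eventuallyEq hα hχ hx) (fun v hv => hv.continuous) hc
  · exact ENNReal.add_lt_top.2 ⟨ENNReal.ofReal_lt_top,
      ENNReal.mul_lt_top (volume_box_lt_top _ _) ENNReal.ofReal_lt_top⟩
  · intro x hx y
    have hM : 0 < latMax n l x := hx.trans_le (min_le_right _ _)
    have hCn := abs_nonneg C
    refine ⟨?_, ?_⟩
    · rw [Real.rpow_zero, mul_one]
      calc |latBarrier n l x - latBarrier n l y| ≤ |latBarrier n l x| + |latBarrier n l y| :=
            abs_sub _ _
        _ ≤ _ := by linarith [abs_latBarrier_le n l x, abs_latBarrier_le n l y]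
    · refine (abs_sub_le_of_fderiv_le (abs_latMax_sub_le l) (abs_latBarrier_le n l)
        (fun x hx => (hC x hx).1.differentiableAt (by norm_num)) (fun x hx => (hC x hx).2) hM
        y).trans ?_
      rw [zero_sub, Real.rpow_neg_one, ← div_eq_mul_inv]
      gcongr
      exact min_le_right _ _

/-! ### Weak gradients along cones -/

/-- The weak gradient tested with the radial vector field `φ(y) (y - b)`, whose divergence is
`∇φ(y) · (y - b) + m φ(y)`. -/
lemma HasWeakGradientOn.integral_radial {m : ℕ} {U : Set (Eu m)} {v : Eu m → ℝ} {g : Eu m → Eu m}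
    (h : HasWeakGradientOn U v g) {φ : Eu m → ℝ} (hφ : IsTestFunction U φ) (b : Eu m) :
    ∫ y in U, v y * (fderiv ℝ φ y (y - b) + m * φ y) = -∫ y in U, φ y * inner ℝ (g y) (y - b) := by
  set e : Fin m → Eu m := fun i => EuclideanSpace.single i (1 : ℝ) with he
  have hφi : ∀ i, IsTestFunction U (fun y => φ y * (y - b) i) := fun i =>
    ⟨hφ.1.mul (by fun_prop), hφ.2.1.mul_right,
      (tsupport_mul_subset_left).trans hφ.2.2⟩
  have hsum : ∀ w : Eu m, w = ∑ i, w i • e i := by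
    intro w
    ext j
    simp [he, Finset.sum_apply, Pi.single_apply]
  have hd : ∀ i y, fderiv ℝ (fun y => φ y * (y - b) i) y (e i) =
      φ y + fderiv ℝ φ y ((y - b) i • e i) := by
    intro i y
    have h1 : HasFDerivAt (fun y : Eu m => (y - b) i) (EuclideanSpace.proj i : Eu m →L[ℝ] ℝ) y :=
      ((EuclideanSpace.proj i : Eu m →L[ℝ] ℝ).hasFDerivAt).sub_const (b i)
    have h2 := ((hφ.1.differentiable (by norm_num)) y).hasFDerivAt.mul h1
    rw [show fderiv ℝ (fun y => φ y * (y - b) i) y = _ from h2.fderiv]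
    simp [he]
  have i1 : ∀ i, Integrable (fun y => v y * fderiv ℝ (fun y => φ y * (y - b) i) y (e i))
      (volume.restrict U) := fun i =>
    ((IsTestFunction.integrable_smul ((hφi i).continuous_fderiv_apply _)
      ((hφi i).2.1.fderiv_apply ℝ _) ((hφi i).tsupport_fderiv_apply _) h.1).congr
        (Eventually.of_forall fun x => mul_comm _ _)).restrict
  have i2 : ∀ i, Integrable (fun y => (φ y * (y - b) i) * inner ℝ (g y) (e i))
      (volume.restrict U) := fun i => by
    have := (IsTestFunction.integrable_smul (hφi i).1.continuous (hφi i).2.1 (hφi i).2.2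
      h.2.1).inner_const (𝕜 := ℝ) (e i)
    refine (this.congr (Eventually.of_forall fun x => ?_)).restrict
    simp [inner_smul_left]
  have l1 : ∀ y, v y * (fderiv ℝ φ y (y - b) + m * φ y) =
      ∑ i, v y * fderiv ℝ (fun y => φ y * (y - b) i) y (e i) := by
    intro y
    simp_rw [hd, ← Finset.mul_sum, Finset.sum_add_distrib, ← map_sum, ← hsum]
    simp [add_comm]
  have l2 : ∀ y, φ y * inner ℝ (g y) (y - b) =
      ∑ i, (φ y * (y - b) i) * inner ℝ (g y) (e i) := by
    intro y
    conv_lhs => rw [hsum (y - b)]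
    rw [inner_sum, Finset.mul_sum]
    simp [inner_smul_right, mul_assoc]
  simp_rw [l1, l2]
  rw [integral_finsetSum _ fun i _ => i1 i, integral_finsetSum _ fun i _ => i2 i,
    ← Finset.sum_neg_distrib]
  exact Finset.sum_congr rfl fun i _ => h.2.2 _ (hφi i) (e i)

lemma deriv_smoothTransition_eq_zero {u : ℝ} (hu : u ∉ Set.Icc (0 : ℝ) 1) :
    deriv Real.smoothTransition u = 0 := by
  rcases lt_or_ge u 0 with h | h
  · have : Real.smoothTransition =ᶠ[𝓝 u] fun _ => 0 := by
      filter_upwards [Iio_mem_nhds h] with x hx using Real.smoothTransition.zero_of_nonpos (le_of_lt hx)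
    rw [this.deriv_eq, deriv_const]
  · have h1 : 1 < u := by
      by_contra hcon
      exact hu ⟨h, not_lt.1 hcon⟩
    have : Real.smoothTransition =ᶠ[𝓝 u] fun _ => 1 := by
      filter_upwards [Ioi_mem_nhds h1] with x hx using Real.smoothTransition.one_of_one_le (le_of_lt hx)
    rw [this.deriv_eq, deriv_const]

lemma continuous_deriv_smoothTransition : Continuous (deriv Real.smoothTransition) :=
  (Real.smoothTransition.contDiff (n := 1)).continuous_deriv le_rfl

lemma differentiable_smoothTransition : Differentiable ℝ Real.smoothTransition :=
  (Real.smoothTransition.contDiff (n := 1)).differentiable one_ne_zero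

/-- A continuous function changes between two points by at most the total mass of its distributional
derivative in between. -/
lemma abs_sub_le_of_forall_test {f : ℝ → ℝ} (hf : Continuous f) {a b K : ℝ} (hab : a < b)
    (h : ∀ θ : ℝ → ℝ, ContDiff ℝ ∞ θ → HasCompactSupport θ → tsupport θ ⊆ Set.Ioo a b →
      (∀ t, 0 ≤ θ t ∧ θ t ≤ 1) → |∫ t, deriv θ t * f t| ≤ K) : |f a - f b| ≤ K := by
  set T := Real.smoothTransition with hT
  set G : ℝ → ℝ := fun ε => ∫ u in Set.Icc (0 : ℝ) 1,
    deriv T u * (f (a + ε * (1 + u)) - f (b - ε * (1 + u))) with hG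
  have hTc : Continuous (deriv T) := continuous_deriv_smoothTransition
  have hGc : Continuous G := by
    refine continuous_parametric_integral_of_continuous ?_ isCompact_Icc
    simp only [Function.uncurry_def]
    fun_prop
  have hG0 : G 0 = f a - f b := by
    have h1 : ∫ u in Set.Icc (0 : ℝ) 1, deriv T u = 1 := by
      rw [integral_Icc_eq_integral_Ioc, ← intervalIntegral.integral_of_le zero_le_one,
        intervalIntegral.integral_deriv_eq_sub (fun x _ => differentiable_smoothTransition x)
          (hTc.intervalIntegrable _ _), Real.smoothTransition.one, Real.smoothTransition.zero,
        sub_zero]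
    simp only [hG, zero_mul, add_zero, sub_zero]
    rw [integral_mul_const, h1, one_mul]
  have hint : ∀ c ε : ℝ, Integrable fun u => deriv T u * f (c + ε * (1 + u)) := by
    intro c ε
    refine Continuous.integrable_of_hasCompactSupport (by fun_prop) ?_
    refine HasCompactSupport.mul_right (HasCompactSupport.intro (isCompact_Icc (a := (0 : ℝ)) (b := 1))
      fun u hu => deriv_smoothTransition_eq_zero hu)
  have hbound : ∀ ε : ℝ, 0 < ε → ε < (b - a) / 4 → |G ε| ≤ K := by
    intro ε hε hε4
    -- a window that rises from `0` to `1` on `[a + ε, a + 2ε]` and falls back on `[b - 2ε, b - ε]`; the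
    -- integral of its derivative against `f` is the difference `G ε` of two means of `f` near the end points
    set θ : ℝ → ℝ := fun t => T ((t - a) / ε - 1) + T ((b - t) / ε - 1) - 1 with hθ
    have hsmall : ∀ t, t < a + 2 * ε → T ((b - t) / ε - 1) = 1 := fun t ht =>
      Real.smoothTransition.one_of_one_le (by
        have : 2 ≤ (b - t) / ε := by rw [le_div_iff₀ hε]; linarith
        linarith)
    have hlarge : ∀ t, a + 2 * ε ≤ t → T ((t - a) / ε - 1) = 1 := fun t ht =>
      Real.smoothTransition.one_of_one_le (by
        have : 2 ≤ (t - a) / ε := by rw [le_div_iff₀ hε]; linarith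
        linarith)
    have hsupp : tsupport θ ⊆ Set.Icc (a + ε) (b - ε) := by
      refine closure_minimal (fun t ht => ?_) isClosed_Icc
      by_contra hcon
      refine ht ?_
      rcases lt_or_ge t (a + ε) with h1 | h1
      · have : T ((t - a) / ε - 1) = 0 := Real.smoothTransition.zero_of_nonpos (by
          have : (t - a) / ε ≤ 1 := by rw [div_le_one hε]; linarith
          linarith)
        simp only [hθ]
        rw [this, hsmall t (by linarith)]; ring
      · have h2 : b - ε < t := by
          by_contra h3
          exact hcon ⟨h1, not_lt.1 h3⟩
        have : T ((b - t) / ε - 1) = 0 := Real.smoothTransition.zero_of_nonpos (by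
          have : (b - t) / ε ≤ 1 := by rw [div_le_one hε]; linarith
          linarith)
        simp only [hθ]
        rw [this, hlarge t (by linarith)]; ring
    have hd : ∀ t, deriv θ t =
        deriv T ((t - a) / ε - 1) / ε - deriv T ((b - t) / ε - 1) / ε := by
      intro t
      have d1 : HasDerivAt (fun t => (t - a) / ε - 1) (1 / ε) t :=
        (((hasDerivAt_id t).sub_const a).div_const ε).sub_const 1
      have d2 : HasDerivAt (fun t => (b - t) / ε - 1) (-1 / ε) t :=
        (((hasDerivAt_id t).const_sub b).div_const ε).sub_const 1
      have e1 := (differentiable_smoothTransition ((t - a) / ε - 1)).hasDerivAt.comp t d1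
      have e2 := (differentiable_smoothTransition ((b - t) / ε - 1)).hasDerivAt.comp t d2
      refine ((e1.add e2).sub_const 1).deriv.trans ?_
      ring
    have key := h θ (by
        refine ((Real.smoothTransition.contDiff.comp (by fun_prop)).add
          (Real.smoothTransition.contDiff.comp (by fun_prop))).sub contDiff_const)
      (HasCompactSupport.of_support_subset_isCompact isCompact_Icc ((subset_tsupport θ).trans hsupp))
      (hsupp.trans fun t ht => ⟨by linarith [ht.1], by linarith [ht.2]⟩) (fun t => by
        have n1 := Real.smoothTransition.nonneg ((t - a) / ε - 1)
        have n2 := Real.smoothTransition.nonneg ((b - t) / ε - 1)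
        have l1 := Real.smoothTransition.le_one ((t - a) / ε - 1)
        have l2 := Real.smoothTransition.le_one ((b - t) / ε - 1)
        rcases lt_or_ge t (a + 2 * ε) with h1 | h1
        · have := hsmall t h1
          simp only [hθ]
          rw [this]
          exact ⟨by linarith, by linarith⟩
        · have := hlarge t h1
          simp only [hθ]
          rw [this]
          exact ⟨by linarith, by linarith⟩)
    have p1 : ∀ t, deriv T ((t - a) / ε - 1) / ε * f t =
        ε⁻¹ * (fun u => deriv T u * f (a + ε * (1 + u))) ((t - a) / ε - 1) := by
      intro t
      have : a + ε * (1 + ((t - a) / ε - 1)) = t := by field_simp; ring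
      simp only [this]; ring
    have p2 : ∀ t, deriv T ((b - t) / ε - 1) / ε * f t =
        ε⁻¹ * (fun u => deriv T u * f (b + -ε * (1 + u))) ((b - t) / ε - 1) := by
      intro t
      have : b + -ε * (1 + ((b - t) / ε - 1)) = t := by field_simp; ring
      simp only [this]; ring
    have q1 : ∀ H : ℝ → ℝ, Integrable H → Integrable (fun t => ε⁻¹ * H ((t - a) / ε - 1)) ∧
        ∫ t, ε⁻¹ * H ((t - a) / ε - 1) = ∫ u, H u := by
      intro H hH
      refine ⟨(((hH.comp_sub_right 1).comp_div hε.ne').comp_sub_right a).const_mul _, ?_⟩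
      rw [integral_const_mul, integral_sub_right_eq_self (fun t => H (t / ε - 1)),
        Measure.integral_comp_div (fun t => H (t - 1)), integral_sub_right_eq_self H, abs_of_pos hε,
        smul_eq_mul, inv_mul_cancel_left₀ hε.ne']
    have q2 : ∀ H : ℝ → ℝ, Integrable H → Integrable (fun t => ε⁻¹ * H ((b - t) / ε - 1)) ∧
        ∫ t, ε⁻¹ * H ((b - t) / ε - 1) = ∫ u, H u := by
      intro H hH
      refine ⟨(((hH.comp_sub_right 1).comp_div hε.ne').comp_sub_left b).const_mul _, ?_⟩
      rw [integral_const_mul, integral_sub_left_eq_self (fun t => H (t / ε - 1)),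
        Measure.integral_comp_div (fun t => H (t - 1)), integral_sub_right_eq_self H, abs_of_pos hε,
        smul_eq_mul, inv_mul_cancel_left₀ hε.ne']
    obtain ⟨r1, r1'⟩ := q1 _ (hint a ε)
    obtain ⟨r2, r2'⟩ := q2 _ (hint b (-ε))
    have hfinal : ∫ t, deriv θ t * f t = G ε := by
      simp_rw [hd, sub_mul, p1, p2]
      rw [integral_sub r1 r2, r1', r2', ← integral_sub (hint a ε) (hint b (-ε)), hG]
      simp only
      rw [setIntegral_eq_integral_of_forall_compl_eq_zero]
      · refine integral_congr_ae (Eventually.of_forall fun u => ?_)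
        simp only
        rw [← mul_sub]; ring_nf
      · intro u hu
        rw [hT, deriv_smoothTransition_eq_zero hu, zero_mul]
    rwa [hfinal] at key
  have hlim : Tendsto (fun ε => |G ε|) (𝓝[>] 0) (𝓝 |f a - f b|) := by
    rw [← hG0]
    exact (hGc.abs.tendsto 0).mono_left nhdsWithin_le_nhds
  refine le_of_tendsto hlim ?_
  filter_upwards [Ioo_mem_nhdsGT (show (0 : ℝ) < (b - a) / 4 by linarith)] with ε hε
    using hbound ε hε.1 hε.2

/-- A smooth function of the squared opening of a cone, supported in openings below `1/4`. -/
def coneProfile (r : ℝ) : ℝ := Real.smoothTransition (2 - 32 * r)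

lemma contDiff_coneProfile : ContDiff ℝ ∞ coneProfile :=
  Real.smoothTransition.contDiff.comp (by fun_prop)

lemma coneProfile_nonneg (r : ℝ) : 0 ≤ coneProfile r := Real.smoothTransition.nonneg _

lemma coneProfile_le_one (r : ℝ) : coneProfile r ≤ 1 := Real.smoothTransition.le_one _

lemma coneProfile_eq_zero {r : ℝ} (hr : (1 / 4) ^ 2 ≤ r) : coneProfile r = 0 :=
  Real.smoothTransition.zero_of_nonpos (by linarith)

lemma coneProfile_zero : coneProfile 0 = 1 := Real.smoothTransition.one_of_one_le (by norm_num)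

/-- A density of degree `-(n + 1)` in the cone around the vertical axis. Its product with the
position vector is divergence free, being a radial field of degree `-n` in dimension `n + 1`. -/
def coneDensity {n : ℕ} (w : Eu (n + 1)) : ℝ :=
  coneProfile (‖horiz w‖ ^ 2 / vert w ^ 2) / (|vert w| ^ n * vert w)

lemma coneDensity_smul {n : ℕ} (w : Eu (n + 1)) {r : ℝ} (hr : 0 < r) :
    coneDensity (r • w) = (r ^ (n + 1))⁻¹ * coneDensity w := by
  rw [coneDensity, coneDensity, horiz_smul, vert_smul, norm_smul, Real.norm_eq_abs, abs_mul,
    abs_of_pos hr, mul_pow, mul_pow, mul_div_mul_left _ _ (by positivity : r ^ 2 ≠ 0), mul_pow,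
    show r ^ n * |vert w| ^ n * (r * vert w) = r ^ (n + 1) * (|vert w| ^ n * vert w) by ring,
    ← div_div, div_eq_inv_mul _ (r ^ (n + 1)), mul_div_assoc]

lemma contDiffAt_coneDensity {n : ℕ} {w : Eu (n + 1)} (hw : vert w ≠ 0) :
    ContDiffAt ℝ ∞ (coneDensity (n := n)) w := by
  have hv : ContDiffAt ℝ ∞ (vert : Eu (n + 1) → ℝ) w := contDiff_vert.contDiffAt
  have h1 : ContDiffAt ℝ ∞ (fun w : Eu (n + 1) => |vert w|) w := (contDiffAt_abs hw).comp w hv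
  have h2 : ContDiffAt ℝ ∞ (fun w : Eu (n + 1) => ‖horiz w‖ ^ 2) w :=
    ((contDiff_norm_sq ℝ).comp contDiff_horiz).contDiffAt
  have h3 := h2.div (hv.pow 2) (pow_ne_zero 2 hw)
  exact ((contDiff_coneProfile.contDiffAt.comp w h3).div ((h1.pow n).mul hv)
    (mul_ne_zero (pow_ne_zero _ (abs_ne_zero.2 hw)) hw))

lemma coneDensity_eq_zero {n : ℕ} {w : Eu (n + 1)} (hw : |vert w| / 4 < ‖horiz w‖) :
    coneDensity w = 0 := by
  rcases eq_or_ne (vert w) 0 with h | h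
  · simp [coneDensity, h]
  · rw [coneDensity, coneProfile_eq_zero, zero_div]
    have := abs_pos.2 h
    rw [← sq_abs (vert w), ← div_pow]
    refine pow_le_pow_left₀ (by norm_num) ?_ 2
    rw [le_div_iff₀ this]
    linarith

lemma abs_coneDensity_le {n : ℕ} {w : Eu (n + 1)} (hw : vert w ≠ 0) :
    |coneDensity w| ≤ (|vert w| ^ (n + 1))⁻¹ := by
  rw [coneDensity, abs_div, abs_mul, abs_pow, abs_abs, ← pow_succ,
    abs_of_nonneg (coneProfile_nonneg _), div_eq_mul_inv]
  exact mul_le_of_le_one_left (by positivity) (coneProfile_le_one _)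

/-- The cut-off densities that serve as test functions: `b` is the horizontal position of the vertex
and `θ` is a window in the vertical variable. -/
def coneTest {n : ℕ} (b : Eu n) (θ : ℝ → ℝ) (y : Eu (n + 1)) : ℝ :=
  coneDensity (y - join 0 b) * θ (vert y)

lemma vert_sub_join {n : ℕ} (b : Eu n) (y : Eu (n + 1)) : vert (y - join 0 b) = vert y := by
  rw [vert_sub, vert_join, sub_zero]

lemma horiz_sub_join {n : ℕ} (b : Eu n) (y : Eu (n + 1)) :
    horiz (y - join 0 b) = horiz y - b := by
  rw [horiz_sub, horiz_join]

lemma coneTest_eventuallyEq_zero {n : ℕ} (b : Eu n) {θ : ℝ → ℝ} {y : Eu (n + 1)}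
    (hy : vert y ∉ tsupport θ) : coneTest b θ =ᶠ[𝓝 y] fun _ => 0 := by
  have := continuous_vert.continuousAt.eventually (notMem_tsupport_iff_eventuallyEq.1 hy)
  filter_upwards [this] with z hz
  rw [coneTest, hz]; simp

lemma contDiff_coneTest {n : ℕ} (b : Eu n) {θ : ℝ → ℝ} (hθ : ContDiff ℝ ∞ θ)
    (h0 : (0 : ℝ) ∉ tsupport θ) : ContDiff ℝ ∞ (coneTest b θ) := by
  refine contDiff_iff_contDiffAt.2 fun y => ?_
  by_cases hy : vert y ∈ tsupport θ
  · have hv : vert (y - join 0 b) ≠ 0 := by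
      rw [vert_sub_join]; rintro h; exact h0 (h ▸ hy)
    exact ((contDiffAt_coneDensity hv).comp y (contDiffAt_id.sub contDiffAt_const)).mul
      (hθ.comp contDiff_vert).contDiffAt
  · exact contDiffAt_const.congr_of_eventuallyEq (coneTest_eventuallyEq_zero b hy)

lemma tsupport_coneTest_subset {n : ℕ} (b : Eu n) (θ : ℝ → ℝ) :
    tsupport (coneTest b θ) ⊆ {y | vert y ∈ tsupport θ ∧ ‖horiz y - b‖ ≤ |vert y| / 4} := by
  have hcl : IsClosed {y : Eu (n + 1) | vert y ∈ tsupport θ ∧ ‖horiz y - b‖ ≤ |vert y| / 4} :=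
    ((isClosed_tsupport θ).preimage continuous_vert).inter
      (isClosed_le (continuous_horiz.sub continuous_const).norm (continuous_vert.abs.div_const 4))
  refine closure_minimal (fun y hy => ⟨subset_tsupport θ fun h => hy ?_, ?_⟩) hcl
  · rw [coneTest, h, mul_zero]
  · by_contra hcon
    push Not at hcon
    refine hy ?_
    rw [coneTest, coneDensity_eq_zero (by rwa [vert_sub_join, horiz_sub_join]), zero_mul]

lemma isTestFunction_coneTest {n : ℕ} (b : Eu n) {θ : ℝ → ℝ} (hθ : ContDiff ℝ ∞ θ)
    (hθ1 : tsupport θ ⊆ {t | t ≠ 0 ∧ |t| < 1}) {U : Set (Eu (n + 1))}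
    (hU : ∀ y : Eu (n + 1), vert y ≠ 0 → |vert y| < 1 → ‖horiz y - b‖ ≤ |vert y| / 4 → y ∈ U) :
    IsTestFunction U (coneTest b θ) := by
  have hsub := tsupport_coneTest_subset b θ
  refine ⟨contDiff_coneTest b hθ fun h => (hθ1 h).1 rfl, ?_, fun y hy => ?_⟩
  · refine (isCompact_closedBall (0 : Eu (n + 1)) (‖b‖ + 1 / 4 + 1)).of_isClosed_subset
      (isClosed_tsupport _) fun y hy => ?_
    rw [mem_closedBall_zero_iff]
    obtain ⟨h1, h2⟩ := hsub hy
    have h3 := (hθ1 h1).2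
    have h4 : ‖horiz y‖ ≤ ‖b‖ + ‖horiz y - b‖ := by
      have := norm_add_le b (horiz y - b)
      rwa [add_sub_cancel] at this
    linarith [norm_le_horiz_add_vert y]
  · obtain ⟨h1, h2⟩ := hsub hy
    exact hU y (hθ1 h1).1 (hθ1 h1).2 h2

/-- Euler's identity for the homogeneous density: only the window is differentiated. -/
lemma fderiv_coneTest_radial {n : ℕ} (b : Eu n) {θ : ℝ → ℝ} (hθ : ContDiff ℝ ∞ θ)
    (h0 : (0 : ℝ) ∉ tsupport θ) (y : Eu (n + 1)) :
    fderiv ℝ (coneTest b θ) y (y - join 0 b) + ((n + 1 : ℕ) : ℝ) * coneTest b θ y =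
      coneDensity (y - join 0 b) * vert y * deriv θ (vert y) := by
  set w := y - join 0 b with hw
  have hvw : vert w = vert y := vert_sub_join b y
  have hline : HasDerivAt (fun r : ℝ => join 0 b + r • w) w 1 := by
    simpa using ((hasDerivAt_id (1 : ℝ)).smul_const w).const_add (join 0 b)
  have hpt : join 0 b + (1 : ℝ) • w = y := by rw [one_smul, hw]; abel
  have hL : HasDerivAt (fun r : ℝ => coneTest b θ (join 0 b + r • w))
      (fderiv ℝ (coneTest b θ) y w) 1 := by
    have h1 : HasFDerivAt (coneTest b θ) (fderiv ℝ (coneTest b θ) y) (join 0 b + (1 : ℝ) • w) := by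
      rw [hpt]
      exact ((contDiff_coneTest b hθ h0).differentiable (by norm_num) y).hasFDerivAt
    exact h1.comp_hasDerivAt 1 hline
  have hR : HasDerivAt (fun r : ℝ => (r ^ (n + 1))⁻¹ * coneDensity w * θ (r * vert y))
      (-((n + 1 : ℕ) : ℝ) * coneDensity w * θ (vert y) + coneDensity w * (deriv θ (vert y) * vert y))
      1 := by
    have a1 : HasDerivAt (fun r : ℝ => (r ^ (n + 1))⁻¹) (-((n + 1 : ℕ) : ℝ)) 1 := by
      refine HasDerivAt.congr_deriv (f := fun r : ℝ => (r ^ (n + 1))⁻¹)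
        ((hasDerivAt_pow (n + 1) (1 : ℝ)).inv (by simp)) ?_
      simp
    have a2 : HasDerivAt (fun r : ℝ => θ (r * vert y)) (deriv θ (vert y) * vert y) 1 := by
      have h1 : HasDerivAt (fun r : ℝ => r * vert y) (vert y) 1 := by
        simpa using (hasDerivAt_id (1 : ℝ)).mul_const (vert y)
      have h2 : HasDerivAt θ (deriv θ (vert y)) (1 * vert y) := by
        rw [one_mul]; exact (hθ.differentiable (by norm_num) _).hasDerivAt
      exact h2.comp 1 h1
    refine HasDerivAt.congr_deriv
      (f := fun r : ℝ => (r ^ (n + 1))⁻¹ * coneDensity w * θ (r * vert y))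
      ((a1.mul_const (coneDensity w)).mul a2) ?_
    simp
  have heq : (fun r : ℝ => coneTest b θ (join 0 b + r • w)) =ᶠ[𝓝 1]
      fun r : ℝ => (r ^ (n + 1))⁻¹ * coneDensity w * θ (r * vert y) := by
    filter_upwards [Ioi_mem_nhds (zero_lt_one' ℝ)] with r hr
    have h1 : vert (join 0 b + r • w) = r * vert y := by
      have := (vertL n).map_add (join 0 b) (r • w)
      simp only [vertL_apply] at this
      rw [this, vert_join, vert_smul, hvw, zero_add]
    rw [coneTest, h1, add_sub_cancel_left, coneDensity_smul w hr]
  have := hL.unique (hR.congr_of_eventuallyEq heq)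
  rw [this, coneTest, ← hw]
  push_cast
  ring

/-- The weighted mean, not normalized, of `v` over the horizontal section at height `t` of the cone
with vertex `(b, 0)`. It is continuous across the vertex `t = 0` if `v` is continuous. -/
def coneMean {n : ℕ} (b : Eu n) (v : Eu (n + 1) → ℝ) (t : ℝ) : ℝ :=
  ∫ z in Metric.closedBall (0 : Eu n) 1, coneProfile (‖z‖ ^ 2) * v (join t (b + t • z))

lemma continuous_coneMean {n : ℕ} (b : Eu n) {v : Eu (n + 1) → ℝ} (hv : Continuous v) :
    Continuous (coneMean b v) := by
  refine continuous_parametric_integral_of_continuous ?_ (isCompact_closedBall _ _)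
  simp only [Function.uncurry_def]
  refine (contDiff_coneProfile.continuous.comp (by fun_prop)).mul (hv.comp ?_)
  exact continuous_join.comp (by fun_prop : Continuous fun p : ℝ × Eu n => (p.1, b + p.1 • p.2))

lemma coneProfile_norm_sq_eq_zero {n : ℕ} {z : Eu n} (hz : 1 / 4 ≤ ‖z‖) :
    coneProfile (‖z‖ ^ 2) = 0 :=
  coneProfile_eq_zero (pow_le_pow_left₀ (by norm_num) hz 2)

lemma coneMean_eq_integral {n : ℕ} (b : Eu n) (v : Eu (n + 1) → ℝ) (t : ℝ) :
    coneMean b v t = ∫ z, coneProfile (‖z‖ ^ 2) * v (join t (b + t • z)) := by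
  refine setIntegral_eq_integral_of_forall_compl_eq_zero fun z hz => ?_
  rw [mem_closedBall_zero_iff, not_le] at hz
  rw [coneProfile_norm_sq_eq_zero (by linarith), zero_mul]

/-- The total weight in `coneMean`. -/
def coneMass (n : ℕ) : ℝ := ∫ z : Eu n, coneProfile (‖z‖ ^ 2)

lemma coneMass_pos (n : ℕ) : 0 < coneMass n := by
  have hc : Continuous fun z : Eu n => coneProfile (‖z‖ ^ 2) :=
    contDiff_coneProfile.continuous.comp (by fun_prop)
  refine hc.integral_pos_of_hasCompactSupport_nonneg_nonzero (x := 0)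
    (HasCompactSupport.intro (isCompact_closedBall (0 : Eu n) 1) fun z hz => ?_)
    (fun z => coneProfile_nonneg _) ?_
  · rw [mem_closedBall_zero_iff, not_le] at hz
    exact coneProfile_norm_sq_eq_zero (by linarith)
  · simp [coneProfile_zero]

/-- Scaling the section of a cone at height `t` to the unit section. -/
lemma integral_section_eq_coneMean {n : ℕ} (b : Eu n) (v : Eu (n + 1) → ℝ) {t : ℝ} (ht : t ≠ 0) :
    ∫ z, v (join t z) * (coneDensity (join t z - join 0 b) * t) = coneMean b v t := by
  have ht' : 0 < |t| := abs_pos.2 ht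
  set F : Eu n → ℝ := fun z => coneProfile (‖z‖ ^ 2 / t ^ 2) * v (join t (b + z)) with hF
  have h1 : ∀ z, v (join t z) * (coneDensity (join t z - join 0 b) * t) =
      (|t| ^ n)⁻¹ * F (z - b) := by
    intro z
    rw [coneDensity, vert_sub_join, horiz_sub_join, vert_join, horiz_join, hF]
    simp only [add_sub_cancel]
    field_simp
  have h2 : ∀ z, coneProfile (‖z‖ ^ 2) * v (join t (b + t • z)) = F (t • z) := by
    intro z
    have h3 : ‖t • z‖ ^ 2 / t ^ 2 = ‖z‖ ^ 2 := by
      rw [norm_smul, Real.norm_eq_abs, mul_pow, sq_abs, mul_div_cancel_left₀ _ (pow_ne_zero 2 ht)]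
    simp only [hF, h3]
  rw [coneMean_eq_integral]
  simp_rw [h1, h2]
  rw [integral_const_mul, integral_sub_right_eq_self F, Measure.integral_comp_smul]
  simp [abs_inv, abs_pow]

lemma integral_split {n : ℕ} {f : Eu (n + 1) → ℝ} (hf : Integrable f) :
    ∫ x, f x = ∫ t : ℝ, ∫ z : Eu n, f (join t z) := by
  have mp := measurePreserving_splitEquiv n
  have e : ∀ x, f x = (fun p : ℝ × Eu n => f (join p.1 p.2)) (splitEquiv n x) := by
    intro x
    change f x = f (join (vert x) (horiz x))
    rw [join_vert_horiz]
  have hi : Integrable (fun p : ℝ × Eu n => f (join p.1 p.2))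
      ((volume : Measure ℝ).prod (volume : Measure (Eu n))) := by
    rw [← mp.integrable_comp_emb (splitEquiv n).measurableEmbedding]
    exact hf.congr (Eventually.of_forall e)
  rw [← integral_prod _ hi, ← mp.integral_comp' (fun p : ℝ × Eu n => f (join p.1 p.2))]
  exact integral_congr_ae (Eventually.of_forall e)

/-- The vertical double cone of height `1` with vertex `(b, 0)`, the section through the vertex
removed. -/
def doubleCone {n : ℕ} (b : Eu n) : Set (Eu (n + 1)) :=
  {y | vert y ≠ 0 ∧ |vert y| < 1 ∧ ‖horiz y - b‖ ≤ |vert y| / 4}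

lemma measurableSet_doubleCone {n : ℕ} (b : Eu n) : MeasurableSet (doubleCone b) := by
  have hv : Measurable (vert : Eu (n + 1) → ℝ) := continuous_vert.measurable
  have hh : Measurable (horiz : Eu (n + 1) → Eu n) := continuous_horiz.measurable
  exact ((measurableSet_eq_fun hv measurable_const).compl).inter
    ((measurableSet_lt hv.abs measurable_const).inter
      (measurableSet_le (hh.sub_const b).norm (hv.abs.div_const 4)))

/-- The distributional derivative of the means over the sections of a cone, as a weighted integral of
the radial component of the gradient over the cone. -/
lemma integral_deriv_mul_coneMean {n : ℕ} {v : Eu (n + 1) → ℝ} (hv : Continuous v)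
    {U : Set (Eu (n + 1))} {g : Eu (n + 1) → Eu (n + 1)} (h : HasWeakGradientOn U v g) {b : Eu n}
    (hU : doubleCone b ⊆ U) {θ : ℝ → ℝ} (hθ : ContDiff ℝ ∞ θ)
    (hθ1 : tsupport θ ⊆ {t | t ≠ 0 ∧ |t| < 1}) :
    ∫ t, deriv θ t * coneMean b v t =
      -∫ y in U, coneTest b θ y * inner ℝ (g y) (y - join 0 b) := by
  have h0 : (0 : ℝ) ∉ tsupport θ := fun h => (hθ1 h).1 rfl
  have hθ0 : deriv θ 0 = 0 := by
    rw [(notMem_tsupport_iff_eventuallyEq.1 h0).deriv_eq]; simp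
  have htest : IsTestFunction U (coneTest b θ) :=
    isTestFunction_coneTest b hθ hθ1 fun y h1 h2 h3 => hU ⟨h1, h2, h3⟩
  rw [← h.integral_radial htest (join 0 b)]
  have hcont : Continuous fun y => v y * (fderiv ℝ (coneTest b θ) y (y - join 0 b) +
      ((n + 1 : ℕ) : ℝ) * coneTest b θ y) := by
    refine hv.mul (((htest.1.continuous_fderiv (by norm_num)).clm_apply (by fun_prop)).add
      (continuous_const.mul htest.1.continuous))
  have hzero : ∀ y, y ∉ tsupport (coneTest b θ) →
      v y * (fderiv ℝ (coneTest b θ) y (y - join 0 b) +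
        ((n + 1 : ℕ) : ℝ) * coneTest b θ y) = 0 := by
    intro y hy
    have : fderiv ℝ (coneTest b θ) y = 0 := by
      by_contra hne
      exact hy (support_fderiv_subset ℝ hne)
    rw [this, image_eq_zero_of_notMem_tsupport hy]
    simp
  rw [setIntegral_eq_integral_of_forall_compl_eq_zero fun y hy =>
    hzero y fun hmem => hy (htest.2.2 hmem)]
  rw [integral_split (hcont.integrable_of_hasCompactSupport
    (HasCompactSupport.intro htest.2.1 hzero))]
  refine integral_congr_ae (Eventually.of_forall fun t => ?_)
  simp only
  simp_rw [fderiv_coneTest_radial b hθ h0, vert_join]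
  rcases eq_or_ne t 0 with rfl | ht
  · simp [hθ0]
  · rw [← integral_section_eq_coneMean b v ht, ← integral_const_mul]
    refine integral_congr_ae (Eventually.of_forall fun z => ?_)
    simp only
    ring

lemma enorm_integral_deriv_mul_coneMean_le {n : ℕ} {v : Eu (n + 1) → ℝ} (hv : Continuous v)
    {U : Set (Eu (n + 1))} {g : Eu (n + 1) → Eu (n + 1)} (h : HasWeakGradientOn U v g) {b : Eu n}
    (hU : doubleCone b ⊆ U) {θ : ℝ → ℝ} (hθ : ContDiff ℝ ∞ θ)
    (hθ1 : tsupport θ ⊆ {t | t ≠ 0 ∧ |t| < 1}) (hθ2 : ∀ t, 0 ≤ θ t ∧ θ t ≤ 1) :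
    ‖∫ t, deriv θ t * coneMean b v t‖ₑ ≤
      2 * ∫⁻ y in doubleCone b, ‖g y‖ₑ * ENNReal.ofReal (|vert y| ^ (-(n : ℝ))) := by
  rw [integral_deriv_mul_coneMean hv h hU hθ hθ1, enorm_neg]
  refine (enorm_integral_le_lintegral_enorm _).trans ?_
  refine (setLIntegral_le_lintegral _ _).trans ?_
  rw [← lintegral_const_mul' _ _ (by norm_num), ← lintegral_indicator (measurableSet_doubleCone b)]
  refine lintegral_mono fun y => ?_
  by_cases hy : y ∈ doubleCone b
  · rw [Set.indicator_of_mem hy]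
    obtain ⟨h1, h2, h3⟩ := hy
    have hpos := abs_pos.2 h1
    have e2 : ∀ c : ℝ, 2 * ENNReal.ofReal c = ENNReal.ofReal (2 * c) := fun c => by
      rw [ENNReal.ofReal_mul (by norm_num)]; simp
    rw [← ofReal_norm, ← ofReal_norm, ← ENNReal.ofReal_mul (norm_nonneg _), e2]
    refine ENNReal.ofReal_le_ofReal ?_
    have hd := abs_coneDensity_le (w := y - join 0 b) (by rwa [vert_sub_join])
    rw [vert_sub_join] at hd
    have hn : ‖y - join 0 b‖ ≤ 2 * |vert y| := by
      refine (norm_le_horiz_add_vert _).trans ?_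
      rw [vert_sub_join, horiz_sub_join]
      linarith
    have hθa : |θ (vert y)| ≤ 1 := abs_le.2 ⟨by linarith [(hθ2 (vert y)).1], (hθ2 (vert y)).2⟩
    rw [coneTest, norm_mul, norm_mul, Real.norm_eq_abs, Real.norm_eq_abs]
    calc _ ≤ (|vert y| ^ (n + 1))⁻¹ * 1 * (‖g y‖ * (2 * |vert y|)) := by
          refine mul_le_mul (mul_le_mul hd hθa (abs_nonneg _) (by positivity)) ?_ (norm_nonneg _)
            (by positivity)
          exact (norm_inner_le_norm _ _).trans (mul_le_mul_of_nonneg_left hn (norm_nonneg _))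
      _ = 2 * (‖g y‖ * |vert y| ^ (-(n : ℝ))) := by
          rw [Real.rpow_neg hpos.le, Real.rpow_natCast]
          field_simp
          ring
  · rw [Set.indicator_of_notMem hy]
    have : coneTest b θ y = 0 := by
      by_contra hne
      obtain ⟨h1, h2⟩ := tsupport_coneTest_subset b θ (subset_tsupport _ hne)
      exact hy ⟨(hθ1 h1).1, (hθ1 h1).2, h2⟩
    rw [this, zero_mul, enorm_zero]

/-- The change of the means of `v` between the two ends of a double cone is controlled by the
gradient in the cone. The continuity of `v` at the vertex is what allows to pass from one half
of the cone to the other. -/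
lemma coneMean_sub_le {n : ℕ} {v : Eu (n + 1) → ℝ} (hv : Continuous v)
    {U : Set (Eu (n + 1))} {g : Eu (n + 1) → Eu (n + 1)} (h : HasWeakGradientOn U v g) {b : Eu n}
    (hU : doubleCone b ⊆ U) :
    ENNReal.ofReal (coneMean b v 1 - coneMean b v (-1)) ≤
      4 * ∫⁻ y in doubleCone b, ‖g y‖ₑ * ENNReal.ofReal (|vert y| ^ (-(n : ℝ))) := by
  set I := ∫⁻ y in doubleCone b, ‖g y‖ₑ * ENNReal.ofReal (|vert y| ^ (-(n : ℝ))) with hI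
  rcases eq_or_ne I ⊤ with hT | hT
  · rw [hT]; simp
  have h2I : 2 * I ≠ ⊤ := ENNReal.mul_ne_top (by norm_num) hT
  have half : ∀ a b' : ℝ, a < b' → Set.Ioo a b' ⊆ {t : ℝ | t ≠ 0 ∧ |t| < 1} →
      |coneMean b v a - coneMean b v b'| ≤ (2 * I).toReal := by
    intro a b' hab hsub
    refine abs_sub_le_of_forall_test (continuous_coneMean b hv) hab fun θ h1 _ h3 h4 => ?_
    have := enorm_integral_deriv_mul_coneMean_le hv h hU h1 (h3.trans hsub) h4
    rw [← Real.norm_eq_abs, ← toReal_enorm]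
    exact ENNReal.toReal_mono h2I this
  have a1 := half 0 1 zero_lt_one fun t ht => ⟨ht.1.ne', abs_lt.2 ⟨by linarith [ht.1], ht.2⟩⟩
  have a2 := half (-1) 0 (by norm_num) fun t ht => ⟨ht.2.ne, abs_lt.2 ⟨ht.1, by linarith [ht.2]⟩⟩
  refine ENNReal.ofReal_le_of_le_toReal ?_
  rw [show (4 : ℝ≥0∞) * I = 2 * (2 * I) by rw [← mul_assoc]; norm_num, ENNReal.toReal_mul]
  simp only [ENNReal.toReal_ofNat]
  linarith [(abs_le.1 a1).1, (abs_le.1 a2).1, (abs_le.1 a1).2, (abs_le.1 a2).2]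

/-! ### The product Cantor measure and the lower bound in the subcritical case -/

/-- The product Cantor measure. -/
def cantorProdMeasure (n : ℕ) (l : ℝ) : Measure (Eu n) :=
  (Measure.pi fun _ : Fin n => cantorMeasure l).map (WithLp.toLp 2)

lemma measurable_toLp (n : ℕ) : Measurable (WithLp.toLp 2 : (Fin n → ℝ) → Eu n) :=
  (PiLp.continuous_toLp 2 _).measurable

lemma isProbabilityMeasure_cantorProdMeasure (n : ℕ) {l : ℝ} (h0 : 0 < l) (h1 : l < 1 / 2) :
    IsProbabilityMeasure (cantorProdMeasure n l) := by
  have := isProbabilityMeasure_cantorMeasure h0 h1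
  exact Measure.isProbabilityMeasure_map (measurable_toLp n).aemeasurable

lemma ae_mem_cantorProd (n : ℕ) {l : ℝ} (h0 : 0 < l) (h1 : l < 1 / 2) :
    ∀ᵐ z ∂cantorProdMeasure n l, z ∈ cantorProd n l := by
  have := isProbabilityMeasure_cantorMeasure h0 h1
  rw [cantorProdMeasure, ae_map_iff (p := fun z => z ∈ cantorProd n l)
    (measurable_toLp n).aemeasurable (isClosed_cantorProd n l).measurableSet]
  change ∀ᵐ z : Fin n → ℝ ∂(Measure.pi fun _ : Fin n => cantorMeasure l), ∀ i, z i ∈ cantor l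
  rw [ae_all_iff]
  intro i
  exact (Measure.quasiMeasurePreserving_eval (μ := fun _ : Fin n => cantorMeasure l) i).ae
    (ae_mem_cantor h0 h1)

lemma exists_cantorProdMeasure_ball_le (n : ℕ) {l : ℝ} (h0 : 0 < l) (h1 : l < 1 / 2) :
    ∃ A : ℝ, 0 ≤ A ∧ ∀ (y : Eu n) (r : ℝ), 0 < r →
      cantorProdMeasure n l {z | ‖y - z‖ ≤ r} ≤ ENNReal.ofReal (A * r ^ cantorDim n l) := by
  have := isProbabilityMeasure_cantorMeasure h0 h1
  obtain ⟨A, hA, h⟩ := exists_cantorMeasure_ball_le h0 h1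
  refine ⟨(A * 2 ^ cantorExp l) ^ n, by positivity, fun y r hr => ?_⟩
  have hm : MeasurableSet {z : Eu n | ‖y - z‖ ≤ r} :=
    (isClosed_le (by fun_prop) continuous_const).measurableSet
  rw [cantorProdMeasure, Measure.map_apply (measurable_toLp n) hm]
  calc _ ≤ (Measure.pi fun _ : Fin n => cantorMeasure l)
        (Set.univ.pi fun i => {t | |t - y i| < 2 * r}) := by
        refine measure_mono fun z hz i _ => ?_
        have h2 : ‖y - WithLp.toLp 2 z‖ ≤ r := hz
        have h3 : |y i - z i| ≤ r := (abs_coord_le (y - WithLp.toLp 2 z) i).trans h2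
        rw [abs_sub_comm] at h3
        exact lt_of_le_of_lt h3 (by linarith)
    _ = ∏ i, cantorMeasure l {t | |t - y i| < 2 * r} := Measure.pi_pi _ _
    _ ≤ ∏ _i : Fin n, ENNReal.ofReal (A * (2 * r) ^ cantorExp l) :=
        Finset.prod_le_prod' fun i _ => h _ _ (by positivity)
    _ = _ := by
        rw [Finset.prod_const, Finset.card_univ, Fintype.card_fin,
          ← ENNReal.ofReal_pow (by positivity), Real.mul_rpow (by norm_num) hr.le, ← mul_assoc,
          mul_pow, ← Real.rpow_natCast (r ^ _), ← Real.rpow_mul hr.le, cantorDim_eq]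
        congr 3; ring

/-- The union of the double cones with vertices in the barrier. -/
def latCone (n : ℕ) (l : ℝ) : Set (Eu (n + 1)) :=
  {y | y ∈ box (n + 1) 1 ∧ vert y ≠ 0 ∧ latDist n l y ≤ |vert y| / 4}

lemma measurableSet_latCone (n : ℕ) (l : ℝ) : MeasurableSet (latCone n l) :=
  (isOpen_box _ _).measurableSet.inter
    ((measurableSet_eq_fun continuous_vert.measurable measurable_const).compl.inter
      (measurableSet_le (continuous_latDist n l).measurable
        (continuous_vert.measurable.abs.div_const 4)))

lemma abs_le_half_of_mem_cantorProd {n : ℕ} {l : ℝ} {b : Eu n} (hb : b ∈ cantorProd n l)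
    (i : Fin n) : |b i| ≤ 1 / 2 := abs_le.2 (cantor_subset l (hb i))

lemma doubleCone_subset_latCone {n : ℕ} {l : ℝ} {b : Eu n} (hb : b ∈ cantorProd n l) :
    doubleCone b ⊆ latCone n l := by
  rintro y ⟨h1, h2, h3⟩
  refine ⟨fun i => ?_, h1, ?_⟩
  · refine Fin.lastCases h2 (fun j => ?_) i
    have a1 := abs_le_half_of_mem_cantorProd hb j
    have a2 : |(horiz y) j - b j| ≤ |vert y| / 4 := (abs_coord_le (horiz y - b) j).trans h3
    have a3 : |(horiz y) j| ≤ |b j| + |(horiz y) j - b j| := by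
      have := abs_add_le (b j) ((horiz y) j - b j)
      rwa [add_sub_cancel] at this
    change |(horiz y) j| < 1
    linarith
  · refine (Metric.infDist_le_dist_of_mem hb).trans ?_
    rwa [dist_eq_norm]

lemma latWeight_of_mem_latCone {n : ℕ} {l α : ℝ} {χ : Eu (n + 1) → ℝ} (hχ : IsBoxCutoff 2 3 χ)
    {y : Eu (n + 1)} (hy : y ∈ latCone n l) : χ y * latWeight n l α y = |vert y| ^ α := by
  have h := (isConeCutoff_latDist n l (κ := 1 / 2) (κ' := 2) (by norm_num) (by norm_num)).2.2.1 y
    (by linarith [hy.2.2, abs_nonneg (vert y)])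
  rw [latWeight, h, hχ.2.2.1 y (box_subset_box (by norm_num) hy.1)]
  ring

/-- The boundary values at the two ends of a double cone. -/
lemma coneMean_boundary {n : ℕ} {l : ℝ} {χ v : Eu (n + 1) → ℝ} (hχ : IsBoxCutoff 2 3 χ)
    (hv : ∀ x, x ∉ box (n + 1) 1 → v x = latBarrier n l x * χ x) {b : Eu n}
    (hb : b ∈ cantorProd n l) {t : ℝ} (ht : |t| = 1) :
    coneMean b v t = 1 / 2 * Real.sign t * coneMass n := by
  rw [coneMean_eq_integral, coneMass, ← integral_const_mul]
  refine integral_congr_ae (Eventually.of_forall fun z => ?_)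
  simp only
  by_cases hz : 1 / 4 ≤ ‖z‖
  · rw [coneProfile_norm_sq_eq_zero hz]; ring
  push Not at hz
  set y : Eu (n + 1) := join t (b + t • z) with hy
  have hvy : vert y = t := vert_join _ _
  have hhy : horiz y = b + t • z := horiz_join _ _
  have hnt : ‖t • z‖ ≤ 1 / 4 := by rw [norm_smul, Real.norm_eq_abs, ht, one_mul]; exact hz.le
  have hout : y ∉ box (n + 1) 1 := by
    intro hmem
    have h1 : |vert y| < 1 := hmem (Fin.last n)
    rw [hvy, ht] at h1
    exact lt_irrefl _ h1
  have hin : y ∈ box (n + 1) 2 := by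
    intro i
    refine Fin.lastCases ?_ (fun j => ?_) i
    · change |vert y| < 2
      rw [hvy, ht]; norm_num
    · change |(horiz y) j| < 2
      rw [hhy]
      have a1 := abs_le_half_of_mem_cantorProd hb j
      have a2 := (abs_coord_le (t • z) j).trans hnt
      exact (abs_add_le (b j) ((t • z) j)).trans_lt (by linarith)
  have hd : latDist n l y ≤ 2 * |vert y| := by
    refine (Metric.infDist_le_dist_of_mem hb).trans ?_
    rw [dist_eq_norm, hhy, add_sub_cancel_left, hvy, ht]
    linarith
  have hρ := (isConeCutoff_latDist n l (κ := 2) (κ' := 4) (by norm_num) (by norm_num)).2.2.1 y hd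
  rw [hv y hout, latBarrier, hρ, hχ.2.2.1 y hin, hvy]
  ring

/-- A continuous function with the boundary values of the barrier function has to change by a fixed
amount along each double cone with vertex in the barrier. Averaging the bounds `coneMean_sub_le` over
the vertices with respect to the Cantor measure turns the kernel `|x_d| ^ (-n)` into
`|x_d| ^ (D - n)`, where `D` is the dimension of the barrier. -/
lemma exists_lower_bound_latWeight {n : ℕ} {q α l : ℝ} (hq : 1 < q) (hα : 0 < α) (h0 : 0 < l)
    (h1 : l < 1 / 2) (hcap : n + 1 - cantorDim n l + α < q) {χ : Eu (n + 1) → ℝ}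
    (hχ : IsBoxCutoff 2 3 χ) :
    ∃ c : ℝ≥0∞, 0 < c ∧ ∀ v ∈ {v : Eu (n + 1) → ℝ | Continuous v},
      (∀ x, x ∉ box (n + 1) 1 → v x = latBarrier n l x * χ x) →
      c ≤ localEnergy q (fun x => χ x * latWeight n l α x) v := by
  have hprob := isProbabilityMeasure_cantorProdMeasure n h0 h1
  obtain ⟨A, hA, hball⟩ := exists_cantorProdMeasure_ball_le n h0 h1
  obtain ⟨B, hB, hvol⟩ := exists_volume_latMax_lt_le n h0 h1
  have hD0 := cantorDim_nonneg n h0 h1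
  have hDn := cantorDim_le n h0 h1
  have hq0 : 0 < q := by linarith
  set S := latCone n l with hS
  set σ : ℝ := n - cantorDim n l with hσ
  have hSm : MeasurableSet S := measurableSet_latCone n l
  have habs : Measurable fun y : Eu (n + 1) => |vert y| := continuous_vert.measurable.abs
  have hSv : ∀ y ∈ S, 0 < |vert y| ∧ |vert y| ≤ 1 := fun y hy =>
    ⟨abs_pos.2 hy.2.1, (hy.1 (Fin.last n)).le⟩
  -- the exponent is admissible exactly because `q` exceeds the codimension plus `α`
  have hγ : (σ + α / q) * (q / (q - 1)) < n + 1 - cantorDim n l := by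
    rw [← mul_div_assoc, div_lt_iff₀ (by linarith)]
    have : (σ + α / q) * q = σ * q + α := by field_simp
    rw [this, hσ]
    nlinarith
  have hK : ∫⁻ x in S, ENNReal.ofReal (|vert x| ^ (-((σ + α / q) * (q / (q - 1))))) < ⊤ := by
    refine (lintegral_rpow_neg_le (κ := n + 1 - cantorDim n l)
      (A := ENNReal.ofReal (B * 2 ^ ((n : ℝ) + 1 - cantorDim n l))) habs
      ((ae_restrict_iff' hSm).2 (Eventually.of_forall hSv)) ?_ fun t ht ht1 => ?_).trans_lt
      (ENNReal.mul_lt_top ENNReal.ofReal_lt_top (layerConst_lt_top hγ))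
    · have : 0 ≤ σ := by rw [hσ]; linarith
      have : 0 < q - 1 := by linarith
      positivity
    · rw [Measure.restrict_apply (measurableSet_lt habs measurable_const)]
      refine (measure_mono fun y hy => ?_).trans ((hvol (2 * t) (by linarith) (by linarith)).trans
        (le_of_eq ?_))
      · have hy1 : |vert y| < 2 * t := hy.1
        have hy2 := hy.2.2.2
        exact max_lt (by linarith [abs_nonneg (vert y)]) hy1
      · rw [Real.mul_rpow (by norm_num) ht.le, ← ENNReal.ofReal_mul (by positivity), mul_assoc]
  have hc₀ : 0 < ENNReal.ofReal (coneMass n) / (4 * ENNReal.ofReal (A + 1)) :=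
    ENNReal.div_pos (by simpa using coneMass_pos n)
      (ENNReal.mul_ne_top (by norm_num) ENNReal.ofReal_ne_top)
  obtain ⟨c, hc, hlow⟩ := exists_lower_bound_of_integral (σ := σ) hq
    (a := fun x => χ x * latWeight n l α x) (h := fun y => |vert y|) hSm (fun y hy => hy.1) habs
    (fun y hy => ⟨(hSv y hy).1, (latWeight_of_mem_latCone hχ hy).ge⟩) hc₀ hK
  refine ⟨c, hc, fun v hv hbd => ?_⟩
  have hv : Continuous v := hv
  refine le_iInf₂ fun g hg => ?_
  set U := box (n + 1) 1 ∩ {x | 0 < χ x * latWeight n l α x} with hUdef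
  have hSU : S ⊆ U := fun y hy => ⟨hy.1, by
    rw [Set.mem_ofPred_eq, latWeight_of_mem_latCone hχ hy]
    exact Real.rpow_pos_of_pos (hSv y hy).1 _⟩
  have hgS : AEStronglyMeasurable g (volume.restrict S) :=
    hg.2.1.aestronglyMeasurable.mono_measure (Measure.restrict_mono hSU le_rfl)
  refine hlow g hgS ?_
  refine ENNReal.div_le_of_le_mul ?_
  set G : Eu (n + 1) → ℝ≥0∞ := fun y => ‖g y‖ₑ * ENNReal.ofReal (|vert y| ^ (-(n : ℝ))) with hG
  have hGm : AEMeasurable G (volume.restrict S) :=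
    hgS.enorm.mul (habs.pow_const _).ennreal_ofReal.aemeasurable
  -- the pairs `(b, y)` for which `y` lies in the double cone with vertex `(b, 0)`
  set T : Set (Eu n × Eu (n + 1)) := {p | ‖horiz p.2 - p.1‖ ≤ |vert p.2| / 4} with hT
  have hTm : MeasurableSet T := (isClosed_le
    ((continuous_horiz.comp continuous_snd).sub continuous_fst).norm
    ((continuous_vert.comp continuous_snd).abs.div_const 4)).measurableSet
  have hpt : ∀ b ∈ cantorProd n l, ENNReal.ofReal (coneMass n) ≤
      4 * ∫⁻ y in S, T.indicator (fun p => G p.2) (b, y) := by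
    intro b hb
    have h2 := doubleCone_subset_latCone hb
    have h3 := coneMean_sub_le hv hg (h2.trans hSU)
    rw [coneMean_boundary hχ hbd hb (by simp), coneMean_boundary hχ hbd hb (by simp),
      Real.sign_of_pos one_pos, Real.sign_of_neg (by norm_num)] at h3
    ring_nf at h3
    rw [mul_comm]
    refine h3.trans (mul_le_mul_left ?_ 4)
    rw [← lintegral_indicator (measurableSet_doubleCone b), ← lintegral_indicator hSm]
    refine lintegral_mono fun y => ?_
    by_cases hy : y ∈ doubleCone b
    · have hyT : (b, y) ∈ T := hy.2.2
      rw [Set.indicator_of_mem hy, Set.indicator_of_mem (h2 hy), Set.indicator_of_mem hyT]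
    · rw [Set.indicator_of_notMem hy]; exact zero_le
  calc ENNReal.ofReal (coneMass n)
      = ∫⁻ _b, ENNReal.ofReal (coneMass n) ∂cantorProdMeasure n l := by simp
    _ ≤ ∫⁻ b, (4 * ∫⁻ y in S, T.indicator (fun p => G p.2) (b, y)) ∂cantorProdMeasure n l := by
        refine lintegral_mono_ae ?_
        filter_upwards [ae_mem_cantorProd n h0 h1] with b hb using hpt b hb
    _ = 4 * ∫⁻ b, (∫⁻ y in S, T.indicator (fun p => G p.2) (b, y)) ∂cantorProdMeasure n l :=
        lintegral_const_mul' _ _ (by norm_num)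
    _ = 4 * ∫⁻ y in S, ∫⁻ b, T.indicator (fun p => G p.2) (b, y) ∂cantorProdMeasure n l := by
        rw [lintegral_lintegral_swap]
        exact (hGm.comp_snd.indicator hTm)
    _ ≤ 4 * ∫⁻ y in S, ENNReal.ofReal (A + 1) * (‖g y‖ₑ * ENNReal.ofReal (|vert y| ^ (-σ))) := by
        gcongr 1
        refine setLIntegral_mono' hSm fun y hy => ?_
        have hvy := (hSv y hy).1
        have e1 : ∀ b, T.indicator (fun p => G p.2) (b, y) =
            {z | ‖horiz y - z‖ ≤ |vert y| / 4}.indicator (fun _ => G y) b := fun b => rfl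
        simp_rw [e1]
        rw [lintegral_indicator_const
          (isClosed_le (by fun_prop) continuous_const).measurableSet, hG]
        calc _ ≤ ‖g y‖ₑ * ENNReal.ofReal (|vert y| ^ (-(n : ℝ))) *
              ENNReal.ofReal (A * (|vert y| / 4) ^ cantorDim n l) := by
              gcongr
              exact hball _ _ (by positivity)
          _ ≤ ‖g y‖ₑ * ENNReal.ofReal (|vert y| ^ (-(n : ℝ))) *
              ENNReal.ofReal ((A + 1) * |vert y| ^ cantorDim n l) := by
              gcongr <;> linarith
          _ = _ := by
              rw [mul_assoc, ← ENNReal.ofReal_mul (by positivity),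
                mul_left_comm (ENNReal.ofReal (A + 1)), ← ENNReal.ofReal_mul (by linarith)]
              congr 2
              rw [mul_left_comm, ← Real.rpow_add hvy, hσ]
              congr 2; ring
    _ = _ := by
        rw [lintegral_const_mul' _ _ ENNReal.ofReal_ne_top]
        ring

/-! ### The saddle function and the barrier in the supercritical case -/

lemma exists_lipschitz_smoothTransition :
    ∃ L : ℝ, 0 ≤ L ∧ ∀ a b, |Real.smoothTransition a - Real.smoothTransition b| ≤ L * |a - b| := by
  obtain ⟨L, hL⟩ := (HasCompactSupport.intro (isCompact_Icc (a := (0 : ℝ)) (b := 1))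
    fun u hu => deriv_smoothTransition_eq_zero hu).exists_bound_of_continuous
      continuous_deriv_smoothTransition
  refine ⟨L, (norm_nonneg _).trans (hL 0), fun a b => ?_⟩
  exact Convex.norm_image_sub_le_of_norm_deriv_le (s := Set.univ)
    (fun x _ => differentiable_smoothTransition x) (fun x _ => hL x) convex_univ trivial trivial

lemma smoothTransition_half : Real.smoothTransition (1 / 2) = 1 / 2 := by
  have h : 0 < expNegInvGlue (1 / 2) := expNegInvGlue.pos_of_pos (by norm_num)
  rw [Real.smoothTransition, show (1 : ℝ) - 1 / 2 = 1 / 2 by norm_num]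
  field_simp
  norm_num

/-- The saddle function: a smooth function of the angle to the vertical axis. The argument of the
transition is at most `0` or at least `1` for angles with `|x_d| / |x| ≥ 1/4`, which covers the cone
`{|x̄| ≤ 2 |x_d|}`; its value at `0` is `0`. -/
def saddle {n : ℕ} (x : Eu (n + 1)) : ℝ := Real.smoothTransition (2 * (vert x / ‖x‖) + 1 / 2) - 1 / 2

lemma abs_saddle_le {n : ℕ} (x : Eu (n + 1)) : |saddle x| ≤ 1 / 2 := by
  have h1 := Real.smoothTransition.nonneg (2 * (vert x / ‖x‖) + 1 / 2)
  have h2 := Real.smoothTransition.le_one (2 * (vert x / ‖x‖) + 1 / 2)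
  rw [saddle, abs_le]
  constructor <;> linarith

lemma contDiffAt_saddle {n : ℕ} {x : Eu (n + 1)} (hx : x ≠ 0) : ContDiffAt ℝ ∞ (saddle (n := n)) x := by
  have h1 : ContDiffAt ℝ ∞ (fun x : Eu (n + 1) => vert x / ‖x‖) x :=
    contDiff_vert.contDiffAt.div (contDiffAt_norm ℝ hx) (norm_ne_zero_iff.2 hx)
  exact (Real.smoothTransition.contDiff.contDiffAt.comp x
    ((contDiffAt_const.mul h1).add contDiffAt_const)).sub contDiffAt_const

lemma measurable_saddle {n : ℕ} : Measurable (saddle (n := n)) := by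
  have hv : Measurable (vert : Eu (n + 1) → ℝ) := continuous_vert.measurable
  exact (Real.smoothTransition.continuous.measurable.comp
    (((hv.div measurable_norm).const_mul 2).add_const _)).sub_const _

lemma saddle_of_cone {n : ℕ} {x : Eu (n + 1)} (hx : ‖horiz x‖ ≤ 2 * |vert x|) :
    saddle x = 1 / 2 * Real.sign (vert x) := by
  have hn : ‖x‖ ≤ 3 * |vert x| := (norm_le_horiz_add_vert x).trans (by linarith)
  have hnv := abs_vert_le x
  rcases lt_trichotomy (vert x) 0 with h | h | h
  · rw [abs_of_neg h] at hn hnv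
    have hpos : 0 < ‖x‖ := by linarith
    have h1 : vert x / ‖x‖ ≤ -(1 / 3) := by rw [div_le_iff₀ hpos]; linarith
    rw [saddle, Real.smoothTransition.zero_of_nonpos (by linarith), Real.sign_of_neg h]
    norm_num
  · rw [saddle, h, Real.sign_zero, zero_div, mul_zero, zero_add, smoothTransition_half]
    norm_num
  · rw [abs_of_pos h] at hn hnv
    have hpos : 0 < ‖x‖ := by linarith
    have h1 : 1 / 3 ≤ vert x / ‖x‖ := by rw [le_div_iff₀ hpos]; linarith
    rw [saddle, Real.smoothTransition.one_of_one_le (by linarith), Real.sign_of_pos h]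
    norm_num

/-- The Lipschitz bound of a function of degree `0`, also across the origin. -/
lemma exists_saddle_sub_le (n : ℕ) : ∃ L : ℝ, 1 ≤ L ∧ ∀ x y : Eu (n + 1), x ≠ 0 →
    |saddle x - saddle y| ≤ L * (‖x - y‖ / ‖x‖) := by
  obtain ⟨L, hL0, hL⟩ := exists_lipschitz_smoothTransition
  refine ⟨4 * L + 1, by linarith, fun x y hx => ?_⟩
  have hpos : 0 < ‖x‖ := norm_pos_iff.2 hx
  have h1 : |vert x / ‖x‖ - vert y / ‖y‖| ≤ 2 * (‖x - y‖ / ‖x‖) := by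
    have e : vert x / ‖x‖ - vert y / ‖y‖ =
        (vert x - vert y) / ‖x‖ + vert y / ‖y‖ * ((‖y‖ - ‖x‖) / ‖x‖) := by
      rcases eq_or_ne y 0 with rfl | hy
      · simp [vert]
      · have := norm_pos_iff.2 hy
        field_simp
        ring
    have a1 : |(vert x - vert y) / ‖x‖| ≤ ‖x - y‖ / ‖x‖ := by
      rw [abs_div, abs_norm, ← vert_sub]
      gcongr
      exact abs_vert_le _
    have a2 : |vert y / ‖y‖| ≤ 1 := by
      rw [abs_div, abs_norm]
      exact div_le_one_of_le₀ (abs_vert_le y) (norm_nonneg _)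
    have a3 : |(‖y‖ - ‖x‖) / ‖x‖| ≤ ‖x - y‖ / ‖x‖ := by
      rw [abs_div, abs_norm]
      gcongr
      rw [norm_sub_rev]
      exact abs_norm_sub_norm_le y x
    rw [e]
    refine (abs_add_le _ _).trans ?_
    rw [abs_mul]
    have := mul_le_mul a2 a3 (abs_nonneg _) zero_le_one
    linarith
  have h2 := hL (2 * (vert x / ‖x‖) + 1 / 2) (2 * (vert y / ‖y‖) + 1 / 2)
  have e2 : 2 * (vert x / ‖x‖) + 1 / 2 - (2 * (vert y / ‖y‖) + 1 / 2) =
      2 * (vert x / ‖x‖ - vert y / ‖y‖) := by ring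
  rw [e2, abs_mul, abs_two] at h2
  have e3 : saddle x - saddle y = Real.smoothTransition (2 * (vert x / ‖x‖) + 1 / 2) -
      Real.smoothTransition (2 * (vert y / ‖y‖) + 1 / 2) := by rw [saddle, saddle]; ring
  rw [e3]
  have h3 : 0 ≤ ‖x - y‖ / ‖x‖ := by positivity
  nlinarith

lemma isSaddle_saddle (n : ℕ) : IsSaddle (saddle (n := n)) := by
  obtain ⟨L, hL1, hL⟩ := exists_saddle_sub_le n
  refine ⟨fun x hx => (contDiffAt_saddle hx).contDiffWithinAt, abs_saddle_le,
    fun x hx => saddle_of_cone hx, L, fun x hx => ?_⟩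
  have hpos : 0 < ‖x‖ := norm_pos_iff.2 hx
  refine norm_fderiv_le_of_lip' ℝ (by positivity) (Eventually.of_forall fun y => ?_)
  rw [Real.norm_eq_abs, abs_sub_comm, norm_sub_rev]
  exact (hL x y hx).trans (le_of_eq (by ring))

lemma vert_single {n : ℕ} (t : ℝ) : vert (EuclideanSpace.single (Fin.last n) t) = t := by
  simp [vert]

lemma horiz_single {n : ℕ} (t : ℝ) : horiz (EuclideanSpace.single (Fin.last n) t) = 0 := by
  ext i
  simp [horiz]

lemma vert_sub_single {n : ℕ} (x : Eu (n + 1)) (t : ℝ) :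
    vert (x - EuclideanSpace.single (Fin.last n) t) = vert x - t := by rw [vert_sub, vert_single]

lemma horiz_sub_single {n : ℕ} (x : Eu (n + 1)) (t : ℝ) :
    horiz (x - EuclideanSpace.single (Fin.last n) t) = horiz x := by
  rw [horiz_sub, horiz_single, sub_zero]

/-- The distance of `x_d` to the Cantor set. -/
def axDist {n : ℕ} (l : ℝ) (x : Eu (n + 1)) : ℝ := Metric.infDist (vert x) (cantor l)

/-- The size of the larger one of the two distances that define the barrier on the axis. -/
def axMax {n : ℕ} (l : ℝ) (x : Eu (n + 1)) : ℝ := max (axDist l x) ‖horiz x‖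

/-- The barrier function of the supercritical case: the mean of saddle functions with saddle points
distributed over the barrier `{0} × C`. -/
def axBarrier {n : ℕ} (l : ℝ) (x : Eu (n + 1)) : ℝ :=
  ∫ t, saddle (x - EuclideanSpace.single (Fin.last n) t) ∂cantorMeasure l

lemma axDist_nonneg {n : ℕ} (l : ℝ) (x : Eu (n + 1)) : 0 ≤ axDist l x := Metric.infDist_nonneg

lemma abs_axDist_sub_le {n : ℕ} (l : ℝ) (x y : Eu (n + 1)) :
    |axDist l x - axDist l y| ≤ ‖x - y‖ := by
  refine (abs_infDist_sub_le _ _ _).trans ?_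
  rw [← vert_sub]
  exact abs_vert_le _

lemma abs_norm_horiz_sub_le {n : ℕ} (x y : Eu (n + 1)) : |‖horiz x‖ - ‖horiz y‖| ≤ ‖x - y‖ := by
  refine (abs_norm_sub_norm_le _ _).trans ?_
  rw [← horiz_sub]
  exact norm_horiz_le _

lemma abs_axMax_sub_le {n : ℕ} (l : ℝ) (x y : Eu (n + 1)) : |axMax l x - axMax l y| ≤ ‖x - y‖ :=
  (abs_max_sub_max_le_max _ _ _ _).trans (max_le (abs_axDist_sub_le l x y) (abs_norm_horiz_sub_le x y))

lemma axDist_le_abs_sub {n : ℕ} {l t : ℝ} (ht : t ∈ cantor l) (x : Eu (n + 1)) :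
    axDist l x ≤ |vert x - t| := by
  have := Metric.infDist_le_dist_of_mem ht (x := vert x)
  rwa [Real.dist_eq] at this

lemma axMax_le_norm_sub {n : ℕ} {l t : ℝ} (ht : t ∈ cantor l) (x : Eu (n + 1)) :
    axMax l x ≤ ‖x - EuclideanSpace.single (Fin.last n) t‖ := by
  refine max_le ((axDist_le_abs_sub ht x).trans ?_) ?_
  · rw [← vert_sub_single]; exact abs_vert_le _
  · rw [← horiz_sub_single x t]; exact norm_horiz_le _

lemma continuous_single {n : ℕ} :
    Continuous fun t : ℝ => (EuclideanSpace.single (Fin.last n) t : Eu (n + 1)) := by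
  have e : (fun t : ℝ => (EuclideanSpace.single (Fin.last n) t : Eu (n + 1))) =
      fun t => t • EuclideanSpace.single (Fin.last n) (1 : ℝ) := by
    funext t; ext i; simp
  rw [e]
  fun_prop

lemma measurable_sub_single {n : ℕ} :
    Measurable fun p : Eu (n + 1) × ℝ => p.1 - EuclideanSpace.single (Fin.last n) p.2 :=
  (continuous_fst.sub (continuous_single.comp continuous_snd)).measurable

lemma measurable_saddle_sub {n : ℕ} (x : Eu (n + 1)) :
    Measurable fun t : ℝ => saddle (x - EuclideanSpace.single (Fin.last n) t) :=
  measurable_saddle.comp (measurable_sub_single.comp (measurable_const.prodMk measurable_id))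

lemma integrable_saddle_sub {n : ℕ} {l : ℝ} (h0 : 0 < l) (h1 : l < 1 / 2) (x : Eu (n + 1)) :
    Integrable (fun t : ℝ => saddle (x - EuclideanSpace.single (Fin.last n) t)) (cantorMeasure l) := by
  have := isProbabilityMeasure_cantorMeasure h0 h1
  exact Integrable.of_bound (measurable_saddle_sub x).aestronglyMeasurable (1 / 2)
    (Eventually.of_forall fun t => abs_saddle_le _)

lemma measurable_axBarrier {n : ℕ} {l : ℝ} (h0 : 0 < l) (h1 : l < 1 / 2) :
    Measurable (axBarrier (n := n) l) := by
  have := isProbabilityMeasure_cantorMeasure h0 h1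
  exact ((measurable_saddle.comp measurable_sub_single).stronglyMeasurable.integral_prod_right'
    (ν := cantorMeasure l)).measurable

lemma abs_axBarrier_le {n : ℕ} {l : ℝ} (h0 : 0 < l) (h1 : l < 1 / 2) (x : Eu (n + 1)) :
    |axBarrier l x| ≤ 1 / 2 := by
  have := isProbabilityMeasure_cantorMeasure h0 h1
  have h := norm_integral_le_of_norm_le_const (μ := cantorMeasure l)
    (f := fun t => saddle (x - EuclideanSpace.single (Fin.last n) t)) (C := 1 / 2)
    (Eventually.of_forall fun t => abs_saddle_le _)
  simpa [axBarrier] using h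

/-- The Riesz potentials of order below its dimension are bounded for the Cantor measure. -/
lemma exists_potential_le {l θ : ℝ} (h0 : 0 < l) (h1 : l < 1 / 2) (hθ0 : 0 ≤ θ)
    (hθ : θ < cantorExp l) :
    ∃ K : ℝ, 0 ≤ K ∧ ∀ y : ℝ,
      ∫⁻ t, ENNReal.ofReal (min 1 |y - t| ^ (-θ)) ∂cantorMeasure l ≤ ENNReal.ofReal K ∧
      ∀ᵐ t ∂cantorMeasure l, t ≠ y := by
  have hprob := isProbabilityMeasure_cantorMeasure h0 h1
  obtain ⟨A, hA, hball⟩ := exists_cantorMeasure_ball_le h0 h1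
  have hE := cantorExp_pos h0 h1
  have hatom : ∀ y : ℝ, ∀ᵐ t ∂cantorMeasure l, t ≠ y := by
    intro y
    have hlim : Tendsto (fun r : ℝ => ENNReal.ofReal (A * r ^ cantorExp l)) (𝓝[>] 0) (𝓝 0) := by
      have := (Real.continuousAt_rpow_const 0 (cantorExp l) (Or.inr hE.le)).tendsto.const_mul A
      rw [Real.zero_rpow hE.ne', mul_zero] at this
      simpa using (ENNReal.tendsto_ofReal this).mono_left nhdsWithin_le_nhds
    have h2 : cantorMeasure l {y} = 0 := by
      refine le_antisymm (ge_of_tendsto hlim ?_) zero_le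
      filter_upwards [self_mem_nhdsWithin] with r hr
      refine (measure_mono ?_).trans (hball y r hr)
      rintro t rfl
      simpa using hr
    rw [ae_iff]
    simpa using h2
  set B : ℝ≥0∞ := ENNReal.ofReal (A * 2 ^ cantorExp l) + ENNReal.ofReal (2 ^ cantorExp l) with hB
  have hBtop : B * layerConst (cantorExp l) θ < ⊤ :=
    ENNReal.mul_lt_top (by rw [hB]; exact ENNReal.add_lt_top.2 ⟨ENNReal.ofReal_lt_top, ENNReal.ofReal_lt_top⟩)
      (layerConst_lt_top hθ)
  refine ⟨(B * layerConst (cantorExp l) θ).toReal, ENNReal.toReal_nonneg, fun y => ⟨?_, hatom y⟩⟩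
  rw [ENNReal.ofReal_toReal hBtop.ne]
  refine lintegral_rpow_neg_le (by fun_prop) ?_ hθ0 fun t ht ht1 => ?_
  · filter_upwards [hatom y] with t ht
    exact ⟨lt_min one_pos (abs_pos.2 (sub_ne_zero.2 ht.symm)), min_le_left _ _⟩
  · rw [hB, add_mul, ← ENNReal.ofReal_mul (by positivity), ← ENNReal.ofReal_mul (by positivity),
      mul_assoc, ← Real.mul_rpow (by norm_num) ht.le]
    by_cases h2 : 2 * t ≤ 1
    · refine le_trans ((measure_mono fun x hx => ?_).trans (hball y (2 * t) (by linarith))) le_self_add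
      have hx : min 1 |y - x| < 2 * t := hx
      rcases min_lt_iff.1 hx with h | h
      · linarith
      · rw [Set.mem_ofPred_eq, abs_sub_comm]; exact h
    · refine le_trans (prob_le_one.trans ?_) le_add_self
      rw [ENNReal.one_le_ofReal]
      exact Real.one_le_rpow (by linarith) hE.le

/-- The oscillation of the barrier function: it is Hölder continuous of every order below the
dimension of the Cantor set, with a quantitative Lipschitz bound off the barrier. A saddle function
with saddle point `t` varies near `x` at the rate `1 / |x - t|`; the factor `|x - t| ^ (-θ)` is
integrable in `t`, and the remaining one is bounded by means of the distance to the barrier. -/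
lemma exists_axBarrier_sub_le {n : ℕ} {l θ : ℝ} (h0 : 0 < l) (h1 : l < 1 / 2) (hθ0 : 0 ≤ θ)
    (hθ1 : θ ≤ 1) (hθ : θ < cantorExp l) :
    ∃ C : ℝ, ∀ x : Eu (n + 1), 0 < min 1 (axMax l x) → ∀ y,
      |axBarrier l x - axBarrier l y| ≤ C * ‖x - y‖ ^ θ ∧
      |axBarrier l x - axBarrier l y| ≤ C * (‖x - y‖ * min 1 (axMax l x) ^ (θ - 1)) := by
  obtain ⟨L, hL1, hL⟩ := exists_saddle_sub_le n
  obtain ⟨K, hK0, hK⟩ := exists_potential_le h0 h1 hθ0 hθ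
  have hL0 : 0 ≤ L := by linarith
  -- a pointwise bound of the integrand by the kernel of the potential suffices
  have main : ∀ (x y : Eu (n + 1)) (R : ℝ), 0 ≤ R →
      (∀ᵐ t ∂cantorMeasure l, |saddle (x - EuclideanSpace.single (Fin.last n) t) -
        saddle (y - EuclideanSpace.single (Fin.last n) t)| ≤ R * min 1 |vert x - t| ^ (-θ)) →
      |axBarrier l x - axBarrier l y| ≤ R * K := by
    intro x y R hR hae
    rw [axBarrier, axBarrier, ← integral_sub (integrable_saddle_sub h0 h1 x)
      (integrable_saddle_sub h0 h1 y), ← Real.norm_eq_abs]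
    refine (ENNReal.ofReal_le_ofReal_iff (by positivity)).1 ?_
    rw [ofReal_norm]
    refine (enorm_integral_le_lintegral_enorm _).trans ?_
    calc _ ≤ ∫⁻ t, ENNReal.ofReal R * ENNReal.ofReal (min 1 |vert x - t| ^ (-θ)) ∂cantorMeasure l := by
          refine lintegral_mono_ae ?_
          filter_upwards [hae] with t ht
          rw [← ofReal_norm, Real.norm_eq_abs, ← ENNReal.ofReal_mul hR]
          exact ENNReal.ofReal_le_ofReal ht
      _ ≤ ENNReal.ofReal R * ENNReal.ofReal K := by
          rw [lintegral_const_mul' _ _ ENNReal.ofReal_ne_top]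
          gcongr
          exact (hK _).1
      _ = _ := (ENNReal.ofReal_mul hR).symm
  refine ⟨L * K, fun x hx y => ⟨?_, ?_⟩⟩
  · have := main x y (L * ‖x - y‖ ^ θ) (by positivity) ?_
    · linarith
    filter_upwards [(hK (vert x)).2] with t ht
    set x' := x - EuclideanSpace.single (Fin.last n) t with hx'
    set y' := y - EuclideanSpace.single (Fin.last n) t with hy'
    have hxy : x' - y' = x - y := by rw [hx', hy']; abel
    have hv : 0 < |vert x - t| := abs_pos.2 (sub_ne_zero.2 ht.symm)
    have hle : |vert x - t| ≤ ‖x'‖ := by rw [← vert_sub_single]; exact abs_vert_le _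
    have hpos : 0 < ‖x'‖ := hv.trans_le hle
    have hm : 0 < min 1 |vert x - t| := lt_min one_pos hv
    -- the Lipschitz bound for nearby points and the bound of the function for the others
    have hr : |saddle x' - saddle y'| ≤ L * (‖x - y‖ / ‖x'‖) ^ θ := by
      by_cases hq : ‖x - y‖ / ‖x'‖ ≤ 1
      · rcases (show 0 ≤ ‖x - y‖ / ‖x'‖ by positivity).eq_or_lt with h | h
        · have h2 := hL x' y' (norm_pos_iff.1 hpos)
          rw [hxy, ← h, mul_zero] at h2
          exact h2.trans (by positivity)
        · refine (hL x' y' (norm_pos_iff.1 hpos)).trans ?_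
          rw [hxy]
          gcongr
          simpa using Real.rpow_le_rpow_of_exponent_ge h hq hθ1
      · push Not at hq
        have h2 : 1 ≤ (‖x - y‖ / ‖x'‖) ^ θ := Real.one_le_rpow hq.le hθ0
        calc _ ≤ |saddle x'| + |saddle y'| := abs_sub _ _
          _ ≤ 1 * 1 := by linarith [abs_saddle_le x', abs_saddle_le y']
          _ ≤ _ := by gcongr
    refine hr.trans ?_
    rw [Real.div_rpow (norm_nonneg _) hpos.le, div_eq_mul_inv, ← Real.rpow_neg hpos.le, mul_assoc]
    gcongr 2
    exact Real.rpow_le_rpow_of_nonpos hm ((min_le_right _ _).trans hle) (by linarith)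
  · have hM : 0 < axMax l x := hx.trans_le (min_le_right _ _)
    have := main x y (L * (‖x - y‖ * min 1 (axMax l x) ^ (θ - 1))) (by positivity) ?_
    · linarith
    filter_upwards [(hK (vert x)).2, ae_mem_cantor h0 h1] with t ht htC
    set x' := x - EuclideanSpace.single (Fin.last n) t with hx'
    set y' := y - EuclideanSpace.single (Fin.last n) t with hy'
    have hxy : x' - y' = x - y := by rw [hx', hy']; abel
    have hv : 0 < |vert x - t| := abs_pos.2 (sub_ne_zero.2 ht.symm)
    have hle : |vert x - t| ≤ ‖x'‖ := by rw [← vert_sub_single]; exact abs_vert_le _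
    have hle2 : axMax l x ≤ ‖x'‖ := axMax_le_norm_sub htC x
    have hpos : 0 < ‖x'‖ := hv.trans_le hle
    have hm : 0 < min 1 |vert x - t| := lt_min one_pos hv
    refine (hL x' y' (norm_pos_iff.1 hpos)).trans ?_
    have h3 : (‖x'‖)⁻¹ = ‖x'‖ ^ (θ - 1) * ‖x'‖ ^ (-θ) := by
      rw [← Real.rpow_add hpos, ← Real.rpow_neg_one]; congr 1; ring
    rw [hxy, div_eq_mul_inv, h3, mul_assoc, mul_assoc]
    gcongr 3
    · exact Real.rpow_le_rpow_of_nonpos hx ((min_le_right _ _).trans hle2) (by linarith)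
    · exact Real.rpow_le_rpow_of_nonpos hm ((min_le_right _ _).trans hle) (by linarith)

/-- The barrier function is smooth off the barrier. -/
lemma contDiffAt_axBarrier {n : ℕ} {l : ℝ} (h0 : 0 < l) (h1 : l < 1 / 2) {x : Eu (n + 1)}
    (hx : 0 < axMax l x) : ContDiffAt ℝ ∞ (axBarrier (n := n) l) x := by
  have hprob := isProbabilityMeasure_cantorMeasure h0 h1
  set r := axMax l x / 2 with hr
  have hr0 : 0 < r := by positivity
  let β₁ : ContDiffBump (0 : Eu (n + 1)) := ⟨r / 4, r / 2, by positivity, by linarith⟩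
  let β₂ : ContDiffBump (0 : Eu (n + 1)) :=
    ⟨‖x‖ + r + 1, ‖x‖ + r + 2, by positivity, by linarith⟩
  -- the saddle function, cut off near the origin and at infinity
  set G : Eu (n + 1) → ℝ := fun y => saddle y * (1 - β₁ y) * β₂ y with hG
  have hGs : ContDiff ℝ ∞ G := by
    refine contDiff_iff_contDiffAt.2 fun y => ?_
    rcases eq_or_ne y 0 with rfl | hy
    · have : G =ᶠ[𝓝 0] fun _ => 0 := by
        filter_upwards [Metric.ball_mem_nhds (0 : Eu (n + 1)) (show (0 : ℝ) < r / 4 by positivity)]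
          with z hz
        have : β₁ z = 1 := β₁.one_of_mem_closedBall (Metric.ball_subset_closedBall hz)
        simp only [hG]
        rw [this]; ring
      exact contDiffAt_const.congr_of_eventuallyEq this
    · exact ((contDiffAt_saddle hy).mul (contDiffAt_const.sub β₁.contDiffAt)).mul β₂.contDiffAt
  have hGc : HasCompactSupport G := β₂.hasCompactSupport.mul_left
  set ν : Measure (Eu (n + 1)) :=
    (cantorMeasure l).map (fun t => EuclideanSpace.single (Fin.last n) t) with hν
  have hsm : Measurable fun t : ℝ => (EuclideanSpace.single (Fin.last n) t : Eu (n + 1)) :=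
    continuous_single.measurable
  have hνp : IsProbabilityMeasure ν := Measure.isProbabilityMeasure_map hsm.aemeasurable
  have hconv := hGc.contDiff_convolution_right (ContinuousLinearMap.lsmul ℝ ℝ)
    ((locallyIntegrable_const (1 : ℝ)) : LocallyIntegrable (fun _ : Eu (n + 1) => (1 : ℝ)) ν) hGs
  refine hconv.contDiffAt.congr_of_eventuallyEq ?_
  filter_upwards [Metric.ball_mem_nhds x hr0] with y hy
  rw [mem_ball_iff_norm] at hy
  rw [convolution_def]
  simp only [ContinuousLinearMap.lsmul_apply, smul_eq_mul, one_mul]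
  rw [hν, integral_map (f := fun z => G (y - z)) hsm.aemeasurable
    (hGs.continuous.comp (by fun_prop)).aestronglyMeasurable, axBarrier]
  refine integral_congr_ae ?_
  filter_upwards [ae_mem_cantor h0 h1] with t ht
  have hlow : r ≤ ‖y - EuclideanSpace.single (Fin.last n) t‖ := by
    refine le_trans ?_ (axMax_le_norm_sub ht y)
    have := (abs_le.1 (abs_axMax_sub_le l x y)).2
    rw [norm_sub_rev] at this
    linarith
  have hup : ‖y - EuclideanSpace.single (Fin.last n) t‖ ≤ ‖x‖ + r + 1 := by
    have a1 : ‖(EuclideanSpace.single (Fin.last n) t : Eu (n + 1))‖ ≤ 1 / 2 := by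
      rw [PiLp.norm_single]
      exact abs_le.2 (cantor_subset l ht)
    have a2 := norm_sub_le y (EuclideanSpace.single (Fin.last n) t : Eu (n + 1))
    have a3 : ‖y‖ ≤ ‖x‖ + ‖y - x‖ := by
      have := norm_add_le x (y - x)
      rwa [add_sub_cancel] at this
    linarith
  have e1 : β₁ (y - EuclideanSpace.single (Fin.last n) t) = 0 :=
    β₁.zero_of_le_dist (by
      rw [dist_zero_right]
      change r / 2 ≤ _
      linarith)
  have e2 : β₂ (y - EuclideanSpace.single (Fin.last n) t) = 1 :=
    β₂.one_of_mem_closedBall (by rw [mem_closedBall_zero_iff]; exact hup)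
  simp only [hG]
  rw [e1, e2]; ring

lemma isConeCutoff_axDist {n : ℕ} (l : ℝ) {κ κ' : ℝ} (hκ : 0 < κ) (hκ' : κ < κ') :
    IsConeCutoff (axDist (n := n) l) (fun x => ‖horiz x‖) κ κ'
      (coneCutoff (axDist l) (fun x => ‖horiz x‖) κ κ') :=
  isConeCutoff_coneCutoff (fun _ => norm_nonneg _) (axDist_nonneg l) hκ hκ' (abs_axDist_sub_le l)
    abs_norm_horiz_sub_le fun x hx =>
      (contDiffAt_norm ℝ (norm_ne_zero_iff.1 hx)).comp x contDiff_horiz.contDiffAt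

/-- The weight of the supercritical case before localization. -/
def axWeight {n : ℕ} (l α : ℝ) (x : Eu (n + 1)) : ℝ :=
  ‖horiz x‖ ^ α * (1 - coneCutoff (axDist l) (fun x => ‖horiz x‖) (1 / 2) 2 x)

lemma isHolder_of_le_one {m : ℕ} {α : ℝ} (hα : 0 < α) (hα1 : α ≤ 1) {a : Eu m → ℝ} {C : ℝ}
    (h : ∀ x y, |a x - a y| ≤ C * ‖x - y‖ ^ α) : IsHolder α a := by
  have hk : ⌈α⌉₊ - 1 = 0 := by
    have : ⌈α⌉₊ ≤ 1 := Nat.ceil_le.2 (by simpa using hα1)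
    omega
  have hc : Continuous a := by
    refine continuous_iff_continuousAt.2 fun x => ?_
    have hlim : Tendsto (fun y => C * ‖y - x‖ ^ α) (𝓝 x) (𝓝 0) := by
      have h1 : Continuous fun y : Eu m => C * ‖y - x‖ ^ α :=
        continuous_const.mul ((continuous_id.sub continuous_const).norm.rpow_const
          fun _ => Or.inr hα.le)
      have := h1.tendsto x
      simpa [Real.zero_rpow hα.ne'] using this
    rw [ContinuousAt, tendsto_iff_norm_sub_tendsto_zero]
    exact squeeze_zero (fun _ => norm_nonneg _) (fun y => h y x) hlim
  rw [IsHolder, hk]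
  refine ⟨contDiff_zero.2 hc, C, fun x y => ?_⟩
  have e : ‖iteratedFDeriv ℝ 0 a x - iteratedFDeriv ℝ 0 a y‖ = |a x - a y| := by
    rw [iteratedFDeriv_zero_eq_comp]
    simp only [Function.comp_apply]
    rw [← map_sub, LinearIsometryEquiv.norm_map, Real.norm_eq_abs]
  rw [e]
  simpa using h x y

/-- The weight is of order `α ≤ 1`, so that bounds of the weight and its gradient suffice. -/
lemma isWeight_axWeight {n : ℕ} (l : ℝ) {α : ℝ} (hα : 0 < α) (hα1 : α ≤ 1) {χ : Eu (n + 1) → ℝ}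
    (hχ : IsBoxCutoff 2 3 χ) : IsWeight α (fun x => χ x * axWeight l α x) := by
  obtain ⟨hsm, h01, -, -, C, hC⟩ :=
    isConeCutoff_axDist (n := n) l (κ := 1 / 2) (κ' := 2) (by norm_num) (by norm_num)
  obtain ⟨L, hL0, hLb, hLd, -⟩ := exists_lipschitz_of_contDiff hχ.1 hχ.hasCompactSupport
  set ρ := coneCutoff (axDist (n := n) l) (fun x => ‖horiz x‖) (1 / 2) 2 with hρ
  set R : ℝ := (n + 1 : ℕ) * |(3 : ℝ)| with hR
  have hR0 : 0 ≤ R := by positivity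
  have hh : ∀ x ∈ tsupport χ, ‖horiz x‖ ≤ R := fun x hx =>
    (norm_horiz_le x).trans (norm_le_of_coord_le x (hχ.tsupport_subset hx))
  have hval : ∀ x, χ x * axWeight l α x ≤ ‖horiz x‖ ^ α := fun x => by
    have h1 := hχ.2.1 x
    have h2 := h01 x
    calc χ x * axWeight l α x ≤ 1 * (‖horiz x‖ ^ α * 1) := by
          rw [axWeight]
          refine mul_le_mul h1.2 (mul_le_mul_of_nonneg_left ?_ (by positivity))
            (mul_nonneg (by positivity) ?_) zero_le_one <;> linarith
      _ = _ := by ring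
  have hnn : ∀ x, 0 ≤ χ x * axWeight l α x := fun x =>
    mul_nonneg (hχ.2.1 x).1 (mul_nonneg (by positivity) (by linarith [(h01 x).2]))
  have hop : IsOpen {x : Eu (n + 1) | ¬ (axDist l x = 0 ∧ ‖horiz x‖ = 0)} := by
    have : {x : Eu (n + 1) | ¬ (axDist l x = 0 ∧ ‖horiz x‖ = 0)} =
        ({x | axDist l x = 0} ∩ {x | ‖horiz x‖ = 0})ᶜ := rfl
    rw [this, isOpen_compl_iff]
    exact (isClosed_eq (continuous_of_abs_sub_le (abs_axDist_sub_le l)) continuous_const).inter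
      (isClosed_eq continuous_horiz.norm continuous_const)
  -- the derivatives of the three factors
  have hder : ∀ x : Eu (n + 1), 0 < ‖horiz x‖ →
      HasFDerivAt (fun x => χ x * axWeight l α x)
        (χ x • (‖horiz x‖ ^ α • (-fderiv ℝ ρ x) +
          (1 - ρ x) • fderiv ℝ (fun x : Eu (n + 1) => ‖horiz x‖ ^ α) x) +
          axWeight l α x • fderiv ℝ χ x) x ∧
      ‖fderiv ℝ (fun x : Eu (n + 1) => ‖horiz x‖ ^ α) x‖ ≤ α * ‖horiz x‖ ^ (α - 1) := by
    intro x hx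
    have hρx : DifferentiableAt ℝ ρ x :=
      (hsm.contDiffAt (hop.mem_nhds fun h => hx.ne' h.2)).differentiableAt (by norm_num)
    have hnx : DifferentiableAt ℝ (fun x : Eu (n + 1) => ‖horiz x‖) x :=
      ((contDiffAt_norm (n := 1) ℝ (norm_pos_iff.1 hx)).differentiableAt one_ne_zero).comp x
        (horizL n).differentiableAt
    have hpow := hnx.hasFDerivAt.rpow_const (p := α) (Or.inl hx.ne')
    refine ⟨(((hχ.1.differentiable (by norm_num)) x).hasFDerivAt.mul
      (hpow.differentiableAt.hasFDerivAt.mul ((hρx.hasFDerivAt).const_sub 1))), ?_⟩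
    rw [hpow.fderiv, norm_smul, Real.norm_eq_abs, abs_of_nonneg (by positivity)]
    have h1 : ‖fderiv ℝ (fun x : Eu (n + 1) => ‖horiz x‖) x‖ ≤ 1 :=
      norm_fderiv_le_of_lip' ℝ zero_le_one (Eventually.of_forall fun y => by
        rw [one_mul]; exact abs_norm_horiz_sub_le y x)
    exact mul_le_of_le_one_right (by positivity) h1
  set K : ℝ := |C| + α + L * R + 1 with hK
  have hK0 : 1 ≤ K := by
    have := mul_nonneg hL0 hR0
    have := abs_nonneg C
    linarith
  have hsize : ∀ x : Eu (n + 1), 0 < ‖horiz x‖ → ‖χ x * axWeight l α x‖ ≤ K * ‖horiz x‖ ^ α := by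
    intro x _
    rw [Real.norm_eq_abs, abs_of_nonneg (hnn x)]
    have : 0 ≤ ‖horiz x‖ ^ α := by positivity
    exact (hval x).trans (by nlinarith)
  have hgrad : ∀ x : Eu (n + 1), 0 < ‖horiz x‖ →
      ‖fderiv ℝ (fun x => χ x * axWeight l α x) x‖ ≤ K * ‖horiz x‖ ^ (α - 1) := by
    intro x hx
    obtain ⟨hd, hn⟩ := hder x hx
    rw [hd.fderiv]
    have hp0 : 0 ≤ ‖horiz x‖ ^ (α - 1) := by positivity
    by_cases hxs : x ∈ tsupport χ
    · have hpow : ‖horiz x‖ ^ α = ‖horiz x‖ ^ (α - 1) * ‖horiz x‖ := by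
        rw [← Real.rpow_add_one hx.ne', sub_add_cancel]
      have e1 : ‖χ x‖ ≤ 1 := abs_le.2 ⟨by linarith [(hχ.2.1 x).1], (hχ.2.1 x).2⟩
      have e2 : ‖(1 : ℝ) - ρ x‖ ≤ 1 :=
        abs_le.2 ⟨by linarith [(h01 x).2], by linarith [(h01 x).1]⟩
      have e3 : ‖‖horiz x‖ ^ α • (-fderiv ℝ ρ x)‖ ≤ ‖horiz x‖ ^ (α - 1) * |C| := by
        rw [norm_smul, norm_neg, Real.norm_eq_abs, abs_of_nonneg (by positivity), hpow, mul_assoc]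
        gcongr
        calc ‖horiz x‖ * ‖fderiv ℝ ρ x‖ ≤ ‖horiz x‖ * (C / ‖horiz x‖) := by
              gcongr; exact hC x hx.ne'
          _ = C := by field_simp
          _ ≤ |C| := le_abs_self C
      have e4 : ‖axWeight l α x‖ ≤ ‖horiz x‖ ^ (α - 1) * R := by
        rw [axWeight, norm_mul, Real.norm_eq_abs (_ ^ α), abs_of_nonneg (by positivity), hpow]
        calc _ ≤ ‖horiz x‖ ^ (α - 1) * ‖horiz x‖ * 1 := by gcongr
          _ ≤ _ := by rw [mul_one]; gcongr; exact hh x hxs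
      calc _ ≤ ‖χ x‖ * (‖‖horiz x‖ ^ α • (-fderiv ℝ ρ x)‖ + ‖(1 : ℝ) - ρ x‖ *
            ‖fderiv ℝ (fun x : Eu (n + 1) => ‖horiz x‖ ^ α) x‖) +
            ‖axWeight l α x‖ * ‖fderiv ℝ χ x‖ := by
            refine (norm_add_le _ _).trans (add_le_add ?_ (norm_smul _ _).le)
            refine (norm_smul _ _).le.trans (mul_le_mul_of_nonneg_left ?_ (norm_nonneg _))
            exact (norm_add_le _ _).trans (add_le_add le_rfl (norm_smul _ _).le)
        _ ≤ 1 * (‖horiz x‖ ^ (α - 1) * |C| + 1 * (α * ‖horiz x‖ ^ (α - 1))) +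
            ‖horiz x‖ ^ (α - 1) * R * L := by
            gcongr
            exact hLd x
        _ ≤ _ := by rw [hK]; nlinarith
    · have hχe : χ =ᶠ[𝓝 x] 0 := notMem_tsupport_iff_eventuallyEq.1 hxs
      rw [hχe.eq_of_nhds, hχe.fderiv_eq]
      simp
      positivity
  obtain ⟨C', hC'⟩ := exists_holder_of_bounds (h := fun x : Eu (n + 1) => ‖horiz x‖)
    (fun _ => norm_nonneg _) abs_norm_horiz_sub_le hα hα1 (f := fun x => χ x * axWeight l α x)
    (C := K) (fun x hx => by rw [axWeight, hx, Real.zero_rpow hα.ne']; ring)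
    (fun x hx => (hder x hx).1.differentiableAt) hsize hgrad
  refine ⟨hnn, ⟨R ^ α, fun x => ?_⟩, isHolder_of_le_one hα hα1 hC', fun x hx => by
    simp [hχ.2.2.2 x hx]⟩
  by_cases hx : x ∈ tsupport χ
  · exact (hval x).trans (Real.rpow_le_rpow (norm_nonneg _) (hh x hx) hα.le)
  · simp only
    rw [image_eq_zero_of_notMem_tsupport hx, zero_mul]; positivity

/-- Where the weight is active, the barrier function is locally constant. -/
lemma axBarrier_eventuallyEq {n : ℕ} {l α : ℝ} (h0 : 0 < l) (h1 : l < 1 / 2) (hα : 0 < α)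
    (hα1 : α ≤ 1) {χ : Eu (n + 1) → ℝ} (hχ : IsBoxCutoff 2 3 χ) {x : Eu (n + 1)}
    (hx : 0 < χ x * axWeight l α x) : ∃ c : ℝ, axBarrier l =ᶠ[𝓝 x] fun _ => c := by
  have hcont : Continuous fun x => χ x * axWeight l α x :=
    (isWeight_axWeight l hα hα1 hχ).2.2.1.1.continuous
  have hA := isConeCutoff_axDist (n := n) l (κ := 1 / 2) (κ' := 2) (by norm_num) (by norm_num)
  have hcone : ∀ y : Eu (n + 1), 0 < χ y * axWeight l α y → ‖horiz y‖ < 2 * axDist l y := by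
    intro y hy
    by_contra hcon
    push Not at hcon
    rw [axWeight, hA.2.2.1 y (by linarith)] at hy
    simp at hy
  have hδ : 0 < axDist l x := by linarith [hcone x hx, norm_nonneg (horiz x)]
  -- near `x` every saddle function of the family is constant, since the weight is active only where
  -- `|x̄| < 2 |x_d - t|` for all `t` in the Cantor set
  refine ⟨∫ t, 1 / 2 * Real.sign (vert x - t) ∂cantorMeasure l, ?_⟩
  filter_upwards [continuousAt_const.eventually_lt hcont.continuousAt hx,
    Metric.ball_mem_nhds x hδ] with y hy hyx
  rw [mem_ball_iff_norm] at hyx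
  refine integral_congr_ae ?_
  filter_upwards [ae_mem_cantor h0 h1] with t ht
  have hyt := axDist_le_abs_sub ht y
  have hxt := axDist_le_abs_sub ht x
  rw [saddle_of_cone (by rw [horiz_sub_single, vert_sub_single]; linarith [hcone y hy]),
    vert_sub_single]
  have hv : |vert y - vert x| < axDist l x := by
    rw [← vert_sub]; exact (abs_vert_le _).trans_lt hyx
  have hv' := abs_lt.1 hv
  congr 1
  rcases le_abs'.1 hxt with h | h
  · rw [Real.sign_of_neg (by linarith), Real.sign_of_neg (by linarith)]
  · rw [Real.sign_of_pos (by linarith), Real.sign_of_pos (by linarith)]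

lemma axMax_pos_of_notMem_box {n : ℕ} {l : ℝ} (h0 : 0 < l) (h1 : l < 1 / 2) {x : Eu (n + 1)}
    (hx : x ∉ box (n + 1) (4 / 6)) : 0 < axMax l x := by
  by_contra hcon
  push Not at hcon
  refine hx fun i => ?_
  have hv : ‖horiz x‖ ≤ 0 := (le_max_right _ _).trans hcon
  have hd : axDist l x = 0 := le_antisymm ((le_max_left _ _).trans hcon) (axDist_nonneg l x)
  have hmem : vert x ∈ cantor l :=
    ((isClosed_cantor l).mem_iff_infDist_zero (cantor_nonempty h0 h1)).2 hd
  refine Fin.lastCases ?_ (fun j => ?_) i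
  · have h2 : |vert x| ≤ 1 / 2 := abs_le.2 (cantor_subset l hmem)
    exact lt_of_le_of_lt h2 (by norm_num)
  · exact lt_of_le_of_lt ((abs_coord_le (horiz x) j).trans hv) (by norm_num)

lemma exists_volume_axMax_lt_le (n : ℕ) {l : ℝ} (h0 : 0 < l) (h1 : l < 1 / 2) :
    ∃ A : ℝ, 0 ≤ A ∧ ∀ t : ℝ, 0 < t → t ≤ 2 →
      volume {x : Eu (n + 1) | axMax l x < t} ≤ ENNReal.ofReal (A * t ^ (n + 1 - cantorExp l)) := by
  obtain ⟨A, hA, h⟩ := exists_volume_thickening_cantor_le h0 h1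
  have hb1 : volume (Metric.ball (0 : Eu n) 1) < ⊤ := measure_ball_lt_top
  set B := (volume (Metric.ball (0 : Eu n) 1)).toReal with hB
  refine ⟨A * B, by positivity, fun t ht ht2 => ?_⟩
  have hset : {x : Eu (n + 1) | axMax l x < t} = {x : Eu (n + 1) |
      vert x ∈ {r : ℝ | Metric.infDist r (cantor l) < t} ∧ horiz x ∈ Metric.ball (0 : Eu n) t} := by
    ext x
    simp only [axMax, axDist, max_lt_iff, Set.mem_ofPred_eq, mem_ball_zero_iff]
  rw [hset, volume_split, Measure.addHaar_ball_of_pos _ _ ht, ← ENNReal.ofReal_toReal hb1.ne, ← hB,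
    finrank_euclideanSpace_fin]
  calc _ ≤ ENNReal.ofReal (A * t ^ (1 - cantorExp l)) *
        (ENNReal.ofReal (t ^ n) * ENNReal.ofReal B) := by
        gcongr; exact h t ht ht2
    _ = _ := by
        rw [← ENNReal.ofReal_mul (by positivity), ← ENNReal.ofReal_mul (by positivity),
          show (n : ℝ) + 1 - cantorExp l = (1 - cantorExp l) + n by ring, Real.rpow_add ht,
          Real.rpow_natCast]
        congr 1; ring

/-- In the supercritical case the gap follows from a lower bound on the local phase. -/
lemma realizesGap_axBarrier {n : ℕ} {s p q α l : ℝ} (hs0 : 0 < s) (hs1 : s < 1) (hp : 1 < p)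
    (hq : 1 < q) (hα : 0 < α) (hα1 : α ≤ 1) (h0 : 0 < l) (h1 : l < 1 / 2)
    (hcap : s * p - (n + 1) < cantorExp l * (p - 1)) {η χ : Eu (n + 1) → ℝ}
    (hη : IsBoxCutoff (4 / 6) (5 / 6) η) (hχ : IsBoxCutoff 2 3 χ)
    (hc : ∃ c : ℝ≥0∞, 0 < c ∧
      ∀ v ∈ {v : Eu (n + 1) → ℝ | Continuous v ∧ ContDiffOn ℝ 1 v (box (n + 1) 1)},
      (∀ x, x ∉ box (n + 1) 1 → v x = axBarrier l x * χ x) →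
      c ≤ localEnergy q (fun x => χ x * axWeight l α x) v) :
    RealizesGap s p q α {v | Continuous v ∧ ContDiffOn ℝ 1 v (box (n + 1) 1)}
      (fun x => χ x * axWeight l α x) (fun x => χ x * axBarrier l x)
      (fun x => (1 - η x) * (χ x * axBarrier l x)) := by
  have hE0 := cantorExp_pos h0 h1
  have hE1 := cantorExp_lt_one h0 h1
  have hn0 : (0 : ℝ) ≤ n := Nat.cast_nonneg n
  have hp0 : 0 < p := by linarith
  -- the Hölder exponent of the barrier function: just below the dimension or the order `s`
  obtain ⟨θ, hθ1, hθ2⟩ : ∃ θ, max 0 (s - (n + 1 - cantorExp l) / p) < θ ∧ θ < min s (cantorExp l) := by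
    refine exists_between (max_lt (lt_min hs0 hE0) (lt_min ?_ ?_))
    · have : 0 < (n + 1 - cantorExp l) / p := by apply div_pos <;> linarith
      linarith
    · have : s * p - (n + 1 - cantorExp l) < cantorExp l * p := by linarith
      have h2 : s - (n + 1 - cantorExp l) / p = (s * p - (n + 1 - cantorExp l)) / p := by
        field_simp
      rw [h2, div_lt_iff₀ hp0]
      exact this
  have hθ0 : 0 < θ := (le_max_left _ _).trans_lt hθ1
  have hθs : θ < s := hθ2.trans_le (min_le_left _ _)
  have hθE : θ < cantorExp l := hθ2.trans_le (min_le_right _ _)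
  have hκ : (s - θ) * p < n + 1 - cantorExp l := by
    have := (le_max_right _ _).trans_lt hθ1
    rw [← lt_div_iff₀ hp0]
    linarith
  obtain ⟨C, hC⟩ := exists_axBarrier_sub_le (n := n) h0 h1 hθ0.le (by linarith) hθE
  obtain ⟨A, hA, hvol⟩ := exists_volume_axMax_lt_le n h0 h1
  have hMc : Continuous (axMax (n := n) l) := continuous_of_abs_sub_le (abs_axMax_sub_le l)
  refine realizesGap_of_barrier (θ := θ) (κ := n + 1 - cantorExp l) (C := C)
    (D := fun x => min 1 (axMax l x)) (Nat.succ_pos n) hs1 hp hq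
    hθ0.le hθs hκ hη hχ ?_ (measurable_axBarrier h0 h1) (abs_axBarrier_le h0 h1)
    (continuous_const.min hMc).measurable (fun x => min_le_left _ _)
    (fun t ht _ => volume_min_lt_le (by linarith) hA hvol t ht) hC
    (fun x hx => contDiffAt_axBarrier h0 h1 (axMax_pos_of_notMem_box h0 h1 hx))
    (isWeight_axWeight l hα hα1 hχ)
    (fun x _ hx => axBarrier_eventuallyEq h0 h1 hα hα1 hχ hx)
    (fun v hv => ⟨hv.continuous, (hv.of_le (by norm_num)).contDiffOn⟩) hc
  exact ENNReal.add_lt_top.2 ⟨ENNReal.ofReal_lt_top,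
    ENNReal.mul_lt_top (volume_box_lt_top _ _) ENNReal.ofReal_lt_top⟩

/-! ### The lower bound in the supercritical case -/

/-- The curves that run through the barrier on the axis; they touch the axis in the Cantor set. They
are Lipschitz graphs over the axis and cross the height `t` at distance comparable to that of `t` to
the Cantor set from the axis. -/
def axCurve {n : ℕ} (l : ℝ) (z : Eu n) (t : ℝ) : Eu (n + 1) :=
  join t (Metric.infDist t (cantor l) • z)

lemma vert_axCurve {n : ℕ} (l : ℝ) (z : Eu n) (t : ℝ) : vert (axCurve l z t) = t := vert_join _ _

lemma horiz_axCurve {n : ℕ} (l : ℝ) (z : Eu n) (t : ℝ) :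
    horiz (axCurve l z t) = Metric.infDist t (cantor l) • z := horiz_join _ _

lemma norm_axCurve_sub_le {n : ℕ} (l : ℝ) {z : Eu n} (hz : ‖z‖ ≤ 1) (t t' : ℝ) :
    ‖axCurve l z t - axCurve l z t'‖ ≤ 2 * |t - t'| := by
  refine (norm_le_horiz_add_vert _).trans ?_
  rw [horiz_sub, vert_sub, vert_axCurve, vert_axCurve, horiz_axCurve, horiz_axCurve, ← sub_smul,
    norm_smul]
  have h1 := abs_infDist_sub_le (cantor l) t t'
  have := mul_le_mul h1 hz (norm_nonneg _) (abs_nonneg _)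
  simp only [Real.norm_eq_abs] at this ⊢
  linarith

lemma continuous_axCurve {n : ℕ} (l : ℝ) (z : Eu n) : Continuous (axCurve l z) :=
  continuous_join.comp (continuous_id.prodMk
    ((Metric.continuous_infDist_pt (cantor l)).smul continuous_const))

lemma infDist_cantor_le {l t : ℝ} (h0 : 0 < l) (h1 : l < 1 / 2) (ht : |t| ≤ 1) :
    Metric.infDist t (cantor l) ≤ 3 / 2 := by
  obtain ⟨c, hc⟩ := cantor_nonempty h0 h1
  refine (Metric.infDist_le_dist_of_mem hc).trans ?_
  rw [Real.dist_eq]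
  have := abs_le.2 (cantor_subset l hc)
  exact (abs_sub t c).trans (by linarith)

lemma norm_horiz_axCurve_le {n : ℕ} {l t : ℝ} (h0 : 0 < l) (h1 : l < 1 / 2) (ht : |t| ≤ 1) {z : Eu n}
    (hz : ‖z‖ ≤ 1 / 2) : ‖horiz (axCurve l z t)‖ ≤ 3 / 4 := by
  rw [horiz_axCurve, norm_smul, Real.norm_eq_abs, abs_of_nonneg Metric.infDist_nonneg]
  calc _ ≤ 3 / 2 * (1 / 2 : ℝ) := mul_le_mul (infDist_cantor_le h0 h1 ht) hz (norm_nonneg _) (by norm_num)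
    _ = 3 / 4 := by norm_num

lemma mem_box_of_le {n : ℕ} {y : Eu (n + 1)} (hv : |vert y| < 1) (hh : ‖horiz y‖ ≤ 3 / 4) :
    y ∈ box (n + 1) 1 := fun i => by
  refine Fin.lastCases hv (fun j => ?_) i
  exact lt_of_le_of_lt ((abs_coord_le (horiz y) j).trans hh) (by norm_num)

/-- The chain rule as an inequality along a Lipschitz curve. -/
lemma norm_deriv_comp_le {m : ℕ} {v : Eu m → ℝ} {γ : ℝ → Eu m} {t L : ℝ} (hL : 0 ≤ L)
    (hγ : ∀ t', ‖γ t' - γ t‖ ≤ L * |t' - t|) (hv : DifferentiableAt ℝ v (γ t)) :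
    ‖deriv (fun t => v (γ t)) t‖ ≤ L * ‖fderiv ℝ v (γ t)‖ := by
  have hcont : Tendsto γ (𝓝 t) (𝓝 (γ t)) := by
    rw [tendsto_iff_norm_sub_tendsto_zero]
    refine squeeze_zero (fun _ => norm_nonneg _) hγ ?_
    have : Continuous fun t' : ℝ => L * |t' - t| := by fun_prop
    simpa using this.tendsto t
  have key : ∀ ε : ℝ, 0 < ε →
      ‖deriv (fun t => v (γ t)) t‖ ≤ (‖fderiv ℝ v (γ t)‖ + ε) * L := by
    intro ε hε
    refine norm_deriv_le_of_lip' (by positivity) ?_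
    filter_upwards [hcont.eventually (hv.hasFDerivAt.isLittleO.def hε)] with t' ht'
    calc ‖v (γ t') - v (γ t)‖ ≤ ‖v (γ t') - v (γ t) - fderiv ℝ v (γ t) (γ t' - γ t)‖ +
          ‖fderiv ℝ v (γ t) (γ t' - γ t)‖ := by
          have := norm_add_le (v (γ t') - v (γ t) - fderiv ℝ v (γ t) (γ t' - γ t))
            (fderiv ℝ v (γ t) (γ t' - γ t))
          rwa [sub_add_cancel] at this
      _ ≤ ε * ‖γ t' - γ t‖ + ‖fderiv ℝ v (γ t)‖ * ‖γ t' - γ t‖ :=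
          add_le_add ht' (ContinuousLinearMap.le_opNorm _ _)
      _ = (‖fderiv ℝ v (γ t)‖ + ε) * ‖γ t' - γ t‖ := by ring
      _ ≤ (‖fderiv ℝ v (γ t)‖ + ε) * (L * |t' - t|) := by gcongr; exact hγ t'
      _ = _ := by rw [Real.norm_eq_abs]; ring
  refine le_of_forall_pos_le_add fun ε hε => ?_
  have h := key (ε / (L + 1)) (by positivity)
  have h2 : ε / (L + 1) * L ≤ ε := by
    rw [div_mul_eq_mul_div, div_le_iff₀ (by positivity)]
    nlinarith
  linarith

/-- The change of `v` along a curve is bounded by the integral of its gradient. -/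
lemma ofReal_sub_le_lintegral_axCurve {n : ℕ} {l : ℝ} (h0 : 0 < l) (h1 : l < 1 / 2)
    {v : Eu (n + 1) → ℝ} (hv : Continuous v) (hv1 : ContDiffOn ℝ 1 v (box (n + 1) 1)) {z : Eu n}
    (hz : ‖z‖ ≤ 1 / 2) :
    ENNReal.ofReal |v (axCurve l z 1) - v (axCurve l z (-1))| ≤
      ∫⁻ t in Set.Ioo (-1 : ℝ) 1, 2 * ‖fderiv ℝ v (axCurve l z t)‖ₑ := by
  set f : ℝ → ℝ := fun t => v (axCurve l z t) with hf
  have hfc : Continuous f := hv.comp (continuous_axCurve l z)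
  have hdiff : ∀ y ∈ box (n + 1) 1, DifferentiableAt ℝ v y := fun y hy =>
    (hv1.contDiffAt ((isOpen_box _ _).mem_nhds hy)).differentiableAt one_ne_zero
  have hstep : ∀ ε : ℝ, 0 < ε → ε < 1 → ENNReal.ofReal |f (1 - ε) - f (-(1 - ε))| ≤
      ∫⁻ t in Set.Ioo (-1 : ℝ) 1, 2 * ‖fderiv ℝ v (axCurve l z t)‖ₑ := by
    intro ε hε hε1
    -- a compact convex subset of the box that contains the curve up to the heights `±(1 - ε)`; there the
    -- gradient of `v` is bounded, hence `v` is Lipschitz along the curve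
    set Q : Set (Eu (n + 1)) := vertL n ⁻¹' Metric.closedBall 0 (1 - ε) ∩
      horizL n ⁻¹' Metric.closedBall 0 (3 / 4) with hQ
    have hmem : ∀ y, y ∈ Q ↔ |vert y| ≤ 1 - ε ∧ ‖horiz y‖ ≤ 3 / 4 := by
      intro y; simp [hQ]
    have hQb : Q ⊆ box (n + 1) 1 := fun y hy =>
      mem_box_of_le (by linarith [((hmem y).1 hy).1]) ((hmem y).1 hy).2
    have hQconv : Convex ℝ Q :=
      ((convex_closedBall 0 _).linear_preimage (vertL n).toLinearMap).inter
        ((convex_closedBall 0 _).linear_preimage (horizL n).toLinearMap)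
    have hQcomp : IsCompact Q := by
      refine (isCompact_closedBall (0 : Eu (n + 1)) 2).of_isClosed_subset
        ((Metric.isClosed_closedBall.preimage (vertL n).continuous).inter
          (Metric.isClosed_closedBall.preimage (horizL n).continuous)) fun y hy => ?_
      rw [mem_closedBall_zero_iff]
      have := (hmem y).1 hy
      linarith [norm_le_horiz_add_vert y]
    obtain ⟨B, hB⟩ := hQcomp.exists_bound_of_continuousOn
      ((hv1.continuousOn_fderiv_of_isOpen (isOpen_box _ _) le_rfl).mono hQb)
    have hcurve : ∀ t ∈ Set.uIcc (-(1 - ε)) (1 - ε), axCurve l z t ∈ Q := by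
      intro t ht
      rw [Set.uIcc_of_le (by linarith)] at ht
      have hta : |t| ≤ 1 - ε := abs_le.2 ht
      exact (hmem _).2 ⟨by rwa [vert_axCurve], norm_horiz_axCurve_le h0 h1 (by linarith) hz⟩
    have hlip : LipschitzOnWith (Real.toNNReal (|B| * 2)) f (Set.uIcc (-(1 - ε)) (1 - ε)) := by
      refine LipschitzOnWith.of_dist_le_mul fun t ht t' ht' => ?_
      rw [Real.dist_eq, Real.dist_eq, Real.coe_toNNReal _ (by positivity)]
      have key := Convex.norm_image_sub_le_of_norm_fderiv_le (𝕜 := ℝ) (f := v) (C := |B|) (s := Q)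
        (fun y hy => hdiff y (hQb hy)) (fun y hy => (hB y hy).trans (le_abs_self B)) hQconv
        (hcurve t' ht') (hcurve t ht)
      refine key.trans ?_
      rw [mul_assoc]
      gcongr
      exact norm_axCurve_sub_le l (by linarith) t t'
    rw [← hlip.absolutelyContinuousOnInterval.integral_deriv_eq_sub, ← Real.norm_eq_abs, ofReal_norm,
      intervalIntegral.integral_of_le (by linarith)]
    refine (enorm_integral_le_lintegral_enorm _).trans ?_
    have hsub : Set.Ioc (-(1 - ε)) (1 - ε) ⊆ Set.Ioo (-1 : ℝ) 1 := fun t ht =>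
      ⟨by linarith [ht.1], by linarith [ht.2]⟩
    refine (lintegral_mono_set hsub).trans (setLIntegral_mono' measurableSet_Ioo fun t ht => ?_)
    have hta : |t| < 1 := abs_lt.2 ht
    have hb : axCurve l z t ∈ box (n + 1) 1 :=
      mem_box_of_le (by rwa [vert_axCurve]) (norm_horiz_axCurve_le h0 h1 hta.le hz)
    have := norm_deriv_comp_le (γ := axCurve l z) (t := t) (L := 2) (by norm_num)
      (fun t' => norm_axCurve_sub_le l (by linarith) t' t) (hdiff _ hb)
    have e2 : ∀ c : ℝ, 2 * ENNReal.ofReal c = ENNReal.ofReal (2 * c) := fun c => by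
      rw [ENNReal.ofReal_mul (by norm_num)]; simp
    rw [← ofReal_norm, ← ofReal_norm, e2]
    exact ENNReal.ofReal_le_ofReal this
  have hlim : Tendsto (fun ε : ℝ => ENNReal.ofReal |f (1 - ε) - f (-(1 - ε))|) (𝓝[>] 0)
      (𝓝 (ENNReal.ofReal |f 1 - f (-1)|)) := by
    have hc : Continuous fun ε : ℝ => |f (1 - ε) - f (-(1 - ε))| := by fun_prop
    have := hc.tendsto 0
    simp only [sub_zero] at this
    exact ENNReal.tendsto_ofReal (this.mono_left nhdsWithin_le_nhds)
  refine le_of_tendsto hlim ?_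
  filter_upwards [Ioo_mem_nhdsGT (zero_lt_one' ℝ)] with ε hε using hstep ε hε.1 hε.2

/-- The boundary values at the ends of the curves. -/
lemma axCurve_boundary {n : ℕ} {l : ℝ} (h0 : 0 < l) (h1 : l < 1 / 2) {χ v : Eu (n + 1) → ℝ}
    (hχ : IsBoxCutoff 2 3 χ) (hv : ∀ x, x ∉ box (n + 1) 1 → v x = axBarrier l x * χ x) {z : Eu n}
    (hz : ‖z‖ ≤ 1 / 2) {t : ℝ} (ht : |t| = 1) :
    v (axCurve l z t) = 1 / 2 * Real.sign t := by
  have hprob := isProbabilityMeasure_cantorMeasure h0 h1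
  set y := axCurve l z t with hy
  have hvy : vert y = t := vert_axCurve l z t
  have hhy : ‖horiz y‖ ≤ 3 / 4 := norm_horiz_axCurve_le h0 h1 ht.le hz
  have hout : y ∉ box (n + 1) 1 := by
    intro hmem
    have h1 : |vert y| < 1 := hmem (Fin.last n)
    rw [hvy, ht] at h1
    exact lt_irrefl _ h1
  have hin : y ∈ box (n + 1) 2 := by
    intro i
    refine Fin.lastCases ?_ (fun j => ?_) i
    · change |vert y| < 2
      rw [hvy, ht]; norm_num
    · exact lt_of_le_of_lt ((abs_coord_le (horiz y) j).trans hhy) (by norm_num)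
  have hval : axBarrier l y = 1 / 2 * Real.sign t := by
    have : ∀ᵐ r ∂cantorMeasure l,
        saddle (y - EuclideanSpace.single (Fin.last n) r) = 1 / 2 * Real.sign t := by
      filter_upwards [ae_mem_cantor h0 h1] with r hr
      have hr2 := abs_le.2 (cantor_subset l hr)
      have hd : 1 / 2 ≤ |t - r| := by
        have := abs_sub_abs_le_abs_sub t r
        linarith
      rw [saddle_of_cone (by rw [horiz_sub_single, vert_sub_single, hvy]; linarith),
        vert_sub_single, hvy]
      congr 1
      have hr3 := abs_le.1 hr2
      rcases (abs_eq zero_le_one).1 ht with rfl | rfl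
      · rw [Real.sign_of_pos (by linarith), Real.sign_of_pos (by linarith)]
      · rw [Real.sign_of_neg (by linarith), Real.sign_of_neg (by linarith)]
    rw [axBarrier, integral_congr_ae this]
    simp
  rw [hv y hout, hval, hχ.2.2.1 y hin, mul_one]

/-- The region covered by the curves: a conical shell around the axis. -/
def axCone (n : ℕ) (l : ℝ) : Set (Eu (n + 1)) :=
  {y | y ∈ box (n + 1) 1 ∧ axDist l y / 4 < ‖horiz y‖ ∧ ‖horiz y‖ < axDist l y / 2}

lemma measurableSet_axCone (n : ℕ) (l : ℝ) : MeasurableSet (axCone n l) := by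
  have h1 : Measurable (axDist (n := n) l) := (continuous_of_abs_sub_le (abs_axDist_sub_le l)).measurable
  have h2 : Measurable fun y : Eu (n + 1) => ‖horiz y‖ := continuous_horiz.norm.measurable
  exact (isOpen_box _ _).measurableSet.inter
    ((measurableSet_lt (h1.div_const 4) h2).inter (measurableSet_lt h2 (h1.div_const 2)))

lemma axWeight_of_mem_axCone {n : ℕ} {l α : ℝ} {χ : Eu (n + 1) → ℝ} (hχ : IsBoxCutoff 2 3 χ)
    {y : Eu (n + 1)} (hy : y ∈ axCone n l) : χ y * axWeight l α y = ‖horiz y‖ ^ α := by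
  have h := (isConeCutoff_axDist (n := n) l (κ := 1 / 2) (κ' := 2) (by norm_num)
    (by norm_num)).2.2.2.1 y (by linarith [hy.2.2])
  rw [axWeight, h, hχ.2.2.1 y (box_subset_box (by norm_num) hy.1)]
  ring

lemma lintegral_comp_smul_le {n : ℕ} {F : Eu n → ℝ≥0∞} (hF : Measurable F) {r : ℝ} (hr : 0 < r) :
    ∫⁻ z, F (r • z) = ENNReal.ofReal (r ^ (-(n : ℝ))) * ∫⁻ z, F z := by
  rw [← lintegral_map hF (measurable_const_smul r), Measure.map_addHaar_smul _ hr.ne',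
    lintegral_smul_measure, finrank_euclideanSpace_fin, abs_of_pos (by positivity), smul_eq_mul,
    Real.rpow_neg hr.le, Real.rpow_natCast]

/-- Integrating over the family of curves gives a weighted integral of the gradient over the shell. -/
lemma volume_le_lintegral_axCone {n : ℕ} {l : ℝ} (h0 : 0 < l) (h1 : l < 1 / 2)
    {χ v : Eu (n + 1) → ℝ} (hχ : IsBoxCutoff 2 3 χ) (hv : Continuous v)
    (hv1 : ContDiffOn ℝ 1 v (box (n + 1) 1))
    (hbd : ∀ x, x ∉ box (n + 1) 1 → v x = axBarrier l x * χ x) :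
    volume {z : Eu n | 1 / 4 < ‖z‖ ∧ ‖z‖ < 1 / 2} ≤
      ∫⁻ y in axCone n l, 2 * ‖fderiv ℝ v y‖ₑ * ENNReal.ofReal (axDist l y ^ (-(n : ℝ))) := by
  set Z : Set (Eu n) := {z | 1 / 4 < ‖z‖ ∧ ‖z‖ < 1 / 2} with hZ
  have hZm : MeasurableSet Z :=
    (measurableSet_lt measurable_const measurable_norm).inter
      (measurableSet_lt measurable_norm measurable_const)
  set F : Eu (n + 1) → ℝ≥0∞ := fun y => 2 * ‖fderiv ℝ v y‖ₑ with hF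
  have hFm : Measurable F := (measurable_fderiv ℝ v).enorm.const_mul 2
  set G : Eu (n + 1) → ℝ≥0∞ := (axCone n l).indicator
    (fun y => F y * ENNReal.ofReal (axDist l y ^ (-(n : ℝ)))) with hG
  have hdm : Measurable (axDist (n := n) l) :=
    (continuous_of_abs_sub_le (abs_axDist_sub_le l)).measurable
  have hGm : Measurable G :=
    (hFm.mul (hdm.pow_const _).ennreal_ofReal).indicator (measurableSet_axCone n l)
  have hcurve : ∀ z ∈ Z, 1 ≤ ∫⁻ t in Set.Ioo (-1 : ℝ) 1, F (axCurve l z t) := by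
    intro z hz
    have h2 := ofReal_sub_le_lintegral_axCurve h0 h1 hv hv1 hz.2.le
    rw [axCurve_boundary h0 h1 hχ hbd hz.2.le (by simp),
      axCurve_boundary h0 h1 hχ hbd hz.2.le (by simp), Real.sign_of_pos one_pos,
      Real.sign_of_neg (by norm_num)] at h2
    norm_num at h2
    exact h2
  have hjoint : Measurable fun p : Eu n × ℝ => F (axCurve l p.1 p.2) := by
    refine hFm.comp (continuous_join.comp (f := fun p : Eu n × ℝ =>
      (p.2, Metric.infDist p.2 (cantor l) • p.1)) ?_).measurable
    exact continuous_snd.prodMk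
      (((Metric.continuous_infDist_pt (cantor l)).comp continuous_snd).smul continuous_fst)
  calc volume Z = ∫⁻ _z in Z, 1 := by simp
    _ ≤ ∫⁻ z in Z, (∫⁻ t in Set.Ioo (-1 : ℝ) 1, F (axCurve l z t)) :=
        setLIntegral_mono' hZm hcurve
    _ = ∫⁻ t in Set.Ioo (-1 : ℝ) 1, (∫⁻ z in Z, F (axCurve l z t)) :=
        lintegral_lintegral_swap hjoint.aemeasurable
    _ ≤ ∫⁻ t in Set.Ioo (-1 : ℝ) 1, (∫⁻ z, G (join t z)) := by
        refine lintegral_mono_ae ?_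
        have hC : ∀ᵐ t : ℝ ∂volume.restrict (Set.Ioo (-1 : ℝ) 1), t ∉ cantor l :=
          ae_restrict_of_ae (measure_eq_zero_iff_ae_notMem.1 (volume_cantor h0 h1))
        filter_upwards [hC, ae_restrict_mem measurableSet_Ioo] with t ht htI
        have hta : |t| < 1 := abs_lt.2 htI
        set r := Metric.infDist t (cantor l) with hr
        have hr0 : 0 < r :=
          ((isClosed_cantor l).notMem_iff_infDist_pos (cantor_nonempty h0 h1)).1 ht
        have hGt : Measurable fun z : Eu n => G (join t z) :=
          hGm.comp (continuous_join.comp (Continuous.prodMk_right t)).measurable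
        have hpow : ENNReal.ofReal (r ^ (-(n : ℝ))) ≠ 0 := by
          have : 0 < r ^ n := by positivity
          simpa using this
        -- the section of the shell at height `t` is the set `Z` scaled by `r`
        have key := lintegral_comp_smul_le hGt hr0
        have hle : ∫⁻ z in Z, F (axCurve l z t) * ENNReal.ofReal (r ^ (-(n : ℝ))) ≤
            ∫⁻ z, G (join t (r • z)) := by
          rw [← lintegral_indicator hZm]
          refine lintegral_mono fun z => ?_
          by_cases hz : z ∈ Z
          · have hax : axDist l (join t (r • z)) = r := by rw [axDist, vert_join]
            have hnh : ‖horiz (join t (r • z))‖ = r * ‖z‖ := by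
              rw [horiz_join, norm_smul, Real.norm_eq_abs, abs_of_pos hr0]
            have hmem : join t (r • z) ∈ axCone n l := by
              refine ⟨mem_box_of_le (by rwa [vert_join])
                (norm_horiz_axCurve_le h0 h1 hta.le hz.2.le), ?_, ?_⟩
              · rw [hax, hnh]; nlinarith [hz.1]
              · rw [hax, hnh]; nlinarith [hz.2]
            rw [Set.indicator_of_mem hz, hG, Set.indicator_of_mem hmem, hax]
            exact le_rfl
          · rw [Set.indicator_of_notMem hz]; exact zero_le
        rw [key, lintegral_mul_const' _ _ ENNReal.ofReal_ne_top, mul_comm] at hle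
        exact (ENNReal.mul_le_mul_iff_right hpow ENNReal.ofReal_ne_top).1 hle
    _ ≤ ∫⁻ t, (∫⁻ z, G (join t z)) := setLIntegral_le_lintegral _ _
    _ = ∫⁻ y, G y := (lintegral_split hGm).symm
    _ = _ := lintegral_indicator (measurableSet_axCone n l) _

/-- A function that is continuously differentiable in the domain and has the boundary values of the
barrier function changes by `1` along each of the curves. They meet the complement of the active
region only in the Cantor set, a null set of heights, so that the gradient in the active region has to
account for the change. -/
lemma exists_lower_bound_axWeight {n : ℕ} {q α l : ℝ} (hn : 1 ≤ n) (hq : 1 < q) (hα : 0 < α)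
    (hα1 : α ≤ 1) (h0 : 0 < l) (h1 : l < 1 / 2) (hcap : cantorExp l * (q - 1) < q - (n + 1) - α)
    {χ : Eu (n + 1) → ℝ} (hχ : IsBoxCutoff 2 3 χ) :
    ∃ c : ℝ≥0∞, 0 < c ∧
      ∀ v ∈ {v : Eu (n + 1) → ℝ | Continuous v ∧ ContDiffOn ℝ 1 v (box (n + 1) 1)},
      (∀ x, x ∉ box (n + 1) 1 → v x = axBarrier l x * χ x) →
      c ≤ localEnergy q (fun x => χ x * axWeight l α x) v := by
  obtain ⟨A, hA, hvol⟩ := exists_volume_axMax_lt_le n h0 h1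
  have hE0 := cantorExp_pos h0 h1
  have hE1 := cantorExp_lt_one h0 h1
  have hq0 : 0 < q := by linarith
  have hq1 : 0 < q - 1 := by linarith
  have hn0 : (0 : ℝ) ≤ n := Nat.cast_nonneg n
  set S := axCone n l with hS
  have hSm : MeasurableSet S := measurableSet_axCone n l
  set D : Eu (n + 1) → ℝ := fun y => min 1 (axMax l y) with hD
  have hDm : Measurable D :=
    (continuous_const.min (continuous_of_abs_sub_le (abs_axMax_sub_le l))).measurable
  have hSδ : ∀ y ∈ S, 0 < axDist l y ∧ D y ≤ axDist l y ∧ 0 < D y := by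
    intro y hy
    have h2 : 0 < axDist l y := by
      have := hy.2.1.trans hy.2.2
      linarith
    have h3 : axMax l y = axDist l y := max_eq_left (by linarith [hy.2.2])
    refine ⟨h2, ?_, lt_min one_pos (by rwa [h3])⟩
    rw [← h3]; exact min_le_right _ _
  set γ : ℝ := (n + α / q) * (q / (q - 1)) with hγdef
  have hγ0 : 0 ≤ γ := by positivity
  -- the exponent is admissible exactly for dimensions below the upper threshold
  have hγ : γ < n + 1 - cantorExp l := by
    rw [hγdef, ← mul_div_assoc, div_lt_iff₀ hq1]
    have : ((n : ℝ) + α / q) * q = n * q + α := by field_simp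
    rw [this]
    nlinarith
  have hK : ∫⁻ x in S, ENNReal.ofReal ((D x / 4) ^ (-γ)) < ⊤ := by
    have e : ∀ x, ENNReal.ofReal ((D x / 4) ^ (-γ)) ≤
        ENNReal.ofReal (4 ^ γ) * ENNReal.ofReal (D x ^ (-γ)) := by
      intro x
      have hD0 : 0 ≤ D x := le_min zero_le_one ((axDist_nonneg l x).trans (le_max_left _ _))
      rw [← ENNReal.ofReal_mul (by positivity), Real.div_rpow hD0 (by norm_num),
        Real.rpow_neg (by norm_num : (0 : ℝ) ≤ 4), div_inv_eq_mul, mul_comm]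
    refine (lintegral_mono e).trans_lt ?_
    rw [lintegral_const_mul' _ _ ENNReal.ofReal_ne_top]
    refine ENNReal.mul_lt_top ENNReal.ofReal_lt_top ?_
    refine (lintegral_rpow_neg_le (κ := n + 1 - cantorExp l)
      (A := ENNReal.ofReal (A * 2 ^ (n + 1 - cantorExp l)) +
        volume (box (n + 1) 3) * ENNReal.ofReal (2 ^ (n + 1 - cantorExp l))) hDm
      ((ae_restrict_iff' hSm).2 (Eventually.of_forall fun y hy => ⟨(hSδ y hy).2.2, min_le_left _ _⟩))
      hγ0 fun t ht _ => ?_).trans_lt (ENNReal.mul_lt_top (ENNReal.add_lt_top.2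
        ⟨ENNReal.ofReal_lt_top, ENNReal.mul_lt_top (volume_box_lt_top _ _) ENNReal.ofReal_lt_top⟩)
        (layerConst_lt_top hγ))
    refine le_trans ?_ (volume_min_lt_le (by linarith) hA hvol t ht)
    exact Measure.restrict_mono (fun y hy => box_subset_box (by norm_num) hy.1) le_rfl _
  have hZpos : 0 < volume {z : Eu n | 1 / 4 < ‖z‖ ∧ ‖z‖ < 1 / 2} := by
    have hop : IsOpen {z : Eu n | 1 / 4 < ‖z‖ ∧ ‖z‖ < 1 / 2} :=
      (isOpen_lt continuous_const continuous_norm).inter (isOpen_lt continuous_norm continuous_const)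
    refine hop.measure_pos _ ⟨EuclideanSpace.single ⟨0, hn⟩ (1 / 3 : ℝ), ?_⟩
    rw [Set.mem_ofPred_eq, PiLp.norm_single]
    norm_num
  obtain ⟨c, hc, hlow⟩ := exists_lower_bound_of_integral (σ := n) (α := α) hq
    (a := fun x => χ x * axWeight l α x) (h := fun y => D y / 4) hSm (fun y hy => hy.1)
    (hDm.div_const 4) (fun y hy => ⟨by have := (hSδ y hy).2.2; positivity, by
      rw [axWeight_of_mem_axCone hχ hy]
      obtain ⟨_, h3, h4⟩ := hSδ y hy
      exact Real.rpow_le_rpow (by positivity) (by linarith [hy.2.1]) hα.le⟩)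
    (ENNReal.div_pos hZpos.ne' (by norm_num : (2 : ℝ≥0∞) ≠ ⊤)) hK
  refine ⟨c, hc, fun v hv hbd => ?_⟩
  obtain ⟨hvc, hv1⟩ := hv
  refine le_iInf₂ fun g hg => ?_
  set U := box (n + 1) 1 ∩ {x | 0 < χ x * axWeight l α x} with hUdef
  have hUo : IsOpen U := isOpen_active (isWeight_axWeight l hα hα1 hχ).2.2.1.1.continuous
  have hSU : S ⊆ U := fun y hy => ⟨hy.1, by
    rw [Set.mem_ofPred_eq, axWeight_of_mem_axCone hχ hy]
    exact Real.rpow_pos_of_pos (lt_trans (by have := (hSδ y hy).1; positivity) hy.2.1) _⟩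
  have hgS : AEStronglyMeasurable g (volume.restrict S) :=
    hg.2.1.aestronglyMeasurable.mono_measure (Measure.restrict_mono hSU le_rfl)
  refine hlow g hgS (ENNReal.div_le_of_le_mul ?_)
  refine (volume_le_lintegral_axCone h0 h1 hχ hvc hv1 hbd).trans ?_
  rw [mul_comm, ← lintegral_const_mul' _ _ (by norm_num)]
  have hae := hg.ae_eq hUo (hasWeakGradientOn_of_contDiffOn hUo (hv1.mono Set.inter_subset_left))
  refine setLIntegral_mono_ae' hSm ?_
  filter_upwards [hae] with y hy hyS
  rw [hy (hSU hyS), mul_assoc]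
  have e : ‖fderiv ℝ v y‖ₑ = ‖gradient v y‖ₑ := by
    rw [← ofReal_norm, ← ofReal_norm, gradient, LinearIsometryEquiv.norm_map]
  rw [e]
  obtain ⟨h2, h3, h4⟩ := hSδ y hyS
  gcongr 3
  exact Real.rpow_le_rpow_of_nonpos (by positivity) (by linarith) (by simp)

/-! ### A jump along the boundary -/

/-- The box cut-off itself is a weight of any positive order; the constant `h = 1` makes the symbol
estimates a statement about bounded derivatives. -/
lemma IsBoxCutoff.isWeight {m : ℕ} {α : ℝ} (hα : 0 < α) {χ : Eu m → ℝ} (hχ : IsBoxCutoff 2 3 χ) :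
    IsWeight α χ := by
  refine ⟨fun x => (hχ.2.1 x).1, ⟨1, fun x => (hχ.2.1 x).2⟩, ?_, hχ.2.2.2⟩
  obtain ⟨h1, h2⟩ := isSymbol_of_hasCompactSupport (h := fun _ : Eu m => (1 : ℝ)) (R := 1) hχ.1
    hχ.hasCompactSupport fun _ _ => le_rfl
  refine isHolder_of_isSymbol hα (h := fun _ : Eu m => (1 : ℝ)) (fun _ => zero_le_one)
    (fun x y => by simp) (fun x hx => absurd hx one_ne_zero) ⟨h1, fun j => ?_⟩
  obtain ⟨C, hC⟩ := h2 j
  exact ⟨C, fun x hx => by simpa using hC x hx⟩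

/-- The distance, in the supremum norm, to the boundary of the box. -/
def boundaryDist {m : ℕ} (x : Eu m) : ℝ := |‖WithLp.ofLp x‖ - 1|

lemma mem_box_one_iff {m : ℕ} (x : Eu m) : x ∈ box m 1 ↔ ‖WithLp.ofLp x‖ < 1 := by
  rw [pi_norm_lt_iff one_pos]; rfl

lemma abs_supNorm_sub_le {m : ℕ} (x y : Eu m) :
    |‖WithLp.ofLp x‖ - ‖WithLp.ofLp y‖| ≤ ‖x - y‖ := by
  refine (abs_norm_sub_norm_le _ _).trans ?_
  refine (pi_norm_le_iff_of_nonneg (norm_nonneg _)).2 fun i => ?_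
  exact abs_coord_le (x - y) i

lemma boundaryDist_le_of_mem_of_notMem {m : ℕ} {x y : Eu m} (h : ¬(x ∈ box m 1 ↔ y ∈ box m 1)) :
    boundaryDist x ≤ ‖x - y‖ := by
  refine le_trans ?_ (abs_supNorm_sub_le x y)
  rw [mem_box_one_iff, mem_box_one_iff] at h
  rw [boundaryDist]
  rcases lt_or_ge ‖WithLp.ofLp x‖ 1 with h1 | h1 <;> rcases lt_or_ge ‖WithLp.ofLp y‖ 1 with h2 | h2
  · exact absurd ⟨fun _ => h2, fun _ => h1⟩ h
  · rw [abs_of_neg (by linarith), abs_of_neg (by linarith)]; linarith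
  · rw [abs_of_nonneg (by linarith), abs_of_nonneg (by linarith)]; linarith
  · exact absurd ⟨fun h => absurd h (not_lt.2 h1), fun h => absurd h (not_lt.2 h2)⟩ h

lemma continuous_boundaryDist {m : ℕ} : Continuous (boundaryDist (m := m)) :=
  ((PiLp.continuous_ofLp 2 _).norm.sub continuous_const).abs

lemma volume_abs_abs_sub_one_lt (t : ℝ) :
    volume {r : ℝ | |(|r| - 1)| < t} ≤ ENNReal.ofReal (4 * t) := by
  have hsub : {r : ℝ | |(|r| - 1)| < t} ⊆ Set.Ioo (1 - t) (1 + t) ∪ Set.Ioo (-1 - t) (-1 + t) := by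
    intro r hr
    have hr : |(|r| - 1)| < t := hr
    have hr := abs_lt.1 hr
    rcases abs_cases r with ⟨h, _⟩ | ⟨h, _⟩
    · rw [h] at hr
      exact Or.inl ⟨by linarith [hr.1], by linarith [hr.2]⟩
    · rw [h] at hr
      exact Or.inr ⟨by linarith [hr.2], by linarith [hr.1]⟩
  refine (measure_mono hsub).trans ((measure_union_le _ _).trans ?_)
  rw [Real.volume_Ioo, Real.volume_Ioo]
  rcases le_total 0 t with ht | ht
  · rw [← ENNReal.ofReal_add (by linarith) (by linarith)]
    exact ENNReal.ofReal_le_ofReal (by linarith)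
  · rw [ENNReal.ofReal_of_nonpos (by linarith), ENNReal.ofReal_of_nonpos (by linarith)]
    simp

lemma volume_boundaryDist_lt_le {m : ℕ} (hm : 0 < m) {t : ℝ} (ht : 0 < t) :
    volume.restrict (box m 3) {x | boundaryDist x < t} ≤ ENNReal.ofReal (m * 4 * 6 ^ (m - 1) * t) := by
  have : Nonempty (Fin m) := ⟨⟨0, hm⟩⟩
  set S : Fin m → Fin m → Set ℝ := fun i j =>
    if j = i then {r : ℝ | |(|r| - 1)| < t} else Set.Ioo (-3) 3 with hS
  have hmeas : MeasurableSet {x : Eu m | boundaryDist x < t} :=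
    measurableSet_lt continuous_boundaryDist.measurable measurable_const
  rw [Measure.restrict_apply hmeas]
  have hsub : {x : Eu m | boundaryDist x < t} ∩ box m 3 ⊆ ⋃ i, {x : Eu m | ∀ j, x j ∈ S i j} := by
    rintro x ⟨hx, hb⟩
    -- the supremum norm is attained by one of the coordinates
    obtain ⟨i, hi⟩ : ∃ i, ‖WithLp.ofLp x‖ = |x i| := by
      obtain ⟨i, -, hi⟩ := Finset.exists_mem_eq_sup' (Finset.univ_nonempty (α := Fin m))
        (fun i => ‖x i‖)
      refine ⟨i, le_antisymm ?_ (norm_le_pi_norm (WithLp.ofLp x) i)⟩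
      refine (pi_norm_le_iff_of_nonneg (abs_nonneg _)).2 fun j => ?_
      rw [← Real.norm_eq_abs, ← hi]
      exact Finset.le_sup' (fun i => ‖x i‖) (Finset.mem_univ j)
    refine Set.mem_iUnion.2 ⟨i, fun j => ?_⟩
    simp only [hS]
    split_ifs with hij
    · have hx : |‖WithLp.ofLp x‖ - 1| < t := hx
      rw [hij, Set.mem_ofPred_eq, ← hi]
      exact hx
    · exact abs_lt.1 (hb j)
  have hone : ∀ i, volume {x : Eu m | ∀ j, x j ∈ S i j} ≤ ENNReal.ofReal (4 * 6 ^ (m - 1) * t) := by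
    intro i
    rw [volume_setOf_forall_mem, ← Finset.mul_prod_erase _ _ (Finset.mem_univ i)]
    have h1 : volume (S i i) ≤ ENNReal.ofReal (4 * t) := by
      simp only [hS, if_true]
      exact volume_abs_abs_sub_one_lt t
    have h2 : ∏ j ∈ Finset.univ.erase i, volume (S i j) = ENNReal.ofReal (6 ^ (m - 1)) := by
      rw [Finset.prod_congr rfl (g := fun _ => ENNReal.ofReal 6), Finset.prod_const,
        Finset.card_erase_of_mem (Finset.mem_univ i), Finset.card_univ, Fintype.card_fin,
        ENNReal.ofReal_pow (by norm_num)]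
      intro j hj
      simp only [hS, if_neg (Finset.ne_of_mem_erase hj)]
      rw [Real.volume_Ioo]; norm_num
    rw [h2]
    calc _ ≤ ENNReal.ofReal (4 * t) * ENNReal.ofReal (6 ^ (m - 1)) := by gcongr
      _ = _ := by rw [← ENNReal.ofReal_mul (by positivity)]; congr 1; ring
  calc _ ≤ ∑ i, volume {x : Eu m | ∀ j, x j ∈ S i j} :=
        (measure_mono hsub).trans (measure_iUnion_fintype_le _ _)
    _ ≤ ∑ _i : Fin m, ENNReal.ofReal (4 * 6 ^ (m - 1) * t) := Finset.sum_le_sum fun i _ => hone i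
    _ = _ := by
        rw [Finset.sum_const, Finset.card_univ, Fintype.card_fin, nsmul_eq_mul,
          ← ENNReal.ofReal_natCast, ← ENNReal.ofReal_mul (by positivity)]
        congr 1; ring

/-- For `s p < 1` a jump along the boundary of the box has finite nonlocal energy. -/
lemma nonlocalEnergy_jump_lt_top {m : ℕ} (hm : 0 < m) {s p : ℝ} (hs0 : 0 < s) (hs1 : s < 1)
    (hp : 1 < p) (hsp : s * p < 1) {ζ w : Eu m → ℝ} (hζ : ContDiff ℝ ∞ ζ) (hζc : HasCompactSupport ζ)
    (hζ0 : ∀ x ∉ box m 3, ζ x = 0) (hw : Measurable w) (hw1 : ∀ x, |w x| ≤ 1)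
    (hjump : ∀ x y, (x ∈ box m 1 ↔ y ∈ box m 1) → w x = w y) :
    nonlocalEnergy s p (fun x => ζ x * w x) < ⊤ := by
  refine nonlocalEnergy_cutoff_mul_lt_top hm (θ := 0) (κ := 1) (C := 2) (M := 1)
    (D := fun x => min 1 (boundaryDist x)) (A := ENNReal.ofReal (m * 4 * 6 ^ (m - 1) * 2 ^ (1 : ℝ)) +
      volume (box m 3) * ENNReal.ofReal (2 ^ (1 : ℝ))) hs1 hp le_rfl hs0 (by simpa using hsp)
    (ENNReal.add_lt_top.2 ⟨ENNReal.ofReal_lt_top,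
      ENNReal.mul_lt_top (volume_box_lt_top _ _) ENNReal.ofReal_lt_top⟩)
    hw hw1 (continuous_const.min continuous_boundaryDist).measurable (fun x => min_le_left _ _)
    (fun t ht _ => volume_restrict_min_lt_le zero_le_one (by positivity) (fun t ht _ => by
      rw [Real.rpow_one]; exact volume_boundaryDist_lt_le hm ht) t ht)
    (fun x hx y => ?_) hζ hζc hζ0
  by_cases h : x ∈ box m 1 ↔ y ∈ box m 1
  · rw [hjump x y h, sub_self, abs_zero]
    constructor <;> positivity
  · have h2 : |w x - w y| ≤ 2 := (abs_sub _ _).trans (by linarith [hw1 x, hw1 y])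
    have h3 : min 1 (boundaryDist x) ≤ ‖x - y‖ :=
      (min_le_right _ _).trans (boundaryDist_le_of_mem_of_notMem h)
    refine ⟨by rw [Real.rpow_zero, mul_one]; exact h2, ?_⟩
    rw [zero_sub, Real.rpow_neg_one, ← div_eq_mul_inv]
    have : 1 ≤ ‖x - y‖ / min 1 (boundaryDist x) := (one_le_div hx).2 h3
    linarith

/-- If `s p < 1`, the nonlocal phase admits jumps along the boundary. The competitor that vanishes in
the domain has no local energy. The boundary values are `x_d` near the closure of the domain, and the
derivative in the direction of `x_d` of `x_d + φ`, for a test function `φ`, has mean `1`. -/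
lemma exists_lavrentievGap_boundary {n : ℕ} {s p q α : ℝ} (hs0 : 0 < s) (hs1 : s < 1) (hp : 1 < p)
    (hq : 1 < q) (hα : 0 < α) (hsp : s * p < 1) :
    ∃ a u : Eu (n + 1) → ℝ, IsWeight α a ∧ IsBoundaryValue u ∧ LavrentievGap s p q a u := by
  obtain ⟨χ, hχ⟩ := exists_isBoxCutoff (n + 1) (show (0 : ℝ) < 2 by norm_num)
    (show (2 : ℝ) < 3 by norm_num)
  set Ω := box (n + 1) 1 with hΩ
  have hΩo : IsOpen Ω := isOpen_box _ _
  set ζ : Eu (n + 1) → ℝ := fun x => χ x * vert x with hζdef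
  set w : Eu (n + 1) → ℝ := Ω.indicator 1 with hw
  have hζ : ContDiff ℝ ∞ ζ := hχ.1.mul contDiff_vert
  have hζc : HasCompactSupport ζ := hχ.hasCompactSupport.mul_right
  have hζ0 : ∀ x ∉ box (n + 1) 3, ζ x = 0 := fun x hx => by simp [hζdef, hχ.2.2.2 x hx]
  have hwm : Measurable w := measurable_one.indicator hΩo.measurableSet
  have hwin : ∀ x ∈ Ω, w x = 1 := fun x hx => Set.indicator_of_mem hx _
  have hwout : ∀ x ∉ Ω, w x = 0 := fun x hx => Set.indicator_of_notMem hx _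
  have hw01 : ∀ x, w x = 1 ∨ w x = 0 := fun x => by
    by_cases hx : x ∈ Ω
    · exact Or.inl (hwin x hx)
    · exact Or.inr (hwout x hx)
  have hjump : ∀ x y, (x ∈ Ω ↔ y ∈ Ω) → w x = w y := fun x y h => by
    by_cases hx : x ∈ Ω
    · rw [hwin x hx, hwin y (h.1 hx)]
    · rw [hwout x hx, hwout y fun hy => hx (h.2 hy)]
  have hχ1 : ∀ x ∈ Ω, χ x = 1 := fun x hx => hχ.2.2.1 x (box_subset_box (by norm_num) hx)
  have hac : Continuous χ := hχ.1.continuous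
  have hact : Ω ∩ {x | 0 < χ x} = Ω :=
    Set.inter_eq_left.2 fun x hx => by rw [Set.mem_ofPred_eq, hχ1 x hx]; exact one_pos
  have hζΩ : ∀ x ∈ Ω, ζ =ᶠ[𝓝 x] vert := fun x hx => by
    filter_upwards [hΩo.mem_nhds hx] with y hy
    simp only [hζdef]
    rw [hχ1 y hy, one_mul]
  have hdiff : (fun x => ζ x * (1 - w x) - ζ x) = fun x => -ζ x * w x := by funext x; ring
  set e : Eu (n + 1) := EuclideanSpace.single (Fin.last n) 1 with he
  have hen : ‖e‖ = 1 := by rw [he, PiLp.norm_single, norm_one]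
  have hvol0 : 0 < volume Ω := hΩo.measure_pos _ ⟨0, fun i => by simp⟩
  obtain ⟨c, hc, hlow⟩ := exists_lower_bound_of_integral (σ := 0) (α := α) hq (a := χ)
    (h := fun _ => 1) hΩo.measurableSet (subset_refl Ω) measurable_const
    (fun x hx => ⟨one_pos, by rw [Real.one_rpow, hχ1 x hx]⟩) hvol0
    (by simpa using volume_box_lt_top (n + 1) 1)
  have key : ∀ φ, IsTestFunction Ω φ → c ≤ localEnergy q χ (fun x => ζ x + φ x) := by
    intro φ hφ
    refine le_iInf₂ fun g hg => ?_
    rw [← hΩ, hact] at hg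
    refine hlow g hg.2.1.aestronglyMeasurable ?_
    have hv : ContDiff ℝ ∞ (fun x => ζ x + φ x) := hζ.add hφ.1
    have hae := hg.ae_eq hΩo (hasWeakGradientOn_of_contDiffOn hΩo
      (hv.of_le (by norm_num)).contDiffOn)
    have hφ0 : ∫ x in Ω, fderiv ℝ φ x e = 0 := by
      have h1 := (hasWeakGradientOn_of_contDiffOn hΩo
        (contDiff_const (c := (1 : ℝ))).contDiffOn).2.2 φ hφ e
      have h2 : ∀ x : Eu (n + 1), gradient (fun _ : Eu (n + 1) => (1 : ℝ)) x = 0 := fun x => by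
        simp [gradient]
      simpa [h2] using h1
    have hφi : IntegrableOn (fun x => fderiv ℝ φ x e) Ω :=
      ((hφ.continuous_fderiv_apply e).integrable_of_hasCompactSupport
        (hφ.2.1.fderiv_apply ℝ e)).integrableOn
    have hone : IntegrableOn (fun _ : Eu (n + 1) => (1 : ℝ)) Ω :=
      integrableOn_const (volume_box_lt_top _ _).ne
    have hint : ∫ x in Ω, (1 + fderiv ℝ φ x e) = (volume Ω).toReal := by
      rw [integral_add hone hφi, hφ0, add_zero, setIntegral_const, smul_eq_mul, mul_one]
      rfl
    calc volume Ω = ‖(volume Ω).toReal‖ₑ := by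
          rw [Real.enorm_of_nonneg ENNReal.toReal_nonneg,
            ENNReal.ofReal_toReal (volume_box_lt_top _ _).ne]
      _ ≤ ∫⁻ x in Ω, ‖1 + fderiv ℝ φ x e‖ₑ := by
          rw [← hint]; exact enorm_integral_le_lintegral_enorm _
      _ ≤ _ := by
          refine setLIntegral_mono_ae' hΩo.measurableSet ?_
          filter_upwards [hae] with x hx hxΩ
          have h1 : fderiv ℝ (fun x => ζ x + φ x) x e = 1 + fderiv ℝ φ x e := by
            rw [fderiv_fun_add ((hζ.differentiable (by norm_num)) x)
              ((hφ.1.differentiable (by norm_num)) x), (hζΩ x hxΩ).fderiv_eq]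
            have : fderiv ℝ (vert : Eu (n + 1) → ℝ) x = vertL n := (vertL n).fderiv
            rw [add_apply, this, vertL_apply, he, vert_single]
          have h2 : inner ℝ (g x) e = 1 + fderiv ℝ φ x e := by
            rw [hx hxΩ, ← h1, gradient, InnerProductSpace.toDual_symm_apply]
          rw [← h2]
          simp only [neg_zero, Real.rpow_zero, ENNReal.ofReal_one, mul_one]
          rw [← ofReal_norm, ← ofReal_norm]
          refine ENNReal.ofReal_le_ofReal ((norm_inner_le_norm _ _).trans ?_)
          rw [hen, mul_one]
  refine (realizesGap_of_lower_bound (V := {v | ∃ φ, IsTestFunction Ω φ ∧ v = fun x => ζ x + φ x})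
    (α := α) (uC := fun x => ζ x * (1 - w x)) hq
    (nonlocalEnergy_jump_lt_top (Nat.succ_pos n) hs0 hs1 hp hsp hζ hζc hζ0
      (measurable_const.sub hwm) (fun x => by rcases hw01 x with h | h <;> simp [h])
      fun x y h => by rw [hjump x y h]) ?_ ⟨c, hc, ?_⟩ (fun φ hφ => ⟨φ, hφ, rfl⟩)
    (hχ.isWeight hα) ⟨hζ, hζ0⟩ ?_ ?_ ?_ ?_).exists_lavrentievGap
  · refine localEnergy_eq_zero hq hac (fun x => (hχ.2.1 x).1) fun x hx => ⟨0, ?_⟩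
    filter_upwards [hΩo.mem_nhds hx.1] with y hy
    rw [hwin y hy]; ring
  · rintro v ⟨φ, hφ, rfl⟩ _
    exact key φ hφ
  · rw [hdiff]
    refine (hζ.continuous.integrable_of_hasCompactSupport hζc).locallyIntegrable.mono
      (hζ.continuous.measurable.neg.mul hwm).aestronglyMeasurable
      (Eventually.of_forall fun x => ?_)
    rcases hw01 x with h | h <;> simp [h]
  · rw [hdiff]
    exact nonlocalEnergy_jump_lt_top (Nat.succ_pos n) hs0 hs1 hp hsp hζ.neg hζc.neg
      (fun x hx => by simp [hζ0 x hx]) hwm (fun x => by rcases hw01 x with h | h <;> simp [h]) hjump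
  · rw [hdiff]
    have hloc : ∀ x ∈ Ω, (fun x => -ζ x * w x) =ᶠ[𝓝 x] fun x => -vert x := fun x hx => by
      filter_upwards [hΩo.mem_nhds hx, hζΩ x hx] with y h1 h2
      rw [hwin y h1, h2, mul_one]
    refine localEnergy_lt_top (C := 1) hq hac (fun x => (hχ.2.1 x).1) (fun x => (hχ.2.1 x).2)
      (fun x hx => ?_) fun x hx => ?_
    · exact (((contDiff_vert.of_le (by norm_num)).neg.contDiffAt).congr_of_eventuallyEq
        (hloc x hx.1)).contDiffWithinAt
    · rw [(hloc x hx.1).fderiv_eq]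
      refine norm_fderiv_le_of_lip' ℝ zero_le_one (Eventually.of_forall fun y => ?_)
      rw [one_mul, Real.norm_eq_abs, neg_sub_neg, ← vert_sub, norm_sub_rev]
      exact abs_vert_le _
  · refine Eventually.of_forall fun x hx => ?_
    rw [hwout x hx]; ring

/-! ### The choice of the Cantor sets -/

/-- The gap of the subcritical case for a suitable barrier. -/
lemma exists_lavrentievGap_latBarrier {n : ℕ} (hn : 1 ≤ n) {s p q α : ℝ} (hs0 : 0 < s) (hs1 : s < 1)
    (hp : 1 < p) (hq : 1 < q) (hα : 0 < α) (hsub : s * p < n + 1) (hsq : s * p + α < q) :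
    ∃ a u : Eu (n + 1) → ℝ, IsWeight α a ∧ IsBoundaryValue u ∧ LavrentievGap s p q a u := by
  -- the barriers have codimension greater than `1`, so that the lower bound requires `q > 1 + α`; otherwise
  -- `s p < q - α ≤ 1` and the jump can be put on the boundary
  rcases le_or_gt q (1 + α) with hqα | hqα
  · exact exists_lavrentievGap_boundary hs0 hs1 hp hq hα (by linarith)
  have hn1 : (1 : ℝ) ≤ n := by exact_mod_cast hn
  obtain ⟨D, hD1, hD2⟩ : ∃ D, max 0 (n + 1 + α - q) < D ∧ D < min (n : ℝ) (n + 1 - s * p) :=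
    exists_between (max_lt (lt_min (by linarith) (by linarith)) (lt_min (by linarith) (by linarith)))
  have hD0 : 0 < D := (le_max_left _ _).trans_lt hD1
  have hDn : D < n := hD2.trans_le (min_le_left _ _)
  obtain ⟨l, h0, h1, hl⟩ := exists_cantorExp_eq (D := D / n) (by positivity)
    ((div_lt_one (by linarith)).2 hDn)
  have hdim : cantorDim n l = D := by rw [cantorDim_eq, hl]; field_simp
  obtain ⟨η, hη⟩ := exists_isBoxCutoff (n + 1) (show (0 : ℝ) < 4 / 6 by norm_num)
    (show (4 / 6 : ℝ) < 5 / 6 by norm_num)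
  obtain ⟨χ, hχ⟩ := exists_isBoxCutoff (n + 1) (show (0 : ℝ) < 2 by norm_num)
    (show (2 : ℝ) < 3 by norm_num)
  have g1 := (le_max_right _ _).trans_lt hD1
  have g2 := hD2.trans_le (min_le_right _ _)
  exact (realizesGap_latBarrier hs0 hs1 hp hq hα h0 h1 (by rw [hdim]; linarith) hη hχ
    (exists_lower_bound_latWeight hq hα h0 h1 (by rw [hdim]; linarith) hχ)).exists_lavrentievGap

/-- The gap of the supercritical case for a suitable barrier and a weight of positive order. -/
lemma exists_lavrentievGap_axBarrier {n : ℕ} (hn : 1 ≤ n) {s p q α : ℝ} (hs0 : 0 < s) (hs1 : s < 1)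
    (hp : 1 < p) (hq : 1 < q) (hα : 0 < α) (hα1 : α ≤ 1) (hsup : n + 1 < s * p)
    (hpq : (s * p - (n + 1)) / (p - 1) < (q - (n + 1) - α) / (q - 1)) :
    ∃ a u : Eu (n + 1) → ℝ, IsWeight α a ∧ IsBoundaryValue u ∧ LavrentievGap s p q a u := by
  have hn1 : (1 : ℝ) ≤ n := by exact_mod_cast hn
  obtain ⟨D, hD1, hD2⟩ := exists_between hpq
  have hp1 : 0 < p - 1 := by linarith
  have hq1 : 0 < q - 1 := by linarith
  have hD0 : 0 < D := (div_pos (by linarith) hp1).trans hD1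
  have hDlt : D < 1 := hD2.trans ((div_lt_one hq1).2 (by linarith))
  obtain ⟨l, h0, h1, hl⟩ := exists_cantorExp_eq hD0 hDlt
  obtain ⟨η, hη⟩ := exists_isBoxCutoff (n + 1) (show (0 : ℝ) < 4 / 6 by norm_num)
    (show (4 / 6 : ℝ) < 5 / 6 by norm_num)
  obtain ⟨χ, hχ⟩ := exists_isBoxCutoff (n + 1) (show (0 : ℝ) < 2 by norm_num)
    (show (2 : ℝ) < 3 by norm_num)
  rw [div_lt_iff₀ hp1] at hD1
  rw [lt_div_iff₀ hq1] at hD2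
  exact (realizesGap_axBarrier hs0 hs1 hp hq hα hα1 h0 h1 (by rw [hl]; exact hD1) hη hχ
    (exists_lower_bound_axWeight hn hq hα hα1 h0 h1 (by rw [hl]; exact hD2) hχ)).exists_lavrentievGap

/-- Weights of positive order are in particular weights of order `0`. -/
lemma IsWeight.zero {m : ℕ} {α : ℝ} {a : Eu m → ℝ} (h : IsWeight α a) : IsWeight 0 a := by
  obtain ⟨h0, ⟨M, hM⟩, ⟨hcd, -⟩, hz⟩ := h
  refine ⟨h0, ⟨M, hM⟩, ?_, hz⟩
  have hk : ⌈(0 : ℝ)⌉₊ - 1 = 0 := by simp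
  rw [IsHolder, hk]
  refine ⟨contDiff_zero.2 hcd.continuous, M, fun x y => ?_⟩
  rw [iteratedFDeriv_zero_eq_comp]
  simp only [Function.comp_apply]
  rw [← map_sub, LinearIsometryEquiv.norm_map, Real.norm_eq_abs]
  simp only [Nat.cast_zero, sub_zero, Real.rpow_zero, mul_one]
  rw [abs_le]
  constructor <;> linarith [h0 x, h0 y, hM x, hM y]

end

end MixedModel

theorem mainTheorem4 (n : ℕ) (hn : 1 ≤ n) (d : ℝ) (hd : d = n + 1) (s p q α : ℝ)
    (hs₀ : 0 < s) (hs₁ : s < 1) (hp : 1 < p) (hq : 1 < q) :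
    -- subcritical case
    (s - d / p < 0 → 0 < α → s * p + α < q →
      ∃ a u : EuclideanSpace ℝ (Fin (n + 1)) → ℝ,
        IsWeight α a ∧ IsBoundaryValue u ∧ LavrentievGap s p q a u) ∧
    -- supercritical case
    (0 < s - d / p → 0 ≤ α → α ≤ 1 →
      p / (p - 1) * (s - d / p) < q / (q - 1) * (1 - (d + α) / q) →
      ∃ a u : EuclideanSpace ℝ (Fin (n + 1)) → ℝ,
        IsWeight α a ∧ IsBoundaryValue u ∧ LavrentievGap s p q a u) ∧
    -- subcritical case, the barrier `C_l^{d-1} × {0}`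
    (s - d / p < 0 → 0 < α → ∀ l : ℝ, 0 < l → l < 1 / 2 →
      s - (d - cantorDim n l) / p < 0 →
      0 < 1 - (d - cantorDim n l) / q - α / q →
      ∃ ρ ρa η χ : EuclideanSpace ℝ (Fin (n + 1)) → ℝ,
        IsConeCutoff (fun x => Metric.infDist (horiz x) (cantorProd n l))
          (fun x => |vert x|) 2 4 ρ ∧
        IsConeCutoff (fun x => Metric.infDist (horiz x) (cantorProd n l))
          (fun x => |vert x|) (1 / 2) 2 ρa ∧
        IsBoxCutoff (4 / 6) (5 / 6) η ∧ IsBoxCutoff 2 3 χ ∧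
        RealizesGap s p q α {v | Continuous v}
          (fun x => χ x * (|vert x| ^ α * ρa x))
          (fun x => χ x * (1 / 2 * Real.sign (vert x) * ρ x))
          (fun x => (1 - η x) * (χ x * (1 / 2 * Real.sign (vert x) * ρ x)))) ∧
    -- supercritical case, the barrier `{0} × C_l`
    (0 < s - d / p → 0 < α → α ≤ 1 → ∀ l : ℝ, 0 < l → l < 1 / 2 →
      p / (p - 1) * (s - d / p) < cantorDim 1 l →
      cantorDim 1 l < q / (q - 1) * (1 - (d + α) / q) →
      ∃ (μ : MeasureTheory.Measure ℝ) (u₀ ρa η χ : EuclideanSpace ℝ (Fin (n + 1)) → ℝ),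
        IsCantorMeasure l μ ∧ IsSaddle u₀ ∧
        IsConeCutoff (fun x => Metric.infDist (vert x) (cantor l))
          (fun x => ‖horiz x‖) (1 / 2) 2 ρa ∧
        IsBoxCutoff (4 / 6) (5 / 6) η ∧ IsBoxCutoff 2 3 χ ∧
        RealizesGap s p q α {v | Continuous v ∧ ContDiffOn ℝ 1 v (box (n + 1) 1)}
          (fun x => χ x * (‖horiz x‖ ^ α * (1 - ρa x)))
          (fun x => χ x * ∫ t, u₀ (x - EuclideanSpace.single (Fin.last n) t) ∂μ)
          (fun x => (1 - η x) *
            (χ x * ∫ t, u₀ (x - EuclideanSpace.single (Fin.last n) t) ∂μ))) := by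
  subst hd
  have hp0 : 0 < p := by linarith
  have hq0 : 0 < q := by linarith
  have hp1 : 0 < p - 1 := by linarith
  have hq1 : 0 < q - 1 := by linarith
  have eL : p / (p - 1) * (s - ((n : ℝ) + 1) / p) = (s * p - (n + 1)) / (p - 1) := by field_simp
  have eR : ∀ β : ℝ, q / (q - 1) * (1 - ((n : ℝ) + 1 + β) / q) = (q - (n + 1) - β) / (q - 1) :=
    fun β => by field_simp; ring
  obtain ⟨η, hη⟩ := exists_isBoxCutoff (n + 1) (show (0 : ℝ) < 4 / 6 by norm_num)
    (show (4 / 6 : ℝ) < 5 / 6 by norm_num)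
  obtain ⟨χ, hχ⟩ := exists_isBoxCutoff (n + 1) (show (0 : ℝ) < 2 by norm_num)
    (show (2 : ℝ) < 3 by norm_num)
  refine ⟨fun h1 hα h2 => ?_, fun h1 hα hα1 h2 => ?_, fun _ hα l h0 hl h2 h3 => ?_,
    fun _ hα hα1 l h0 hl h2 h3 => ?_⟩
  · refine exists_lavrentievGap_latBarrier hn hs₀ hs₁ hp hq hα ?_ h2
    rwa [sub_neg, lt_div_iff₀ hp0] at h1
  · have hsup : (n : ℝ) + 1 < s * p := by rwa [sub_pos, div_lt_iff₀ hp0] at h1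
    rw [eL, eR] at h2
    rcases hα.eq_or_lt with rfl | hα0
    · -- a weight of a small positive order does for `α = 0`
      set L := (s * p - (n + 1)) / (p - 1) with hL
      rw [sub_zero, lt_div_iff₀ hq1] at h2
      have hβ : 0 < min 1 ((q - (n + 1) - L * (q - 1)) / 2) := lt_min one_pos (by linarith)
      obtain ⟨a, u, ha, hu, hgap⟩ := exists_lavrentievGap_axBarrier hn hs₀ hs₁ hp hq hβ
        (min_le_left _ _) hsup (by
          rw [← hL, lt_div_iff₀ hq1]
          linarith [min_le_right 1 ((q - (n + 1) - L * (q - 1)) / 2)])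
      exact ⟨a, u, ha.zero, hu, hgap⟩
    · exact exists_lavrentievGap_axBarrier hn hs₀ hs₁ hp hq hα0 hα1 hsup h2
  · have c1 : s * p < n + 1 - cantorDim n l := by
      rwa [sub_neg, lt_div_iff₀ hp0] at h2
    have c2 : n + 1 - cantorDim n l + α < q := by
      rw [sub_sub, ← add_div, sub_pos, div_lt_one hq0] at h3
      exact h3
    exact ⟨coneCutoff (latDist n l) (fun x => |vert x|) 2 4,
      coneCutoff (latDist n l) (fun x => |vert x|) (1 / 2) 2, η, χ,
      isConeCutoff_latDist n l (by norm_num) (by norm_num),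
      isConeCutoff_latDist n l (by norm_num) (by norm_num), hη, hχ,
      realizesGap_latBarrier hs₀ hs₁ hp hq hα h0 hl c1 hη hχ
        (exists_lower_bound_latWeight hq hα h0 hl c2 hχ)⟩
  · have hdim : cantorDim 1 l = cantorExp l := by rw [cantorDim_eq, Nat.cast_one, one_mul]
    rw [eL, hdim, div_lt_iff₀ hp1] at h2
    rw [eR, hdim, lt_div_iff₀ hq1] at h3
    exact ⟨cantorMeasure l, saddle, coneCutoff (axDist l) (fun x => ‖horiz x‖) (1 / 2) 2, η, χ,
      isCantorMeasure_cantorMeasure h0 hl, isSaddle_saddle n,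
      isConeCutoff_axDist l (by norm_num) (by norm_num), hη, hχ,
      realizesGap_axBarrier hs₀ hs₁ hp hq hα hα1 h0 hl h2 hη hχ
        (exists_lower_bound_axWeight hn hq hα hα1 h0 hl h3 hχ)⟩
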